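/- Setting. Let $K\ge m$ be positive integers and $\mathcal K_m$ the family of subsets of $[K]$ of size $m$. Sources $1,\dots,K$ produce random vectors $X_n=(X_n^1,\dots,X_n^K)$, $n\ge 1$, independent over time, with values in $\mathcal X^K$ for a measurable space $\mathcal X$; $X_n$ has law $\mathsf F$ for $n\le\nu$ and law $\mathsf G$ for $n>\nu$, where $\nu\ge 0$ is the deterministic change-point and $\mathsf G$ belongs to a family $\mathcal G$. $\mathbb P_\nu^{\mathsf G}$ is the resulting law, and $\mathbb P_\infty$ the law without change. For $E\in\mathcal K_m$ let $X_n^E=(X_n^k)_{k\in E}$, let $\mathsf F^E,\mathsf G^E$ be its laws under $\mathsf F,\mathsf G$, and let $\mathcal A(\mathsf G)=\{E\in\mathcal K_m:\mathsf G^E\ne\mathsf F^E\}$ and $\mathcal G^E=\{\mathsf G^E:\mathsf G\in\mathcal G,\ \mathsf G^E\neq\mathsf F^E\}$. Assume that $\mathsf G^E$ and $\mathsf F^E$ are mutually absolutely continuous for all $\mathsf G\in\mathcal G$, $E\in\mathcal A(\mathsf G)$, and put $\mathcal I_0^E(\mathsf G)=\mathrm{KL}(\mathsf G^E\|\mathsf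 F^E)$. A policy $(S,T)$ consists of a $\mathcal K_m$-valued sampling rule $S=(S_n)_{n\ge1}$, with $S_n$ measurable with respect to $\mathcal F^S_{n-1}$, and a stopping time $T\ge1$ of $(\mathcal F_n^S)$, where $\mathcal F^S_n=\sigma(\mathcal F^S_{n-1},X_n^{S_n})$ and $\mathcal F_0^S$ is a $\sigma$-algebra (of a randomization device) independent of the observations. Let $\Delta(\gamma)$ be the set of policies with $\mathbb E_\infty[T]\ge\gamma$, and $$D^{\mathsf G}(S,T)=\sup_{\nu\ge0}\ \operatorname{ess\,sup}\ \mathbb E_\nu^{\mathsf G}\big[T-\nu\,\big|\,\mathcal F^S_\nu(\mathsf G),\,T>\nu\big],\qquad \mathcal F^S_\nu(\mathsf G)=\sigma\big(S_t,X_t^{S_t}: 1\le t\le\nu,\ S_t\in\mathcal A(\mathsf G)\big).$$ Let $\mathcal U\subseteq\mathcal K_m$ be a non-empty family of "units" such that $\mathcal G^E$ is non-empty and finite for every $E\in\mathcal U$; let $\mathsf H^E$ be the uniform mixture of the members of $\mathcal G^E$, and $\xi_n^E=\log\frac{d\mathsf H^E}{d\mathsf F^E}(X_n^E)$. The Round Robin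 CUSUM $(\tilde S,\tilde T)$ with threshold $A$ and a fixed enumeration $E_1,\dots,E_{|\mathcal U|}$ of $\mathcal U$ starts with $\tilde S_1=E_1$, $Y_0=0$, computes $Y_n=\max\{Y_{n-1},0\}+\xi_n^{\tilde S_n}$, keeps sampling the same unit if $0<Y_n<A$, moves to the cyclically next unit if $Y_n\le0$, and stops at $\tilde T=\inf\{n\ge1:Y_n\ge A\}$. Corollary. Fix $\mathsf G\in\mathcal G$ with $\mathcal A(\mathsf G)\cap\mathcal U\neq\emptyset$. Suppose there are laws $\mathsf F^*,\mathsf G^*$ on $\mathcal X^m$ such that, under a suitable identification of each unit $E$ with $[m]$, $\mathsf F^E=\mathsf F^*$ for every $E\in\mathcal U$, and $(\mathsf G')^E=\mathsf G^*$ for every $\mathsf G'\in\mathcal G$ and every $E\in\mathcal A(\mathsf G')\cap\mathcal U$; and suppose that $\mathrm{KL}(\mathsf G^*\|\mathsf F^*)<\infty$ and $\mathrm{KL}(\mathsf F^*\|\mathsf G^*)<\infty$. Then $$\int\log\frac{d\mathsf F^E}{d\mathsf H^E}\,d\mathsf F^E\in(0,\infty)\ \ \text{for every }E\in\mathcal U,\qquad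 \int\log\frac{d\mathsf H^E}{d\mathsf F^E}\,d\mathsf G^E\in(0,\infty)\ \ \text{for every }E\in\mathcal A(\mathsf G)\cap\mathcal U.$$ If, in addition, $\int\big(\log\frac{d\mathsf G^E}{d\mathsf F^E}\big)^2d\mathsf G^E<\infty$ for every $E\in\mathcal A(\mathsf G)$, and either $\mathcal U=\mathcal K_m$ or $\max_{E\in\mathcal A(\mathsf G)}\mathcal I_0^E(\mathsf G)=\mathrm{KL}(\mathsf G^*\|\mathsf F^*)$, then $(\tilde S,\tilde T)$ with $A=\log\gamma$ is asymptotically optimal under $\mathsf G$, i.e. $$\lim_{\gamma\to\infty}\ \frac{D^{\mathsf G}(\tilde S,\tilde T)}{\inf\{D^{\mathsf G}(S,T):(S,T)\in\Delta(\gamma)\}}=1 .$$ -/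

import Mathlib

open MeasureTheory Filter Topology
open scoped ENNReal ProbabilityTheory

universe v w

noncomputable section

namespace RoundRobin

/-- The family of all sets of exactly `m` of the `K` sources. -/
abbrev Subsets (K m : ℕ) : Type := {E : Finset (Fin K) // E.card = m}

section Model

variable {K m : ℕ} {𝒳 : Type v}

/-- The observation from the sources in `E` when all sources together produce `x`:
the coordinates of `x` in `E`, listed in increasing order of the sources. -/
def obs (E : Subsets K m) (x : Fin K → 𝒳) : Fin m → 𝒳 :=
  fun i => x (E.1.orderEmbOfFin E.2 i)

variable [MeasurableSpace 𝒳]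

/-- The local distribution of `E` when the global distribution is `P`. -/
def localLaw (P : ProbabilityMeasure (Fin K → 𝒳)) (E : Subsets K m) : Measure (Fin m → 𝒳) :=
  (P : Measure (Fin K → 𝒳)).map (obs E)

/-- The sets of `m` sources whose local distribution is affected by a change from `F` to `G`. -/
def affected (m : ℕ) (F G : ProbabilityMeasure (Fin K → 𝒳)) : Set (Subsets K m) :=
  {E | localLaw G E ≠ localLaw F E}

/-- The plausible post-change local distributions of `E`. -/
def postFamily (F : ProbabilityMeasure (Fin K → 𝒳)) (𝒢 : Set (ProbabilityMeasure (Fin K → 𝒳)))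
    (E : Subsets K m) : Set (Measure (Fin m → 𝒳)) :=
  {P | ∃ G ∈ 𝒢, localLaw G E = P ∧ P ≠ localLaw F E}

/-- The uniform mixture of the plausible post-change local distributions of `E`. -/
def mixture (F : ProbabilityMeasure (Fin K → 𝒳)) (𝒢 : Set (ProbabilityMeasure (Fin K → 𝒳)))
    (E : Subsets K m) : Measure (Fin m → 𝒳) :=
  ((postFamily F 𝒢 E).ncard : ℝ≥0∞)⁻¹ •
    Measure.sum (fun P : postFamily F 𝒢 E => (P : Measure (Fin m → 𝒳)))

/-- The log-likelihood ratio of the mixture against the pre-change local distribution of `E`. -/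
def xi (F : ProbabilityMeasure (Fin K → 𝒳)) (𝒢 : Set (ProbabilityMeasure (Fin K → 𝒳)))
    (E : Subsets K m) : (Fin m → 𝒳) → ℝ :=
  llr (mixture F 𝒢 E) (localLaw F E)

/-- The information number of `E` under `G`: the Kullback-Leibler divergence between its
post-change and its pre-change local distribution. -/
def info (F G : ProbabilityMeasure (Fin K → 𝒳)) (E : Subsets K m) : ℝ≥0∞ :=
  InformationTheory.klDiv (localLaw G E) (localLaw F E)

/-- `X₁, X₂, …` as a path; the value of the path at `i : ℕ` is `X_{i+1}`. -/
abbrev Path (K : ℕ) (𝒳 : Type v) : Type v := ℕ → Fin K → 𝒳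

/-- The law of the sequence of observations when there is no change. -/
def noChangeLaw (F : ProbabilityMeasure (Fin K → 𝒳)) : Measure (Path K 𝒳) :=
  Measure.infinitePi (fun _ : ℕ => (F : Measure (Fin K → 𝒳)))

/-- The law of the sequence of observations when `X_1, …, X_ν` have law `F` and
`X_{ν+1}, X_{ν+2}, …` have law `G`. -/
def changeLaw (F G : ProbabilityMeasure (Fin K → 𝒳)) (ν : ℕ) : Measure (Path K 𝒳) :=
  Measure.infinitePi (fun i : ℕ =>
    if i < ν then (F : Measure (Fin K → 𝒳)) else (G : Measure (Fin K → 𝒳)))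

/-- The filtration of the collected observations under the sampling rule `S`, where `S n` is the
set sampled at time `n + 1`. At time `0` it is the information of the randomization device. -/
@[reducible] def history {Rand : Type w} [mR : MeasurableSpace Rand]
    (S : ℕ → Rand × Path K 𝒳 → Subsets K m) : ℕ → MeasurableSpace (Rand × Path K 𝒳)
  | 0 => mR.comap Prod.fst
  | n + 1 => history S n ⊔
      MeasurableSpace.comap (fun ω => obs (S n ω) (ω.2 n)) inferInstance

/-- The information collected up to time `ν` from the sets in `𝒜`: the σ-algebra generated by
`S_t` and `X_t^{S_t}` for those `1 ≤ t ≤ ν` at which `S_t ∈ 𝒜`. -/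
@[reducible] def partialHistory {Rand : Type w} (S : ℕ → Rand × Path K 𝒳 → Subsets K m)
    (𝒜 : Set (Subsets K m)) (ν : ℕ) : MeasurableSpace (Rand × Path K 𝒳) :=
  MeasurableSpace.generateFrom
    {s | ∃ t < ν, ∃ E ∈ 𝒜, ∃ B : Set (Fin m → 𝒳), MeasurableSet B ∧
      s = {ω | S t ω = E ∧ obs E (ω.2 t) ∈ B}}

variable (K m 𝒳) in
/-- A joint sequential sampling rule and change-detection policy. It may use a randomization
device `Rand` with law `ρ`, independent of the observations. -/
structure Policy where
  /-- the randomization device -/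
  Rand : Type w
  [mRand : MeasurableSpace Rand]
  /-- the law of the randomization device -/
  ρ : Measure Rand
  [isProb : IsProbabilityMeasure ρ]
  /-- the sampling rule: `S n` is the set sampled at time `n + 1` -/
  S : ℕ → Rand × Path K 𝒳 → Subsets K m
  /-- the time of the alarm -/
  T : Rand × Path K 𝒳 → ℕ∞
  adapted : ∀ n E, MeasurableSet[history S n] {ω | S n ω = E}
  one_le : ∀ ω, 1 ≤ T ω
  stopping : ∀ n : ℕ, MeasurableSet[history S n] {ω | T ω = n}

attribute [instance] Policy.mRand Policy.isProb

/-- The expected time of the alarm when there is no change. -/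
def meanTimeToFalseAlarm (F : ProbabilityMeasure (Fin K → 𝒳)) (π : Policy.{v, w} K m 𝒳) : ℝ≥0∞ :=
  ∫⁻ ω, (π.T ω : ℝ≥0∞) ∂(π.ρ.prod (noChangeLaw F))

/-- The policies whose expected time until a false alarm is at least `γ`. -/
def Delta (m : ℕ) (F : ProbabilityMeasure (Fin K → 𝒳)) (γ : ℝ) : Set (Policy.{v, w} K m 𝒳) :=
  {π | ENNReal.ofReal γ ≤ meanTimeToFalseAlarm F π}

/-- The worst-case conditional expected detection delay under `G`: the supremum over the
change-points `ν` of the essential supremum of the conditional expectation of `T - ν`, given the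
history up to `ν` from the affected sets and given the event `T > ν`. -/
def delay (F G : ProbabilityMeasure (Fin K → 𝒳)) (π : Policy.{v, w} K m 𝒳) : ℝ≥0∞ :=
  ⨆ ν : ℕ,
    let μ : Measure (π.Rand × Path K 𝒳) :=
      ProbabilityTheory.cond (π.ρ.prod (changeLaw F G ν)) {ω | (ν : ℕ∞) < π.T ω}
    essSup (condLExp (partialHistory π.S (affected m F G) ν) μ
      (fun ω => (π.T ω : ℝ≥0∞) - (ν : ℝ≥0∞))) μ

end Model

section Procedure

variable {K m : ℕ} {𝒳 : Type v} [MeasurableSpace 𝒳]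
  (F : ProbabilityMeasure (Fin K → 𝒳)) (𝒢 : Set (ProbabilityMeasure (Fin K → 𝒳)))
  {N : ℕ} [NeZero N] (u : Fin N → Subsets K m)

/-- The state of the Round Robin CUSUM after `n` observations: the (cyclic) index in the list `u`
of units of the unit to be sampled at time `n + 1`, and the statistic `Y_n`. -/
def state (x : Path K 𝒳) : ℕ → Fin N × ℝ
  | 0 => (0, 0)
  | n + 1 =>
    let d := (state x n).1
    let y := max (state x n).2 0 + xi F 𝒢 (u d) (obs (u d) (x n))
    (if y ≤ 0 then d + 1 else d, y)

/-- The sampling rule of the Round Robin CUSUM. -/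
def rrSample (n : ℕ) (ω : PUnit.{w + 1} × Path K 𝒳) : Subsets K m :=
  u (state F 𝒢 u ω.2 n).1

/-- The stopping rule of the Round Robin CUSUM: the first time `n ≥ 1` with `Y_n ≥ A`. -/
def rrStop (A : ℝ) (ω : PUnit.{w + 1} × Path K 𝒳) : ℕ∞ :=
  ⨅ (n : ℕ) (_ : 1 ≤ n ∧ A ≤ (state F 𝒢 u ω.2 n).2), (n : ℕ∞)

lemma measurable_obs (E : Subsets K m) : Measurable (obs (𝒳 := 𝒳) E) :=
  measurable_pi_lambda _ fun _ => measurable_pi_apply _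

lemma measurable_xi (E : Subsets K m) : Measurable (xi F 𝒢 E) :=
  measurable_llr _ _

lemma history_mono {Rand : Type w} [MeasurableSpace Rand]
    (S : ℕ → Rand × Path K 𝒳 → Subsets K m) : Monotone (history S) :=
  monotone_nat_of_le_succ fun _ => le_sup_left

lemma measurable_state (n : ℕ) :
    Measurable[history (rrSample.{v, w} F 𝒢 u) n]
      (fun ω : PUnit.{w + 1} × Path K 𝒳 => state F 𝒢 u ω.2 n) := by
  induction n with
  | zero => exact measurable_const
  | succ n ih =>
    have h1 : Measurable[history (rrSample.{v, w} F 𝒢 u) (n + 1)]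
        (fun ω : PUnit.{w + 1} × Path K 𝒳 => state F 𝒢 u ω.2 n) :=
      ih.mono (history_mono _ n.le_succ) le_rfl
    have h2 : Measurable[history (rrSample.{v, w} F 𝒢 u) (n + 1)]
        (fun ω : PUnit.{w + 1} × Path K 𝒳 => obs (rrSample F 𝒢 u n ω) (ω.2 n)) :=
      (comap_measurable _).mono le_sup_right le_rfl
    let g : (Fin m → 𝒳) × ℝ → Fin N → Fin N × ℝ := fun p d =>
      (if max p.2 0 + xi F 𝒢 (u d) p.1 ≤ 0 then d + 1 else d, max p.2 0 + xi F 𝒢 (u d) p.1)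
    have hg : Measurable (fun q : ((Fin m → 𝒳) × ℝ) × Fin N => g q.1 q.2) := by
      refine measurable_from_prod_countable_left fun d => ?_
      have hy : Measurable fun p : (Fin m → 𝒳) × ℝ => max p.2 0 + xi F 𝒢 (u d) p.1 :=
        (measurable_snd.max measurable_const).add ((measurable_xi F 𝒢 _).comp measurable_fst)
      exact (Measurable.ite (measurableSet_le hy measurable_const)
        measurable_const measurable_const).prodMk hy
    exact hg.comp ((h2.prodMk (measurable_snd.comp h1)).prodMk (measurable_fst.comp h1))

/-- The Round Robin CUSUM with threshold `A` and list of units `u`. -/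
def roundRobin (A : ℝ) : Policy.{v, w} K m 𝒳 where
  Rand := PUnit.{w + 1}
  ρ := Measure.dirac PUnit.unit
  S := rrSample F 𝒢 u
  T := rrStop F 𝒢 u A
  adapted n E := (measurable_fst.comp (measurable_state F 𝒢 u n)) (.of_discrete (s := {d | u d = E}))
  one_le ω := le_iInf₂ fun n hn => by exact_mod_cast hn.1
  stopping n := by
    have key : {ω : PUnit.{w + 1} × Path K 𝒳 | rrStop F 𝒢 u A ω = n} =
        {ω | (1 ≤ n ∧ A ≤ (state F 𝒢 u ω.2 n).2) ∧
          ∀ k < n, ¬ (1 ≤ k ∧ A ≤ (state F 𝒢 u ω.2 k).2)} := by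
      ext ω
      simp only [Set.mem_ofPred_eq, rrStop]
      constructor
      · intro h
        have hmin : ∀ k < n, ¬ (1 ≤ k ∧ A ≤ (state F 𝒢 u ω.2 k).2) := by
          intro k hk hc
          have h3 : (n : ℕ∞) ≤ k := h ▸ iInf₂_le k hc
          exact absurd (by exact_mod_cast h3) (not_le.2 hk)
        refine ⟨?_, hmin⟩
        by_contra hc
        have : ((n + 1 : ℕ) : ℕ∞) ≤ n := by
          rw [← h]
          refine le_iInf₂ fun k hk => ?_
          have : n + 1 ≤ k := by
            by_contra hlt
            rcases (Nat.lt_succ_iff.1 (not_le.1 hlt)).lt_or_eq with h4 | h4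
            · exact hmin k h4 hk
            · exact hc (h4 ▸ hk)
          exact_mod_cast this
        have : n + 1 ≤ n := by exact_mod_cast this
        omega
      · rintro ⟨h1, h2⟩
        refine le_antisymm (iInf₂_le n h1) (le_iInf₂ fun k hk => ?_)
        exact_mod_cast not_lt.1 fun hlt => h2 k hlt hk
    rw [key]
    have hs : ∀ k ≤ n, MeasurableSet[history (rrSample.{v, w} F 𝒢 u) n]
        {ω : PUnit.{w + 1} × Path K 𝒳 | 1 ≤ k ∧ A ≤ (state F 𝒢 u ω.2 k).2} := fun k hk =>
      history_mono _ hk _ ((MeasurableSet.const _).inter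
        ((measurable_snd.comp (measurable_state F 𝒢 u k)) measurableSet_Ici))
    have hi : MeasurableSet[history (rrSample.{v, w} F 𝒢 u) n]
        (⋂ k : Fin n, {ω : PUnit.{w + 1} × Path K 𝒳 |
          1 ≤ (k : ℕ) ∧ A ≤ (state F 𝒢 u ω.2 k).2}ᶜ) :=
      .iInter fun k => (hs k k.2.le).compl
    convert (hs n le_rfl).inter hi using 1
    ext ω
    simp only [Set.mem_inter_iff, Set.mem_iInter, Set.mem_compl_iff, Set.mem_ofPred_eq]
    exact and_congr_right fun _ => ⟨fun h k => h k k.2, fun h k hk => h ⟨k, hk⟩⟩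

/-- Asymptotic optimality under `G` of the Round Robin CUSUM with threshold `log γ`: as `γ → ∞`,
its worst-case delay is asymptotically equivalent to the smallest possible one among all policies
whose expected time until a false alarm is at least `γ`. -/
def AsymptoticallyOptimal (G : ProbabilityMeasure (Fin K → 𝒳)) : Prop :=
  Tendsto (fun γ : ℝ => delay F G (roundRobin.{v, w} F 𝒢 u (Real.log γ)) /
    ⨅ π ∈ Delta.{v, w} m F γ, delay F G π) atTop (𝓝 1)

end Procedure

section Conditions

variable {K m : ℕ} {𝒳 : Type v} [MeasurableSpace 𝒳]
  (F : ProbabilityMeasure (Fin K → 𝒳)) (𝒢 : Set (ProbabilityMeasure (Fin K → 𝒳)))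
  (U : Finset (Subsets K m))

/-- Before the change the statistic of every unit has finite negative drift: the divergence
`∫ log (dF^E / dH^E) dF^E = - ∫ ξ^E dF^E` is (well defined and) in `(0, ∞)`. -/
def PreChangeDrift : Prop :=
  ∀ E ∈ U, Integrable (xi F 𝒢 E) (localLaw F E) ∧
    Integrable (llr (localLaw F E) (mixture F 𝒢 E)) (localLaw F E) ∧
    ∫ y, xi F 𝒢 E y ∂(localLaw F E) =
      - ∫ y, llr (localLaw F E) (mixture F 𝒢 E) y ∂(localLaw F E) ∧
    0 < ∫ y, llr (localLaw F E) (mixture F 𝒢 E) y ∂(localLaw F E)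

/-- After the change the statistic of every affected unit has finite positive drift. -/
def PostChangeDrift (G : ProbabilityMeasure (Fin K → 𝒳)) : Prop :=
  ∀ E ∈ U, E ∈ affected m F G → Integrable (xi F 𝒢 E) (localLaw G E) ∧
    0 < ∫ y, xi F 𝒢 E y ∂(localLaw G E)

/-- The log-likelihood ratio of every affected set of `m` sources has a finite second moment. -/
def SecondMoment (m : ℕ) (G : ProbabilityMeasure (Fin K → 𝒳)) : Prop :=
  ∀ E ∈ affected m F G,
    Integrable (fun y => (llr (localLaw G E) (localLaw F E) y) ^ 2) (localLaw G E)

/-- All units have, up to a listing of the sources of the unit, the same pre-change local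
distribution `Fs`, and all affected units have, in the same listing and under every plausible
post-change global distribution, the same post-change local distribution `Gs`. -/
def Homogeneous (Fs Gs : Measure (Fin m → 𝒳)) : Prop :=
  ∀ E ∈ U, ∃ σ : Equiv.Perm (Fin m),
    (localLaw F E).map (fun y i => y (σ i)) = Fs ∧
    ∀ G ∈ 𝒢, E ∈ affected m F G → (localLaw G E).map (fun y i => y (σ i)) = Gs

end Conditions

end RoundRobin

end

namespace RoundRobin

/-! By homogeneity the mixture of a unit is a single law, so every increment of the statistic is a
log-likelihood ratio. It has the law μ₀ of log(dG*/dF*) under F* for every unit before the change,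
and for unaffected units also after it; for affected units after the change it has the law μ₁ of the
same variable under G*. The mean of μ₀ is -KL(F*‖G*) < 0 and that of μ₁ is I = KL(G*‖F*) > 0, which
is the first claim. Optimality follows from three estimates, combined in
`asymptoticallyOptimal_of_bounds`.

False alarms (`exp_le_meanTimeToFalseAlarm`). Since μ₀ has exponential moment 1, the conditional
mean of exp Y_{n+1} is exp(max(Y_n, 0)) ≤ exp Y_n + 1. Hence reaching the level A takes at least exp
A steps in the mean, which is γ when A = log γ.

Lower bound (`eventually_le_delay`). If the mean time until a false alarm is at least γ, then in
some window of length h close to (log γ)/I an alarm has conditional probability of order at most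
(log γ)/γ. When the change occurs at the start of this window, this probability grows at most by the
likelihood ratio. The drift of its logarithm is at most I whatever is sampled, so by Chebyshev it
stays below h(I + δ) with high probability. An alarm in the window is then still unlikely.

Upper bound (`exists_delay_roundRobin_le`). A Lyapunov function bounds the mean remaining time by (1
+ o(1))A/I, plus a multiple of the height of the statistic if an unaffected unit is sampled at the
change-point. That height could be of order A. However, the conditioning does not see observations
from unaffected sets. Since the last reset the statistic is therefore a random walk conditioned only
on staying in (0, A), and by `strip_height_le` its conditional mean height is o(A), uniformly in the
time since the reset.

For the latter, an exponential tilt with some θ in (0, 1) makes the step centred. By the central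
limit theorem a centred walk moves by any distance κ, in a suitable number of steps, with a
probability bounded below independently of κ. Descending through the strip in A/κ such blocks thus
costs at most a factor exp(-cA) with c as small as desired (`strip_one_le_exp_mul`). Undoing the
tilt bounds the mean of exp(θ · height), given confinement, by exp(cA) times a constant, so heights
above εA/2 contribute negligibly. -/

/-- The expectation of `φ (y + S_n)` on the event that `y + S_1, …, y + S_n` belong to `I`, where
`S` is the random walk with step distribution `μ`. -/
noncomputable def strip (μ : Measure ℝ) (I : Set ℝ) : ℕ → (ℝ → ℝ≥0∞) → ℝ → ℝ≥0∞
  | 0, φ, y => φ y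
  | n + 1, φ, y => ∫⁻ x, I.indicator (strip μ I n φ) (y + x) ∂μ

/-! ### Random walks killed on leaving a set -/

section Strip

variable {μ : Measure ℝ} {I : Set ℝ}

lemma measurable_strip [SFinite μ] (hI : MeasurableSet I) {φ : ℝ → ℝ≥0∞} (hφ : Measurable φ)
    (n : ℕ) : Measurable (strip μ I n φ) := by
  induction n with
  | zero => exact hφ
  | succ n ih =>
    have h : Measurable fun q : ℝ × ℝ => I.indicator (strip μ I n φ) (q.1 + q.2) :=
      (ih.indicator hI).comp (measurable_fst.add measurable_snd)
    exact h.lintegral_prod_right'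

/-- Translation by `c` turns a path confined to `I` into a path confined to `J`. The starting point
is not subject to the confinement, so the comparison at `y` is a separate hypothesis; it matters
only when no step is taken. -/
lemma strip_le_strip_shift {J : Set ℝ} {φ ψ : ℝ → ℝ≥0∞} {c : ℝ}
    (h : ∀ z ∈ I, z + c ∈ J ∧ φ z ≤ ψ (z + c)) (n : ℕ) {y : ℝ} (hy : φ y ≤ ψ (y + c)) :
    strip μ I n φ y ≤ strip μ J n ψ (y + c) := by
  induction n generalizing y with
  | zero => exact hy
  | succ n ih =>
    refine lintegral_mono fun x => ?_
    by_cases hx : y + x ∈ I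
    · have h1 := ih (h _ hx).2
      have h2 := (h _ hx).1
      have e : y + x + c = y + c + x := by ring
      rw [e] at h1 h2
      rw [Set.indicator_of_mem hx, Set.indicator_of_mem h2]
      exact h1
    · simp [Set.indicator_of_notMem hx]

lemma strip_mono_on {φ ψ : ℝ → ℝ≥0∞} (h : ∀ z ∈ I, φ z ≤ ψ z) (n : ℕ) {y : ℝ}
    (hy : φ y ≤ ψ y) : strip μ I n φ y ≤ strip μ I n ψ y := by
  have := strip_le_strip_shift (μ := μ) (I := I) (J := I) (φ := φ) (ψ := ψ) (c := 0)
    (fun z hz => by simpa using ⟨hz, h z hz⟩) n (y := y) (by simpa using hy)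
  simpa using this

/-- Markov property of the killed walk at time `m`. -/
lemma strip_add_steps (φ : ℝ → ℝ≥0∞) (m n : ℕ) (y : ℝ) :
    strip μ I (m + n) φ y = strip μ I m (strip μ I n φ) y := by
  induction m generalizing y with
  | zero => simp [strip]
  | succ m ih =>
    rw [Nat.succ_add]
    refine lintegral_congr fun x => ?_
    by_cases hx : y + x ∈ I <;> simp [hx, ih]

lemma strip_const_mul {c : ℝ≥0∞} (hc : c ≠ ∞) (φ : ℝ → ℝ≥0∞) (n : ℕ) (y : ℝ) :
    strip μ I n (fun z => c * φ z) y = c * strip μ I n φ y := by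
  induction n generalizing y with
  | zero => rfl
  | succ n ih =>
    simp only [strip]
    rw [← lintegral_const_mul' _ _ hc]
    refine lintegral_congr fun x => ?_
    by_cases hx : y + x ∈ I <;> simp [hx, ih]

lemma strip_add_fun [SFinite μ] (hI : MeasurableSet I) {φ ψ : ℝ → ℝ≥0∞} (hφ : Measurable φ)
    (n : ℕ) (y : ℝ) :
    strip μ I n (fun z => φ z + ψ z) y = strip μ I n φ y + strip μ I n ψ y := by
  induction n generalizing y with
  | zero => rfl
  | succ n ih =>
    simp only [strip]
    rw [← lintegral_add_left]
    · refine lintegral_congr fun x => ?_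
      by_cases hx : y + x ∈ I <;> simp [hx, ih]
    · exact ((measurable_strip hI hφ n).indicator hI).comp (measurable_const_add y)

lemma strip_one_le [IsProbabilityMeasure μ] (n : ℕ) (y : ℝ) : strip μ I n 1 y ≤ 1 := by
  induction n generalizing y with
  | zero => exact le_rfl
  | succ n ih =>
    calc strip μ I (n + 1) 1 y ≤ ∫⁻ _, 1 ∂μ := lintegral_mono fun x => by
          by_cases hx : y + x ∈ I <;> simp [hx, ih]
      _ = 1 := by simp

/-- Exponential change of measure for the random walk in a strip. -/
lemma strip_tilted {μ' : Measure ℝ} {θ M : ℝ} (hM : 0 < M)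
    (h : ∀ g : ℝ → ℝ≥0∞,
      ∫⁻ x, g x ∂μ' = ∫⁻ x, ENNReal.ofReal (M⁻¹ * Real.exp (θ * x)) * g x ∂μ)
    (ψ : ℝ → ℝ≥0∞) (n : ℕ) (y : ℝ) :
    strip μ' I n ψ y = ENNReal.ofReal (M⁻¹ ^ n * Real.exp (-(θ * y))) *
      strip μ I n (fun z => ENNReal.ofReal (Real.exp (θ * z)) * ψ z) y := by
  -- The densities of the steps multiply to `M⁻¹ ^ n` times the exponential of θ (endpoint - start).
  induction n generalizing y with
  | zero =>
    simp only [strip]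
    rw [← mul_assoc, ← ENNReal.ofReal_mul (by positivity), pow_zero, one_mul, ← Real.exp_add]
    simp
  | succ n ih =>
    simp only [strip]
    rw [h, ← lintegral_const_mul' _ _ ENNReal.ofReal_ne_top]
    refine lintegral_congr fun x => ?_
    by_cases hx : y + x ∈ I
    · rw [Set.indicator_of_mem hx, Set.indicator_of_mem hx, ih, ← mul_assoc,
        ← ENNReal.ofReal_mul (by positivity)]
      congr 2
      have : Real.exp (-(θ * (y + x))) = Real.exp (-(θ * y)) * Real.exp (-(θ * x)) := by
        rw [← Real.exp_add]; ring_nf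
      rw [this, pow_succ, Real.exp_neg (θ * x)]
      field_simp
    · simp [hx]

/-- A random walk whose steps belong to `[α, β]` with probability at least `q`. -/
lemma pow_le_strip_of_steps {A α β : ℝ} {q : ℝ≥0∞} (hq : q ≤ μ (Set.Icc α β)) (n : ℕ) {y : ℝ}
    (h : ∀ i : ℕ, 1 ≤ i → i ≤ n → 0 < y + i * α ∧ y + i * β < A) :
    q ^ n ≤ strip μ (Set.Ioo 0 A) n ((Set.Icc (y + n * α) (y + n * β)).indicator 1) y := by
  induction n generalizing y with
  | zero => simp [strip]
  | succ n ih =>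
    have key : ∀ x, (Set.Icc α β).indicator (fun _ => q ^ n) x ≤
        (Set.Ioo 0 A).indicator (strip μ (Set.Ioo 0 A) n
          ((Set.Icc (y + (n + 1 : ℕ) * α) (y + (n + 1 : ℕ) * β)).indicator 1)) (y + x) := by
      intro x
      by_cases hx : x ∈ Set.Icc α β
      · have h1 := h 1 le_rfl (by omega)
        simp only [Nat.cast_one, one_mul] at h1
        have hm : y + x ∈ Set.Ioo 0 A := ⟨by linarith [hx.1], by linarith [hx.2]⟩
        rw [Set.indicator_of_mem hx, Set.indicator_of_mem hm]
        refine (ih (y := y + x) fun i hi hin => ?_).trans (strip_mono_on (fun z _ => ?_) n ?_)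
        · have h2 := h (i + 1) (by omega) (by omega)
          push_cast at h2
          exact ⟨by linarith [hx.1], by linarith [hx.2]⟩
        all_goals
          refine Set.indicator_le_indicator_of_subset (Set.Icc_subset_Icc ?_ ?_) (by simp) _
          all_goals push_cast; linarith [hx.1, hx.2]
      · simp [hx]
    calc q ^ (n + 1) ≤ q ^ n * μ (Set.Icc α β) := by rw [pow_succ]; gcongr
      _ = ∫⁻ x, (Set.Icc α β).indicator (fun _ => q ^ n) x ∂μ := by
          rw [lintegral_indicator measurableSet_Icc]; simp
      _ ≤ _ := lintegral_mono key

/-- The random walk goes down in blocks of `L` steps, keeping away from the ends of the strip. -/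
lemma pow_le_strip_of_blocks [IsProbabilityMeasure μ] {A B κ : ℝ} {L : ℕ} {p : ℝ≥0∞} (hκ : 0 < κ)
    (hB : 0 ≤ B) (hA : 5 * B ≤ A)
    (hdown : p ≤ strip μ (Set.Ioo (-B) B) L ((Set.Iic (-κ)).indicator 1) 0)
    (hup : p ≤ strip μ (Set.Ioo (-B) B) L ((Set.Ici κ).indicator 1) 0)
    (j r : ℕ) (hr : r ≤ L) {y : ℝ} (hy : y ∈ Set.Icc B (A - B)) :
    p ^ (j + 1) ≤ strip μ (Set.Ioo 0 A) (j * L + r)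
      ((Set.Iic (max (4 * B) (y - j * κ) + B)).indicator 1) y := by
  induction j generalizing y with
  | zero =>
    -- An unfinished block: confinement during `L` steps implies confinement during the first `r`.
    have h1 : p ≤ strip μ (Set.Ioo (-B) B) r 1 0 := by
      refine hdown.trans ?_
      obtain ⟨t, rfl⟩ := Nat.exists_eq_add_of_le hr
      rw [strip_add_steps]
      have h2 : ∀ z, strip μ (Set.Ioo (-B) B) t ((Set.Iic (-κ)).indicator 1) z ≤ 1 := fun z =>
        (strip_mono_on (fun z _ => Set.indicator_le_self' (by simp) z) t
          (Set.indicator_le_self' (by simp) z)).trans (strip_one_le t z)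
      exact strip_mono_on (fun z _ => h2 z) r (h2 0)
    simp only [zero_add, pow_one, zero_mul]
    refine h1.trans ?_
    have key := strip_le_strip_shift (μ := μ) (I := Set.Ioo (-B) B) (J := Set.Ioo 0 A) (φ := 1)
      (ψ := (Set.Iic (max (4 * B) (y - (0 : ℕ) * κ) + B)).indicator 1) (c := y)
      (fun z hz => ⟨⟨by linarith [hz.1, hy.1], by linarith [hz.2, hy.2]⟩, ?_⟩) r (y := 0) ?_
    · simpa using key
    · rw [Set.indicator_of_mem]
      · simp
      · have := le_max_right (4 * B) (y - (0 : ℕ) * κ)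
        simp only [Nat.cast_zero, zero_mul, sub_zero, Set.mem_Iic] at this ⊢
        linarith [hz.2]
    · rw [Set.indicator_of_mem]
      · simp
      · have := le_max_right (4 * B) (y - (0 : ℕ) * κ)
        simp only [Nat.cast_zero, zero_mul, sub_zero, Set.mem_Iic] at this ⊢
        linarith
  | succ j ih =>
    have e : (j + 1) * L + r = L + (j * L + r) := by ring
    rw [e, strip_add_steps]
    have hp : ∀ s : Set ℝ, p ≤ strip μ (Set.Ioo (-B) B) L (s.indicator 1) 0 → p ≤ 1 := fun s h =>
      h.trans ((strip_mono_on (fun z _ => Set.indicator_le_self' (by simp) z) L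
          (Set.indicator_le_self' (by simp) _)).trans (strip_one_le L _))
    have hpt : p ^ (j + 1) ≠ ∞ := ENNReal.pow_ne_top (ne_top_of_le_ne_top (by simp) (hp _ hup))
    -- One computation serves both directions, with `s` the set of admissible displacements. Since
    -- `0 ∉ s`, the comparison at the starting point is trivial.
    have main : ∀ s : Set ℝ, (0 : ℝ) ∉ s → p ≤ strip μ (Set.Ioo (-B) B) L (s.indicator 1) 0 →
        (∀ z ∈ s, z ∈ Set.Ioo (-B) B → z + y ∈ Set.Icc B (A - B) ∧
          max (4 * B) (z + y - j * κ) ≤ max (4 * B) (y - (j + 1 : ℕ) * κ)) →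
        p ^ (j + 1 + 1) ≤ strip μ (Set.Ioo 0 A) L (strip μ (Set.Ioo 0 A) (j * L + r)
          ((Set.Iic (max (4 * B) (y - (j + 1 : ℕ) * κ) + B)).indicator 1)) y := by
      intro s h0 hs hz
      calc p ^ (j + 1 + 1) ≤ p ^ (j + 1) * strip μ (Set.Ioo (-B) B) L (s.indicator 1) 0 := by
            rw [pow_succ p (j + 1)]; gcongr
        _ = strip μ (Set.Ioo (-B) B) L (fun z => p ^ (j + 1) * s.indicator 1 z) 0 :=
            (strip_const_mul hpt _ _ _).symm
        _ ≤ _ := by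
            have key := strip_le_strip_shift (μ := μ) (I := Set.Ioo (-B) B) (J := Set.Ioo 0 A)
              (φ := fun z => p ^ (j + 1) * s.indicator 1 z)
              (ψ := strip μ (Set.Ioo 0 A) (j * L + r)
                ((Set.Iic (max (4 * B) (y - (j + 1 : ℕ) * κ) + B)).indicator 1)) (c := y)
              (fun z hzB => ⟨⟨by linarith [hzB.1, hy.1], by linarith [hzB.2, hy.2]⟩, ?_⟩) L
              (y := 0) (by simp [h0])
            · simpa using key
            · by_cases hzs : z ∈ s
              · obtain ⟨h1, h2⟩ := hz z hzs hzB
                simp only [hzs, Set.indicator_of_mem, Pi.one_apply, mul_one]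
                refine (ih h1).trans (strip_mono_on (fun x _ => ?_) _ ?_)
                all_goals
                  refine Set.indicator_le_indicator_of_subset (Set.Iic_subset_Iic.2 ?_) (by simp) _
                  linarith
              · simp [hzs]
    -- From above `3 * B` a descending block ends above `2 * B` and at least `κ` lower. Otherwise an
    -- ascending block ends between `B + κ` and `4 * B ≤ A - B`. Blocks thus end in `[B, A - B]`,
    -- and a displacement below `B` within a block cannot leave `(0, A)`.
    by_cases h3 : 3 * B < y
    · refine main _ (by simpa using hκ) hdown fun z hz hzB => ⟨⟨by linarith [hzB.1], ?_⟩, ?_⟩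
      · have : z ≤ -κ := hz
        linarith [hy.2]
      · have : z ≤ -κ := hz
        refine max_le_max le_rfl ?_
        push_cast
        linarith
    · refine main _ (by simpa using hκ) hup fun z hz hzB => ⟨⟨?_, ?_⟩, ?_⟩
      · have : κ ≤ z := hz
        linarith [hy.1]
      · linarith [hzB.2]
      · have h4 : z + y - j * κ ≤ 4 * B := by
          have : 0 ≤ (j : ℝ) * κ := by positivity
          linarith [hzB.2]
        rw [max_eq_left h4]
        exact le_max_left _ _

end Strip

/-! ### Large displacements of a centred walk, by the central limit theorem -/

section Blocks

variable {μ : Measure ℝ}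

lemma strip_univ_eq_lintegral_sum [IsProbabilityMeasure μ] (n : ℕ) {φ : ℝ → ℝ≥0∞}
    (hφ : Measurable φ) :
    strip μ Set.univ n φ 0 =
      ∫⁻ x, φ (∑ i ∈ Finset.range n, x i) ∂Measure.infinitePi (fun _ : ℕ => μ) := by
  induction n generalizing φ with
  | zero => simp [strip]
  | succ n ih =>
    rw [strip_add_steps, ih (measurable_strip .univ hφ 1)]
    set P := Measure.infinitePi (fun _ : ℕ => μ)
    have hind : ProbabilityTheory.IndepFun (fun x : ℕ → ℝ => ∑ i ∈ Finset.range n, x i)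
        (fun x => x n) P := by
      have h := (ProbabilityTheory.iIndepFun_infinitePi (P := fun _ : ℕ => μ)
        (X := fun _ x => x) (fun _ => measurable_id)).indepFun_finsetSum_of_notMem
          (fun i => measurable_pi_apply i) (s := Finset.range n) (i := n) (by simp)
      convert h using 1
      ext x
      simp
    have hS : Measurable fun x : ℕ → ℝ => ∑ i ∈ Finset.range n, x i := by fun_prop
    have hmap := (ProbabilityTheory.indepFun_iff_map_prod_eq_prod_map_map hS.aemeasurable
      (measurable_pi_apply n).aemeasurable).1 hind
    have hg : Measurable fun q : ℝ × ℝ => φ (q.1 + q.2) := by fun_prop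
    have hev : P.map (fun x => x n) = μ := Measure.infinitePi_map_eval (fun _ : ℕ => μ) n
    calc ∫⁻ x, strip μ Set.univ 1 φ (∑ i ∈ Finset.range n, x i) ∂P
        = ∫⁻ s, ∫⁻ t, φ (s + t) ∂μ ∂P.map (fun x => ∑ i ∈ Finset.range n, x i) := by
          rw [lintegral_map hg.lintegral_prod_right' hS]
          simp [strip]
      _ = ∫⁻ q, φ (q.1 + q.2) ∂P.map (fun x => (∑ i ∈ Finset.range n, x i, x n)) := by
          rw [hmap, hev, lintegral_prod _ hg.aemeasurable]
      _ = _ := by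
          rw [lintegral_map hg (hS.prodMk (measurable_pi_apply n))]
          simp [Finset.sum_range_succ]

/-- Confinement to a large interval costs nothing in the limit when the number of steps is fixed:
monotone convergence, one step at a time. -/
lemma tendsto_strip_Ioo [SFinite μ] {φ : ℝ → ℝ≥0∞} (hφ : Measurable φ) (n : ℕ) (y : ℝ) :
    Tendsto (fun B : ℕ => strip μ (Set.Ioo (-(B : ℝ)) B) n φ y) atTop
      (𝓝 (strip μ Set.univ n φ y)) := by
  induction n generalizing y with
  | zero => exact tendsto_const_nhds
  | succ n ih =>
    simp only [strip, Set.indicator_univ]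
    refine lintegral_tendsto_of_tendsto_of_monotone (fun B => ?_) ?_ ?_
    · exact (((measurable_strip measurableSet_Ioo hφ n).indicator measurableSet_Ioo).comp
        (measurable_const_add y)).aemeasurable
    · refine ae_of_all _ fun x B B' hB => ?_
      have hB' : (B : ℝ) ≤ B' := by exact_mod_cast hB
      have hsub : Set.Ioo (-(B : ℝ)) B ⊆ Set.Ioo (-(B' : ℝ)) B' :=
        Set.Ioo_subset_Ioo (by linarith) hB'
      refine (Set.indicator_le_indicator_of_subset hsub (by simp) _).trans ?_
      refine Set.indicator_le_indicator ?_
      have := strip_le_strip_shift (μ := μ) (J := Set.Ioo (-(B' : ℝ)) B') (φ := φ) (ψ := φ)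
        (c := 0) (fun z hz => by rw [add_zero]; exact ⟨hsub hz, le_rfl⟩) n (y := y + x) (by simp)
      simpa using this
    · refine ae_of_all _ fun x => (ih (y + x)).congr' ?_
      obtain ⟨N, hN⟩ := exists_nat_gt |y + x|
      filter_upwards [eventually_ge_atTop N] with B hB
      have hB' : (N : ℝ) ≤ B := by exact_mod_cast hB
      have := abs_lt.1 (hN.trans_le hB')
      exact (Set.indicator_of_mem (s := Set.Ioo (-(B : ℝ)) B) this _).symm

/-- Blocks of steps with which a centred random walk moves down, or up, by at least `κ`: their
probability is bounded away from zero, uniformly in `κ`. -/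
lemma exists_blocks [IsProbabilityMeasure μ] (h2 : MemLp id 2 μ) (h0 : ∫ x, x ∂μ = 0)
    (hv : Var[id; μ] ≠ 0) :
    ∃ p : ℝ≥0∞, 0 < p ∧ ∀ κ : ℝ, ∃ (L : ℕ) (B : ℝ), 0 ≤ B ∧
      p ≤ strip μ (Set.Ioo (-B) B) L ((Set.Iic (-κ)).indicator 1) 0 ∧
      p ≤ strip μ (Set.Ioo (-B) B) L ((Set.Ici κ).indicator 1) 0 := by
  set P := Measure.infinitePi (fun _ : ℕ => μ) with hP
  set v : NNReal := Var[id; μ].toNNReal with hvdef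
  have hv0 : v ≠ 0 := by
    rw [hvdef, ne_eq, Real.toNNReal_eq_zero, not_le]
    exact lt_of_le_of_ne (ProbabilityTheory.variance_nonneg _ _) (Ne.symm hv)
  have hX : ∀ i : ℕ, ProbabilityTheory.IdentDistrib (fun x : ℕ → ℝ => x i) id P μ := fun i =>
    ⟨(measurable_pi_apply i).aemeasurable, aemeasurable_id, by
      rw [Measure.map_id]; exact Measure.infinitePi_map_eval (fun _ : ℕ => μ) i⟩
  have hmean : ∫ x, x 0 ∂P = 0 := by
    have := (hX 0).integral_eq
    simpa [h0] using this
  have hvar : Var[fun x : ℕ → ℝ => x 0; P] = Var[id; μ] := (hX 0).variance_eq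
  have hclt := ProbabilityTheory.tendstoInDistribution_inv_sqrt_mul_sum_sub (P := P)
    (X := fun i (x : ℕ → ℝ) => x i) (Y := id) (P' := ProbabilityTheory.gaussianReal 0 v)
    (by rw [hvar]; exact ProbabilityTheory.HasLaw.id)
    ((hX 0).memLp_iff.2 h2)
    (ProbabilityTheory.iIndepFun_infinitePi (P := fun _ : ℕ => μ)
        (X := fun _ x => x) (fun _ => measurable_id))
    (fun i => (hX i).trans (hX 0).symm)
  have hopen : (ProbabilityTheory.gaussianReal 0 v).IsOpenPosMeasure :=
    (ProbabilityTheory.gaussianReal_absolutelyContinuous' 0 hv0).isOpenPosMeasure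
  have hlim := fun (U : Set ℝ) (hU : IsOpen U) =>
    ProbabilityMeasure.le_liminf_measure_open_of_tendsto hclt.tendsto hU
  set g := ProbabilityTheory.gaussianReal 0 v
  have hgU : ∀ U : Set ℝ, IsOpen U → U.Nonempty → 0 < g U := fun U hU hne =>
    hU.measure_pos g hne
  -- These are the limiting probabilities that S_n/√n is below -1 and above 1. Any smaller positive
  -- `p` is attained for all large `n`, and a block length `L` with `√L ≥ κ` turns 1 on the
  -- normalised scale into `κ`. Hence `p` does not depend on `κ`.
  set p₀ := min (g (Set.Iio (-1))) (g (Set.Ioi 1)) with hp₀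
  have hp₀pos : 0 < p₀ := lt_min (hgU _ isOpen_Iio ⟨-2, by norm_num⟩) (hgU _ isOpen_Ioi ⟨2, by norm_num⟩)
  obtain ⟨p, hp, hpp⟩ := exists_between hp₀pos
  refine ⟨p, hp, fun κ => ?_⟩
  have hev : ∀ U : Set ℝ, IsOpen U → p₀ ≤ g U → ∀ᶠ n : ℕ in atTop,
      p < P {x | (√(n : ℝ))⁻¹ * ∑ i ∈ Finset.range n, x i ∈ U} := by
    intro U hU hle
    have h1 := hlim U hU
    simp only [ProbabilityMeasure.coe_mk, Measure.map_id] at h1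
    have h3 := eventually_lt_of_lt_liminf (hpp.trans_le (hle.trans h1))
    filter_upwards [h3] with n hn
    rw [Measure.map_apply (by fun_prop) hU.measurableSet] at hn
    simp only [hmean, mul_zero, sub_zero] at hn
    exact hn
  have hsq : ∀ᶠ n : ℕ in atTop, κ ≤ √(n : ℝ) :=
    (Real.tendsto_sqrt_atTop.comp tendsto_natCast_atTop_atTop).eventually_ge_atTop κ
  obtain ⟨L, hL1, hL2, hLκ, hLpos⟩ := ((hev _ isOpen_Iio (min_le_left _ _)).and
    ((hev _ isOpen_Ioi (min_le_right _ _)).and (hsq.and (eventually_gt_atTop 0)))).exists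
  have hs : 0 < √(L : ℝ) := Real.sqrt_pos.2 (by exact_mod_cast hLpos)
  have hbig : ∀ U V : Set ℝ, MeasurableSet V →
      p < P {x | (√(L : ℝ))⁻¹ * ∑ i ∈ Finset.range L, x i ∈ U} →
      (∀ s, (√(L : ℝ))⁻¹ * s ∈ U → s ∈ V) →
      ∀ᶠ B : ℕ in atTop, p < strip μ (Set.Ioo (-(B : ℝ)) B) L (V.indicator 1) 0 := by
    intro U V hV hU hUV
    refine (tendsto_strip_Ioo (measurable_one.indicator hV) L 0).eventually_const_lt ?_
    rw [strip_univ_eq_lintegral_sum L (measurable_one.indicator hV)]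
    have hS : Measurable fun x : ℕ → ℝ => ∑ i ∈ Finset.range L, x i := by fun_prop
    have : ∫⁻ x, V.indicator 1 (∑ i ∈ Finset.range L, x i) ∂P =
        P ((fun x : ℕ → ℝ => ∑ i ∈ Finset.range L, x i) ⁻¹' V) := by
      rw [← lintegral_indicator_one (hS hV)]
      rfl
    rw [this]
    exact hU.trans_le (measure_mono fun x hx => hUV _ hx)
  have hd := hbig (Set.Iio (-1)) (Set.Iic (-κ)) measurableSet_Iic hL1 (fun s hs' => by
    have h5 : (√(L : ℝ))⁻¹ * s < -1 := hs'
    rw [inv_mul_lt_iff₀ hs] at h5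
    simp only [Set.mem_Iic]; linarith)
  have hu := hbig (Set.Ioi 1) (Set.Ici κ) measurableSet_Ici hL2 (fun s hs' => by
    have h5 : 1 < (√(L : ℝ))⁻¹ * s := hs'
    rw [lt_inv_mul_iff₀ hs] at h5
    simp only [Set.mem_Ici]; linarith)
  obtain ⟨B, hB1, hB2⟩ := (hd.and hu).exists
  exact ⟨L, B, by positivity, hB1.le, hB2.le⟩

/-- A centred and non-degenerate step is positive, and negative, with positive probability. -/
lemma exists_step_intervals (hi : Integrable id μ) (h0 : ∫ x, x ∂μ = 0)
    (hv : ¬ id =ᵐ[μ] 0) :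
    ∃ a b : ℝ, 0 < a ∧ a ≤ b ∧ 0 < μ (Set.Icc a b) ∧ 0 < μ (Set.Icc (-b) (-a)) := by
  have hpos : ∀ f : ℝ → ℝ, Integrable f μ → ∫ x, f x ∂μ = 0 → (f =ᵐ[μ] 0 → id =ᵐ[μ] 0) →
      0 < μ {x | 0 < f x} := by
    intro f hf h1 h2
    by_contra hc
    have h3 : μ {x | 0 < f x} = 0 := by simpa using hc
    have h4 : ∀ᵐ x ∂μ, 0 ≤ (-f) x := by
      rw [ae_iff]; simpa using h3
    have h5 : ∫ x, (-f) x ∂μ = 0 := by simp [integral_neg, h1]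
    have h6 := (integral_eq_zero_iff_of_nonneg_ae h4 hf.neg).1 h5
    refine hv (h2 ?_)
    filter_upwards [h6] with x hx
    simpa using hx
  have hex : ∀ s : ℕ → Set ℝ, Monotone s → 0 < μ (⋃ n, s n) → ∀ᶠ n in atTop, 0 < μ (s n) := by
    intro s hs hpos
    exact (tendsto_measure_iUnion_atTop hs).eventually_const_lt hpos
  have h1 := hex (fun n => Set.Icc (1 / ((n : ℝ) + 1)) (n + 1)) (fun m n hmn => by
      have : (m : ℝ) ≤ n := by exact_mod_cast hmn
      exact Set.Icc_subset_Icc (by gcongr) (by linarith)) (by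
    refine (hpos id hi h0 id).trans_le (measure_mono fun x hx => ?_)
    have hx : 0 < x := hx
    obtain ⟨n, hn⟩ := exists_nat_gt (max x (1 / x))
    refine Set.mem_iUnion.2 ⟨n, ?_, ?_⟩
    · rw [div_le_iff₀ (by positivity)]
      have h3 : 1 / x < n := (le_max_right _ _).trans_lt hn
      rw [div_lt_iff₀ hx] at h3
      linarith [mul_comm x (n : ℝ)]
    · linarith [(le_max_left x (1 / x)).trans_lt hn])
  have h2 := hex (fun n => Set.Icc (-((n : ℝ) + 1)) (-(1 / ((n : ℝ) + 1)))) (fun m n hmn => by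
      have : (m : ℝ) ≤ n := by exact_mod_cast hmn
      exact Set.Icc_subset_Icc (by linarith) (by
        have h7 : 1 / ((n : ℝ) + 1) ≤ 1 / ((m : ℝ) + 1) := by gcongr
        exact neg_le_neg h7)) (by
    refine (hpos (fun x => -x) hi.neg (by rw [integral_neg, h0, neg_zero]) (fun h => by
      filter_upwards [h] with x hx
      simpa using hx)).trans_le (measure_mono fun x hx => ?_)
    have hx : 0 < -x := hx
    obtain ⟨n, hn⟩ := exists_nat_gt (max (-x) (1 / (-x)))
    refine Set.mem_iUnion.2 ⟨n, ?_, ?_⟩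
    · linarith [(le_max_left (-x) (1 / (-x))).trans_lt hn]
    · rw [le_neg, div_le_iff₀ (by positivity)]
      have h3 : 1 / (-x) < n := (le_max_right _ _).trans_lt hn
      rw [div_lt_iff₀ hx] at h3
      linarith [mul_comm (-x) (n : ℝ)])
  obtain ⟨n, hn1, hn2⟩ := (h1.and h2).exists
  refine ⟨1 / ((n : ℝ) + 1), n + 1, by positivity, ?_, hn1, hn2⟩
  rw [div_le_iff₀ (by positivity)]
  nlinarith [(Nat.cast_nonneg n : (0 : ℝ) ≤ n)]

end Blocks

/-! ### The height of a walk conditioned to stay in a strip -/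

section Confinement

variable {μ : Measure ℝ}

/-- Probabilities written as `exp (-t)` with `t ≥ 0` let the costs of successive stages be added. -/
lemma exists_exp_neg_le {p : ℝ≥0∞} (hp : 0 < p) :
    ∃ t : ℝ, 0 ≤ t ∧ ENNReal.ofReal (Real.exp (-t)) ≤ p := by
  obtain ⟨r, hr0, hrp⟩ := ENNReal.lt_iff_exists_nnreal_btwn.1 hp
  have hr : (0 : ℝ) < r := by exact_mod_cast hr0
  refine ⟨max 0 (-Real.log r), le_max_left _ _, le_trans ?_ hrp.le⟩
  rw [← ENNReal.ofReal_coe_nnreal]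
  refine ENNReal.ofReal_le_ofReal ?_
  rw [← Real.le_log_iff_exp_le hr]
  linarith [le_max_right 0 (-Real.log r)]

/-- Markov property at time `m`, keeping only the paths that are then in `s`. -/
lemma mul_le_strip_add {I s : Set ℝ} {β : ℝ≥0∞} (hβ : β ≠ ∞) {ψ : ℝ → ℝ≥0∞} {m n : ℕ}
    (h : ∀ z ∈ s, β ≤ strip μ I n ψ z) (y : ℝ) :
    β * strip μ I m (s.indicator 1) y ≤ strip μ I (m + n) ψ y := by
  have h1 : ∀ z, β * s.indicator 1 z ≤ strip μ I n ψ z := by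
    intro z
    by_cases hz : z ∈ s
    · simpa [hz] using h z hz
    · simp [hz]
  rw [strip_add_steps, ← strip_const_mul hβ]
  exact strip_mono_on (fun z _ => h1 z) m (h1 y)

/-- A centred random walk confined to `(0, A)` is near `0` with a conditional probability that is
not exponentially small in `A`. -/
lemma strip_one_le_exp_mul [IsProbabilityMeasure μ] (h2 : MemLp id 2 μ) (h0 : ∫ x, x ∂μ = 0)
    (hv : Var[id; μ] ≠ 0) {c : ℝ} (hc : 0 < c) :
    ∃ A₀ w : ℝ, ∀ A ≥ A₀, ∀ n, strip μ (Set.Ioo 0 A) n 1 0 ≤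
      ENNReal.ofReal (Real.exp (c * A)) *
        strip μ (Set.Ioo 0 A) n ((Set.Iic w).indicator 1) 0 := by
  obtain ⟨p₁, hp₁, hblock⟩ := exists_blocks h2 h0 hv
  have hid : Integrable id μ := h2.integrable (by norm_num)
  obtain ⟨a, b, ha, hab, hq₁, hq₂⟩ := exists_step_intervals hid h0 (fun h => hv (by
    rw [ProbabilityTheory.variance_congr h]; exact ProbabilityTheory.variance_zero μ))
  obtain ⟨tp, htp, hp⟩ := exists_exp_neg_le hp₁
  obtain ⟨tq, htq, hq⟩ := exists_exp_neg_le (lt_min hq₁ hq₂)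
  set p := ENNReal.ofReal (Real.exp (-tp))
  set q := ENNReal.ofReal (Real.exp (-tq))
  have hpt : p ≠ ∞ := ENNReal.ofReal_ne_top
  have hqt : q ≠ ∞ := ENNReal.ofReal_ne_top
  have hp1 : p ≤ 1 := ENNReal.ofReal_le_one.2 (Real.exp_le_one_iff.2 (by linarith))
  have hq1 : q ≤ 1 := ENNReal.ofReal_le_one.2 (Real.exp_le_one_iff.2 (by linarith))
  -- With this block displacement, `A / κ` blocks of cost `tp` cost at most `c * A / 2`. The summand
  -- 1 keeps `κ` positive when `tp = 0`.
  set κ := 2 * tp / c + 1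
  have hκ : 0 < κ := by positivity
  obtain ⟨L, B, hB, hdown', hup'⟩ := hblock κ
  have hdown := hp.trans hdown'
  have hup := hp.trans hup'
  -- The number of one-signed steps, each of size at least `a`, that bring the walk to distance `B`
  -- from an end of the strip.
  set n₀ := ⌈B / a⌉₊
  have hn₀ : B ≤ n₀ * a := by
    have := Nat.le_ceil (B / a)
    rwa [div_le_iff₀ ha] at this
  have hb : 0 < b := ha.trans_le hab
  set w := max (4 * B) (n₀ * b) + B
  -- The last lower bound on `A` absorbs the fixed costs `n₀ * tq + 2 * tp` in the other half of `c
  -- * A`.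
  refine ⟨max (max (2 * (n₀ * b + B) + 1) (5 * B)) (2 * (n₀ * tq + 2 * tp) / c), w,
    fun A hA n => ?_⟩
  have hA1 : 2 * (n₀ * b + B) + 1 ≤ A := (le_max_left _ _).trans ((le_max_left _ _).trans hA)
  have hA2 : 5 * B ≤ A := (le_max_right _ _).trans ((le_max_left _ _).trans hA)
  have hA3 : 2 * (n₀ * tq + 2 * tp) ≤ A * c := by
    have := (le_max_right _ _).trans hA
    rwa [div_le_iff₀ hc] at this
  have hn0b : 0 ≤ (n₀ : ℝ) * b := by positivity
  have hApos : 0 < A := by linarith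
  set J := ⌈A / κ⌉₊
  have hJ : A ≤ J * κ := by
    have := Nat.le_ceil (A / κ)
    rwa [div_le_iff₀ hκ] at this
  set β := q ^ n₀ * p ^ (J + 1)
  have hβ : ENNReal.ofReal (Real.exp (-(c * A))) ≤ β := by
    simp only [β, q, p]
    rw [← ENNReal.ofReal_pow (Real.exp_pos _).le, ← ENNReal.ofReal_pow (Real.exp_pos _).le,
      ← ENNReal.ofReal_mul (by positivity), ← Real.exp_nat_mul, ← Real.exp_nat_mul,
      ← Real.exp_add]
    refine ENNReal.ofReal_le_ofReal (Real.exp_le_exp.2 ?_)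
    have h3 : (J : ℝ) ≤ A / κ + 1 := (Nat.ceil_lt_add_one (by positivity)).le
    have h4 : A / κ * tp ≤ c * A / 2 := by
      rw [div_mul_eq_mul_div, div_le_iff₀ hκ]
      have : c * κ = 2 * tp + c := by simp only [κ]; field_simp
      nlinarith
    have h5 : (J : ℝ) * tp ≤ (A / κ + 1) * tp := by gcongr
    push_cast
    nlinarith
  have hβt : β ≠ ∞ := ENNReal.mul_ne_top (ENNReal.pow_ne_top hqt) (ENNReal.pow_ne_top hpt)
  -- reaching the middle part of the strip
  have hstart : ∀ y, 0 ≤ y → y < A → ∃ s : Set ℝ, s ⊆ Set.Icc B (A - B) ∧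
      q ^ n₀ ≤ strip μ (Set.Ioo 0 A) n₀ (s.indicator 1) y := by
    intro y hy0 hyA
    rcases le_or_gt y (A / 2) with hy | hy
    · refine ⟨_, Set.Icc_subset_Icc ?_ ?_, pow_le_strip_of_steps (α := a) (β := b)
        (hq.trans (min_le_left _ _)) n₀ fun i hi hin => ?_⟩
      · linarith
      · linarith
      · have h1 : (1 : ℝ) ≤ i := by exact_mod_cast hi
        have h2 : (i : ℝ) * b ≤ n₀ * b := by gcongr
        exact ⟨by positivity, by linarith⟩
    · refine ⟨_, Set.Icc_subset_Icc ?_ ?_, pow_le_strip_of_steps (α := -b) (β := -a)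
        (hq.trans (min_le_right _ _)) n₀ fun i hi hin => ?_⟩
      · linarith
      · linarith
      · have h1 : (1 : ℝ) ≤ i := by exact_mod_cast hi
        have h2 : (i : ℝ) * b ≤ n₀ * b := by gcongr
        have h3 : 0 < (i : ℝ) * a := by positivity
        exact ⟨by linarith, by linarith⟩
  have hfinal : ∀ y, 0 ≤ y → y < A →
      β ≤ strip μ (Set.Ioo 0 A) (n₀ + J * L) ((Set.Iic w).indicator 1) y := by
    intro y hy0 hyA
    obtain ⟨s, hs, hsq⟩ := hstart y hy0 hyA
    calc β ≤ p ^ (J + 1) * strip μ (Set.Ioo 0 A) n₀ (s.indicator 1) y := by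
          simp only [β]; rw [mul_comm]; gcongr
      _ ≤ _ := by
          refine mul_le_strip_add (ENNReal.pow_ne_top hpt) (fun z hz => ?_) y
          refine (pow_le_strip_of_blocks hκ hB hA2 hdown hup J 0 (Nat.zero_le _) (hs hz)).trans ?_
          rw [add_zero]
          have hz' := (hs hz).2
          have hle : max (4 * B) (z - J * κ) + B ≤ w := by
            rw [max_eq_left (by linarith)]
            exact add_le_add (le_max_left _ _) le_rfl
          have h1 : ∀ x, (Set.Iic (max (4 * B) (z - J * κ) + B)).indicator (1 : ℝ → ℝ≥0∞) x ≤
              (Set.Iic w).indicator 1 x := fun x =>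
            Set.indicator_le_indicator_of_subset (Set.Iic_subset_Iic.2 hle) (by simp) x
          exact strip_mono_on (fun x _ => h1 x) _ (h1 z)
  have hmain : ENNReal.ofReal (Real.exp (-(c * A))) * strip μ (Set.Ioo 0 A) n 1 0 ≤
      strip μ (Set.Ioo 0 A) n ((Set.Iic w).indicator 1) 0 := by
    -- If `n` is shorter than a complete descent, the walk starts at `0` and only has to be kept
    -- low: upward steps away from the boundary, then blocks. Otherwise the descent occupies the
    -- last `n₀ + J * L` steps, from wherever the confined walk then is.
    rcases lt_or_ge n (n₀ + J * L) with hn | hn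
    · calc ENNReal.ofReal (Real.exp (-(c * A))) * strip μ (Set.Ioo 0 A) n 1 0 ≤ β * 1 := by
            gcongr
            exact strip_one_le n 0
        _ = β := mul_one β
        _ ≤ _ := ?_
      rcases lt_or_ge n n₀ with hnn | hnn
      · calc β ≤ q ^ n₀ * 1 := by
              simp only [β]; gcongr; exact pow_le_one' hp1 _
          _ ≤ q ^ n := by rw [mul_one]; exact pow_le_pow_right_of_le_one' hq1 hnn.le
          _ ≤ _ := pow_le_strip_of_steps (A := A) (α := a) (β := b) (y := 0)
            (hq.trans (min_le_left _ _)) n fun i hi hin => ?_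
          _ ≤ _ := ?_
        · have h1 : (1 : ℝ) ≤ i := by exact_mod_cast hi
          have h2 : (i : ℝ) ≤ n₀ := by exact_mod_cast hin.trans hnn.le
          have h3 : (i : ℝ) * b ≤ n₀ * b := by gcongr
          exact ⟨by positivity, by linarith⟩
        · have h1 : ∀ x, (Set.Icc (0 + n * a) (0 + n * b)).indicator (1 : ℝ → ℝ≥0∞) x ≤
              (Set.Iic w).indicator 1 x := fun x => by
            refine Set.indicator_le_indicator_of_subset (fun z hz => ?_) (by simp) x
            have h2 : (n : ℝ) ≤ n₀ := by exact_mod_cast hnn.le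
            have h3 : (n : ℝ) * b ≤ n₀ * b := by gcongr
            have h4 : n₀ * b ≤ max (4 * B) (n₀ * b) := le_max_right _ _
            simp only [Set.mem_Iic, w]
            linarith [hz.2]
          exact strip_mono_on (fun x _ => h1 x) _ (h1 0)
      · obtain ⟨m, rfl⟩ := Nat.exists_eq_add_of_le hnn
        have hL : 0 < L := by
          rcases Nat.eq_zero_or_pos L with h | h
          · subst h; omega
          · exact h
        have hjr : m = m / L * L + m % L := (Nat.div_add_mod' m L).symm
        have hj : m / L < J := by
          rw [Nat.div_lt_iff_lt_mul hL]; omega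
        have hsteps := pow_le_strip_of_steps (A := A) (α := a) (β := b) (y := 0)
            (hq.trans (min_le_left _ _)) n₀ fun i hi hin => by
          have h1 : (1 : ℝ) ≤ i := by exact_mod_cast hi
          have h2 : (i : ℝ) ≤ n₀ := by exact_mod_cast hin
          have h3 : (i : ℝ) * b ≤ n₀ * b := by gcongr
          exact ⟨by positivity, by linarith⟩
        calc β ≤ q ^ n₀ * p ^ (m / L + 1) := by
              simp only [β]
              refine mul_le_mul_right ?_ _
              exact pow_le_pow_right_of_le_one' hp1 (by omega)
          _ ≤ p ^ (m / L + 1) * strip μ (Set.Ioo 0 A) n₀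
                ((Set.Icc (0 + n₀ * a) (0 + n₀ * b)).indicator 1) 0 := by
              rw [mul_comm]; gcongr
          _ ≤ _ := by
              refine mul_le_strip_add (ENNReal.pow_ne_top hpt) (fun z hz => ?_) 0
              rw [zero_add, zero_add] at hz
              have hz' : z ∈ Set.Icc B (A - B) := ⟨by linarith [hz.1], by linarith [hz.2]⟩
              refine (pow_le_strip_of_blocks hκ hB hA2 hdown hup (m / L) (m % L)
                (Nat.mod_lt _ hL).le hz').trans ?_
              rw [← hjr]
              have hle : max (4 * B) (z - (m / L : ℕ) * κ) + B ≤ w := by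
                refine add_le_add (max_le_max le_rfl ?_) le_rfl
                have : 0 ≤ ((m / L : ℕ) : ℝ) * κ := by positivity
                linarith [hz.2]
              have h1 : ∀ x, (Set.Iic (max (4 * B) (z - (m / L : ℕ) * κ) + B)).indicator
                  (1 : ℝ → ℝ≥0∞) x ≤ (Set.Iic w).indicator 1 x := fun x =>
                Set.indicator_le_indicator_of_subset (Set.Iic_subset_Iic.2 hle) (by simp) x
              exact strip_mono_on (fun x _ => h1 x) _ (h1 z)
    · obtain ⟨m, rfl⟩ := Nat.exists_eq_add_of_le hn
      rw [add_comm (n₀ + J * L) m, strip_add_steps, strip_add_steps,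
        ← strip_const_mul ENNReal.ofReal_ne_top]
      have h1 : ∀ y, 0 ≤ y → y < A →
          ENNReal.ofReal (Real.exp (-(c * A))) * strip μ (Set.Ioo 0 A) (n₀ + J * L) 1 y ≤
          strip μ (Set.Ioo 0 A) (n₀ + J * L) ((Set.Iic w).indicator 1) y := by
        intro y hy0 hyA
        calc _ ≤ β * 1 := by
              gcongr
              exact strip_one_le _ _
          _ = β := mul_one β
          _ ≤ _ := hfinal y hy0 hyA
      exact strip_mono_on (fun y hy => h1 y hy.1.le hy.2) m (h1 0 le_rfl hApos)
  calc strip μ (Set.Ioo 0 A) n 1 0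
      = ENNReal.ofReal (Real.exp (c * A)) *
        (ENNReal.ofReal (Real.exp (-(c * A))) * strip μ (Set.Ioo 0 A) n 1 0) := by
        rw [← mul_assoc, ← ENNReal.ofReal_mul (by positivity), ← Real.exp_add]
        simp
    _ ≤ _ := by gcongr

/-- The tilting parameter at which a random walk becomes centred. -/
lemma exists_tilted_mean_zero [IsProbabilityMeasure μ] (hexp : Integrable Real.exp μ)
    (h1 : ∫ x, Real.exp x ∂μ = 1) (hne : ∫ x, x ∂μ ≠ 0) :
    ∃ θ : ℝ, 0 < θ ∧ Integrable (fun x => Real.exp (θ * x)) μ ∧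
      MemLp id 2 (μ.tilted (θ * ·)) ∧ ∫ x, x ∂(μ.tilted (θ * ·)) = 0 ∧
      Var[id; μ.tilted (θ * ·)] ≠ 0 := by
  have hdom : ∀ t ∈ Set.Icc (0 : ℝ) 1, ∀ x : ℝ, Real.exp (t * x) ≤ 1 + Real.exp x := by
    intro t ht x
    rcases le_total 0 x with hx | hx
    · have : Real.exp (t * x) ≤ Real.exp x := Real.exp_le_exp.2 (by nlinarith [ht.2])
      linarith
    · have : Real.exp (t * x) ≤ 1 := Real.exp_le_one_iff.2 (by nlinarith [ht.1])
      linarith [Real.exp_pos x]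
  have hbd : Integrable (fun x => 1 + Real.exp x) μ := (integrable_const 1).add hexp
  have hint : ∀ t ∈ Set.Icc (0 : ℝ) 1, Integrable (fun x => Real.exp (t * x)) μ := fun t ht =>
    hbd.mono' (by fun_prop) (ae_of_all _ fun x => by
      rw [Real.norm_of_nonneg (Real.exp_pos _).le]; exact hdom t ht x)
  have hcont : ContinuousOn (ProbabilityTheory.mgf id μ) (Set.Icc 0 1) := by
    refine continuousOn_of_dominated (bound := fun x => 1 + Real.exp x) (fun t _ => by fun_prop)
      (fun t ht => ae_of_all _ fun x => ?_) hbd (ae_of_all _ fun x => by fun_prop)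
    rw [Real.norm_of_nonneg (Real.exp_pos _).le]; exact hdom t ht x
  -- Rolle's theorem: the moment generating function equals 1 at both 0 and 1, and a zero of its
  -- derivative centres the tilted law.
  obtain ⟨θ, hθ, hder⟩ := exists_deriv_eq_zero zero_lt_one hcont (by
    simp [ProbabilityTheory.mgf, h1])
  have hmem : θ ∈ interior (ProbabilityTheory.integrableExpSet id μ) := by
    refine interior_maximal (fun t ht => ?_) isOpen_Ioo hθ
    exact hint t ⟨ht.1.le, ht.2.le⟩
  have hθi := hint θ ⟨hθ.1.le, hθ.2.le⟩
  have hmean : ∫ x, x ∂(μ.tilted (θ * ·)) = 0 := by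
    have h3 := ProbabilityTheory.integral_tilted_mul_self hmem
    rw [ProbabilityTheory.deriv_cgf hmem] at h3
    rw [ProbabilityTheory.deriv_mgf hmem] at hder
    simp only [id] at h3 hder
    rw [h3, hder, zero_div]
  have hL2 : MemLp id 2 (μ.tilted (θ * ·)) := by
    simpa using ProbabilityTheory.memLp_tilted_mul hmem 2
  have hprob : IsProbabilityMeasure (μ.tilted (θ * ·)) := isProbabilityMeasure_tilted hθi
  -- Zero variance would make the step almost surely 0 under the tilted law, hence under `μ`,
  -- contradicting the non-zero mean.
  refine ⟨θ, hθ.1, hθi, hL2, hmean, fun hv => hne ?_⟩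
  have h4 := ProbabilityTheory.ae_eq_integral_of_variance_eq_zero hL2 hv
  have h5 := (absolutelyContinuous_tilted hθi).ae_le h4
  have h6 : (fun x : ℝ => x) =ᵐ[μ] fun _ => 0 := by
    filter_upwards [h5] with x hx
    have : x = ∫ y, y ∂(μ.tilted (θ * ·)) := by simpa using hx
    rw [this, hmean]
  rw [integral_congr_ae h6]
  simp

/-- For a random walk whose steps have exponential moment `1` and non-zero mean, the expected
height, given that the walk has been confined to `(0, A)` so far, is `o(A)` uniformly in time. -/
theorem strip_height_le [IsProbabilityMeasure μ] (hexp : Integrable Real.exp μ)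
    (h1 : ∫ x, Real.exp x ∂μ = 1) (hne : ∫ x, x ∂μ ≠ 0) {ε : ℝ} (hε : 0 < ε) :
    ∃ A₀ : ℝ, ∀ A ≥ A₀, ∀ n, strip μ (Set.Ioo 0 A) n ENNReal.ofReal 0 ≤
      ENNReal.ofReal (ε * A) * strip μ (Set.Ioo 0 A) n 1 0 := by
  obtain ⟨θ, hθ, hθi, hL2, hmean, hvar⟩ := exists_tilted_mean_zero hexp h1 hne
  have hprob : IsProbabilityMeasure (μ.tilted (θ * ·)) := isProbabilityMeasure_tilted hθi
  -- Heights above `ε / 2 * A` gain the factor exp(-θεA/2) = exp(-2cA). One half of the exponent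
  -- pays for the factor exp(cA) of the confinement estimate, the other half makes the error vanish.
  set c := θ * ε / 4
  have hc : 0 < c := by positivity
  obtain ⟨A₀, w, hW⟩ := strip_one_le_exp_mul hL2 hmean hvar hc
  set M := ∫ x, Real.exp (θ * x) ∂μ
  have hM : 0 < M := integral_exp_pos hθi
  have htilt : ∀ g : ℝ → ℝ≥0∞, ∫⁻ x, g x ∂(μ.tilted (θ * ·)) =
      ∫⁻ x, ENNReal.ofReal (M⁻¹ * Real.exp (θ * x)) * g x ∂μ := by
    intro g
    rw [lintegral_tilted]
    refine lintegral_congr fun x => ?_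
    rw [div_eq_inv_mul]
  have htend : Tendsto (fun A : ℝ => Real.exp (θ * w) * Real.exp (-(c * A))) atTop (𝓝 0) := by
    rw [← mul_zero (Real.exp (θ * w))]
    refine Tendsto.const_mul _ (Real.tendsto_exp_neg_atTop_nhds_zero.comp ?_)
    exact tendsto_id.const_mul_atTop hc
  obtain ⟨A₁, hA₁⟩ := eventually_atTop.1 (htend.eventually_lt_const (half_pos hε))
  refine ⟨max (max A₀ A₁) 1, fun A hA n => ?_⟩
  have hA0 : A₀ ≤ A := (le_max_left _ _).trans ((le_max_left _ _).trans hA)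
  have hA1 : A₁ ≤ A := (le_max_right _ _).trans ((le_max_left _ _).trans hA)
  have hApos : 0 < A := zero_lt_one.trans_le ((le_max_right _ _).trans hA)
  set I := Set.Ioo (0 : ℝ) A
  -- the exponential moment of the height
  have hexpo : strip μ I n (fun z => ENNReal.ofReal (Real.exp (θ * z))) 0 ≤
      ENNReal.ofReal (Real.exp (c * A) * Real.exp (θ * w)) * strip μ I n 1 0 := by
    have e1 := strip_tilted (I := I) hM htilt 1 n 0
    have e2 := strip_tilted (I := I) hM htilt ((Set.Iic w).indicator 1) n 0
    simp only [mul_zero, neg_zero, Real.exp_zero, mul_one, Pi.one_apply] at e1 e2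
    have h3 := hW A hA0 n
    rw [e1, e2] at h3
    have h4 : strip μ I n (fun z => ENNReal.ofReal (Real.exp (θ * z)) *
        (Set.Iic w).indicator 1 z) 0 ≤ ENNReal.ofReal (Real.exp (θ * w)) * strip μ I n 1 0 := by
      rw [← strip_const_mul ENNReal.ofReal_ne_top]
      have h5 : ∀ z, ENNReal.ofReal (Real.exp (θ * z)) * (Set.Iic w).indicator 1 z ≤
          ENNReal.ofReal (Real.exp (θ * w)) * (1 : ℝ → ℝ≥0∞) z := by
        intro z
        by_cases hz : z ∈ Set.Iic w
        · have : θ * z ≤ θ * w := by gcongr; exact hz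
          simp only [hz, Set.indicator_of_mem, Pi.one_apply, mul_one]
          exact ENNReal.ofReal_le_ofReal (Real.exp_le_exp.2 this)
        · simp [hz]
      exact strip_mono_on (fun z _ => h5 z) n (h5 0)
    -- Both tilted quantities carry the same normalisation `M⁻¹ ^ n`, which cancels; this makes the
    -- estimate uniform in `n`.
    have hMn : ENNReal.ofReal (M⁻¹ ^ n) ≠ 0 := by
      simp only [ne_eq, ENNReal.ofReal_eq_zero, not_le]; positivity
    rw [mul_left_comm] at h3
    rw [ENNReal.mul_le_mul_iff_right hMn ENNReal.ofReal_ne_top] at h3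
    rw [ENNReal.ofReal_mul (by positivity), mul_assoc]
    exact h3.trans (by gcongr)
  -- Heights are split at `ε / 2 * A`. Above it the height is at most `A`, and an exponential Markov
  -- bound applies.
  have hpoint : ∀ z, z < A → ENNReal.ofReal z ≤ ENNReal.ofReal (ε / 2 * A) * (1 : ℝ → ℝ≥0∞) z +
      ENNReal.ofReal (A * Real.exp (-(θ * (ε / 2 * A)))) * ENNReal.ofReal (Real.exp (θ * z)) := by
    intro z hz
    rw [← ENNReal.ofReal_mul (by positivity), Pi.one_apply, mul_one,
      ← ENNReal.ofReal_add (by positivity) (by positivity)]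
    refine ENNReal.ofReal_le_ofReal ?_
    rcases le_or_gt z (ε / 2 * A) with h | h
    · have : 0 ≤ A * Real.exp (-(θ * (ε / 2 * A))) * Real.exp (θ * z) := by positivity
      linarith
    · have h6 : 1 ≤ Real.exp (-(θ * (ε / 2 * A))) * Real.exp (θ * z) := by
        rw [← Real.exp_add]
        refine Real.one_le_exp ?_
        nlinarith
      have h7 : 0 ≤ ε / 2 * A := by positivity
      nlinarith
  calc strip μ I n ENNReal.ofReal 0
      ≤ strip μ I n (fun z => ENNReal.ofReal (ε / 2 * A) * (1 : ℝ → ℝ≥0∞) z +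
        ENNReal.ofReal (A * Real.exp (-(θ * (ε / 2 * A)))) *
          ENNReal.ofReal (Real.exp (θ * z))) 0 :=
        strip_mono_on (fun z hz => hpoint z hz.2) n (hpoint 0 hApos)
    _ = ENNReal.ofReal (ε / 2 * A) * strip μ I n 1 0 +
        ENNReal.ofReal (A * Real.exp (-(θ * (ε / 2 * A)))) *
          strip μ I n (fun z => ENNReal.ofReal (Real.exp (θ * z))) 0 := by
        rw [strip_add_fun measurableSet_Ioo (measurable_one.const_mul _),
          strip_const_mul ENNReal.ofReal_ne_top, strip_const_mul ENNReal.ofReal_ne_top]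
    _ ≤ ENNReal.ofReal (ε / 2 * A) * strip μ I n 1 0 +
        ENNReal.ofReal (A * Real.exp (-(θ * (ε / 2 * A)))) *
          (ENNReal.ofReal (Real.exp (c * A) * Real.exp (θ * w)) * strip μ I n 1 0) := by gcongr
    _ = ENNReal.ofReal (ε / 2 * A + A * (Real.exp (θ * w) * Real.exp (-(c * A)))) *
          strip μ I n 1 0 := by
        rw [ENNReal.ofReal_add (by positivity) (by positivity), add_mul, ← mul_assoc,
          ← ENNReal.ofReal_mul (by positivity)]
        congr 3
        have : Real.exp (-(θ * (ε / 2 * A))) = Real.exp (-(c * A)) * Real.exp (-(c * A)) := by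
          rw [← Real.exp_add]; congr 1; simp only [c]; ring
        rw [this, Real.exp_neg]
        field_simp
    _ ≤ _ := by
        gcongr
        have := (hA₁ A hA1).le
        nlinarith

end Confinement

/-! ### Independence of the next observation from the collected history -/

lemma lintegral_indepFun {Ω A B : Type*} [MeasurableSpace Ω] [MeasurableSpace A]
    [MeasurableSpace B] {P : Measure Ω} [IsProbabilityMeasure P] {X : Ω → A} {Y : Ω → B}
    (hX : Measurable X) (hY : Measurable Y) (h : ProbabilityTheory.IndepFun X Y P)
    {f : A × B → ℝ≥0∞} (hf : Measurable f) :
    ∫⁻ ω, f (X ω, Y ω) ∂P = ∫⁻ ω, ∫⁻ z, f (X ω, z) ∂(P.map Y) ∂P := by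
  have hmap := (ProbabilityTheory.indepFun_iff_map_prod_eq_prod_map_map hX.aemeasurable
    hY.aemeasurable).1 h
  have : IsProbabilityMeasure (P.map Y) := Measure.isProbabilityMeasure_map hY.aemeasurable
  rw [← lintegral_map hf.lintegral_prod_right' hX, ← lintegral_prod _ hf.aemeasurable, ← hmap,
    lintegral_map hf (hX.prodMk hY)]

section Sampling

variable {K m : ℕ} {𝒳 : Type v} [MeasurableSpace 𝒳] {Rand : Type w}

lemma measurable_obs_of_adapted {S : ℕ → Rand × Path K 𝒳 → Subsets K m}
    {mΩ : MeasurableSpace (Rand × Path K 𝒳)} {n : ℕ}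
    (hS : ∀ E, MeasurableSet[mΩ] {ω | S n ω = E})
    (hn : Measurable[mΩ] fun ω : Rand × Path K 𝒳 => ω.2 n) :
    Measurable[mΩ] fun ω => obs (S n ω) (ω.2 n) := by
  intro B hB
  have : (fun ω => obs (S n ω) (ω.2 n)) ⁻¹' B =
      ⋃ E, {ω | S n ω = E} ∩ (fun ω => obs E (ω.2 n)) ⁻¹' B := by
    ext ω
    simp
  rw [this]
  exact .iUnion fun E => (hS E).inter (((measurable_obs E).comp hn) hB)

variable [MeasurableSpace Rand]

/-- The randomization device and the first `n` observations. -/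
def past (n : ℕ) (ω : Rand × Path K 𝒳) : Rand × ((i : Finset.range n) → Fin K → 𝒳) :=
  (ω.1, (Finset.range n).restrict ω.2)

lemma measurable_past (n : ℕ) : Measurable (past n : Rand × Path K 𝒳 → _) :=
  measurable_fst.prodMk ((Finset.measurable_restrict _).comp measurable_snd)

variable {S : ℕ → Rand × Path K 𝒳 → Subsets K m}

/-- The history is generated by adaptively chosen coordinates. The larger σ-algebra of the device
and the complete first `n` observations comes from a fixed map, whose independence of the next
observation is visible in the product law. -/
lemma history_le_comap_past (hS : ∀ n E, MeasurableSet[history S n] {ω | S n ω = E}) (n : ℕ) :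
    history S n ≤ MeasurableSpace.comap (past n) inferInstance := by
  induction n with
  | zero =>
    have : (Prod.fst : Rand × Path K 𝒳 → Rand) = Prod.fst ∘ past 0 := rfl
    simp only [history]
    rw [this, ← MeasurableSpace.comap_comp]
    exact MeasurableSpace.comap_mono (measurable_fst.comap_le)
  | succ n ih =>
    have hle : MeasurableSpace.comap (past n : Rand × Path K 𝒳 → _) inferInstance ≤
        MeasurableSpace.comap (past (n + 1)) inferInstance := by
      have : (past n : Rand × Path K 𝒳 → _) =
          (fun q : Rand × ((i : Finset.range (n + 1)) → Fin K → 𝒳) =>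
            (q.1, fun i : Finset.range n => q.2 ⟨i, by
              have := Finset.mem_range.1 i.2
              exact Finset.mem_range.2 (by omega)⟩)) ∘ past (n + 1) := rfl
      rw [this, ← MeasurableSpace.comap_comp]
      refine MeasurableSpace.comap_mono (Measurable.comap_le ?_)
      exact measurable_fst.prodMk (measurable_pi_lambda _ fun i =>
        (measurable_pi_apply _).comp measurable_snd)
    refine sup_le (ih.trans hle) (Measurable.comap_le ?_)
    refine measurable_obs_of_adapted (fun E => hle _ (ih _ (hS n E))) ?_
    have : (fun ω : Rand × Path K 𝒳 => ω.2 n) =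
        (fun q : Rand × ((i : Finset.range (n + 1)) → Fin K → 𝒳) =>
          q.2 ⟨n, Finset.self_mem_range_succ n⟩) ∘ past (n + 1) := rfl
    rw [this]
    exact Measurable.comp ((measurable_pi_apply _).comp measurable_snd) (comap_measurable _)

lemma history_le (hS : ∀ n E, MeasurableSet[history S n] {ω | S n ω = E}) (n : ℕ) :
    history S n ≤ (inferInstance : MeasurableSpace (Rand × Path K 𝒳)) :=
  (history_le_comap_past hS n).trans (measurable_past n).comap_le

lemma measurableSet_sample_eq (hS : ∀ n E, MeasurableSet[history S n] {ω | S n ω = E}) (n : ℕ)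
    (E : Subsets K m) : MeasurableSet {ω | S n ω = E} :=
  history_le hS n _ (hS n E)

lemma partialHistory_le (hS : ∀ n E, MeasurableSet[history S n] {ω | S n ω = E})
    (𝒜 : Set (Subsets K m)) (ν : ℕ) : partialHistory S 𝒜 ν ≤ history S ν := by
  refine MeasurableSpace.generateFrom_le ?_
  rintro s ⟨t, ht, E, -, B, hB, rfl⟩
  refine history_mono S (Nat.succ_le_of_lt ht) _ ?_
  have h1 : MeasurableSet[history S (t + 1)] {ω | S t ω = E} :=
    history_mono S t.le_succ _ (hS t E)
  have h2 : Measurable[history S (t + 1)] fun ω => obs (S t ω) (ω.2 t) :=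
    (comap_measurable _).mono le_sup_right le_rfl
  have : {ω : Rand × Path K 𝒳 | S t ω = E ∧ obs E (ω.2 t) ∈ B} =
      {ω | S t ω = E} ∩ (fun ω => obs (S t ω) (ω.2 t)) ⁻¹' B := by
    ext ω
    constructor
    · rintro ⟨rfl, h⟩; exact ⟨rfl, h⟩
    · rintro ⟨rfl, h⟩; exact ⟨rfl, h⟩
  rw [this]
  exact h1.inter (h2 hB)

variable {ρ : Measure Rand} {μ : ℕ → Measure (Fin K → 𝒳)} [∀ i, IsProbabilityMeasure (μ i)]

lemma lintegral_past (n : ℕ)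
    {f : (Rand × ((i : Finset.range n) → Fin K → 𝒳)) × (Fin K → 𝒳) → ℝ≥0∞} (hf : Measurable f) :
    ∫⁻ ω, f (past n ω, ω.2 n) ∂(ρ.prod (Measure.infinitePi μ)) =
      ∫⁻ ω, ∫⁻ z, f (past n ω, z) ∂(μ n) ∂(ρ.prod (Measure.infinitePi μ)) := by
  have hind : ProbabilityTheory.IndepFun (fun x : Path K 𝒳 => (Finset.range n).restrict x)
      (fun x => x n) (Measure.infinitePi μ) := by
    have h := (ProbabilityTheory.iIndepFun_infinitePi (P := μ)
      (X := fun _ x => x) (fun _ => measurable_id)).indepFun_finset (Finset.range n) {n}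
        (by simp) (fun i => measurable_pi_apply i)
    have hp : Measurable fun q : ({n} : Finset ℕ) → Fin K → 𝒳 =>
      q ⟨n, Finset.mem_singleton_self n⟩ := measurable_pi_apply _
    exact h.comp measurable_id hp
  have hev : (Measure.infinitePi μ).map (fun x => x n) = μ n := Measure.infinitePi_map_eval μ n
  have hm : Measurable fun ω : Rand × Path K 𝒳 => f (past n ω, ω.2 n) :=
    hf.comp ((measurable_past n).prodMk ((measurable_pi_apply n).comp measurable_snd))
  rw [lintegral_prod _ hm.aemeasurable, lintegral_prod _ ?_]
  · refine lintegral_congr fun a => ?_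
    have h := lintegral_indepFun (Finset.measurable_restrict _) (measurable_pi_apply n) hind
      (f := fun q => f ((a, q.1), q.2))
      (hf.comp ((measurable_const.prodMk measurable_fst).prodMk measurable_snd))
    rw [hev] at h
    exact h
  · exact (hf.lintegral_prod_right'.comp (measurable_past n)).aemeasurable

variable [IsProbabilityMeasure ρ]

lemma indep_history (hS : ∀ n E, MeasurableSet[history S n] {ω | S n ω = E}) (n : ℕ) :
    ProbabilityTheory.Indep (history S n)
      (MeasurableSpace.comap (fun ω : Rand × Path K 𝒳 => ω.2 n) inferInstance)
      (ρ.prod (Measure.infinitePi μ)) := by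
  refine ProbabilityTheory.indep_of_indep_of_le_left ?_ (history_le_comap_past hS n)
  have hev : Measurable fun ω : Rand × Path K 𝒳 => ω.2 n :=
    (measurable_pi_apply n).comp measurable_snd
  rw [ProbabilityTheory.Indep_iff]
  rintro _ _ ⟨t, ht, rfl⟩ ⟨B, hB, rfl⟩
  have h1 := lintegral_past (ρ := ρ) (μ := μ) n (f := (t ×ˢ B).indicator fun _ => 1)
    (measurable_const.indicator (ht.prod hB))
  have h2 := lintegral_past (ρ := ρ) (μ := μ) n (f := (Set.univ ×ˢ B).indicator fun _ => 1)
    (measurable_const.indicator (MeasurableSet.univ.prod hB))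
  have e : ∀ s : Set (Rand × ((i : Finset.range n) → Fin K → 𝒳)), MeasurableSet s →
      ∫⁻ ω, (s ×ˢ B).indicator (fun _ => (1 : ℝ≥0∞)) (past n ω, ω.2 n)
        ∂(ρ.prod (Measure.infinitePi μ)) = (ρ.prod (Measure.infinitePi μ))
          (past n ⁻¹' s ∩ (fun ω => ω.2 n) ⁻¹' B) := by
    intro s hs
    rw [← lintegral_indicator_one ((measurable_past n hs).inter (hev hB))]
    rfl
  have e' : ∀ s : Set (Rand × ((i : Finset.range n) → Fin K → 𝒳)), MeasurableSet s →
      ∫⁻ ω, ∫⁻ z, (s ×ˢ B).indicator (fun _ => (1 : ℝ≥0∞)) (past n ω, z) ∂(μ n)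
        ∂(ρ.prod (Measure.infinitePi μ)) =
      (ρ.prod (Measure.infinitePi μ)) (past n ⁻¹' s) * μ n B := by
    intro s hs
    have : ∀ ω : Rand × Path K 𝒳, ∫⁻ z, (s ×ˢ B).indicator (fun _ => (1 : ℝ≥0∞)) (past n ω, z) ∂(μ n) =
        (past n ⁻¹' s).indicator (fun _ => μ n B) ω := by
      intro ω
      by_cases h : past n ω ∈ s
      · rw [Set.indicator_of_mem (s := past n ⁻¹' s) h, ← lintegral_indicator_one hB]
        refine lintegral_congr fun z => ?_
        by_cases hz : z ∈ B <;> simp [h, hz, Set.indicator]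
      · rw [Set.indicator_of_notMem (s := past n ⁻¹' s) h]
        simp [h, Set.indicator]
    rw [lintegral_congr this, lintegral_indicator (measurable_past n hs)]
    simp [mul_comm]
  rw [e _ ht, e' _ ht] at h1
  rw [e _ .univ, e' _ .univ] at h2
  rw [h1]
  simp only [Set.preimage_univ, Set.univ_inter, measure_univ, one_mul] at h2
  rw [h2]

/-- Integrating out the observation collected at time `n + 1`, given the history up to time
`n`. -/
lemma lintegral_next (hS : ∀ n E, MeasurableSet[history S n] {ω | S n ω = E}) {n : ℕ}
    {A : Type*} [MeasurableSpace A] {V : Rand × Path K 𝒳 → A} (hV : Measurable[history S n] V)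
    {f : Subsets K m → A × (Fin m → 𝒳) → ℝ≥0∞} (hf : ∀ E, Measurable (f E)) :
    ∫⁻ ω, f (S n ω) (V ω, obs (S n ω) (ω.2 n)) ∂(ρ.prod (Measure.infinitePi μ)) =
      ∫⁻ ω, ∫⁻ z, f (S n ω) (V ω, z) ∂((μ n).map (obs (S n ω)))
        ∂(ρ.prod (Measure.infinitePi μ)) := by
  set P := ρ.prod (Measure.infinitePi μ) with hP
  have hev : Measurable fun ω : Rand × Path K 𝒳 => ω.2 n :=
    (measurable_pi_apply n).comp measurable_snd
  have hmapev : P.map (fun ω : Rand × Path K 𝒳 => ω.2 n) = μ n := by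
    have : (fun ω : Rand × Path K 𝒳 => ω.2 n) = (fun x => x n) ∘ Prod.snd := rfl
    rw [this, ← Measure.map_map (measurable_pi_apply n) measurable_snd, hP, Measure.map_snd_prod,
      measure_univ, one_smul]
    exact Measure.infinitePi_map_eval μ n
  have hVm : Measurable V := hV.mono (history_le hS n) le_rfl
  have key : ∀ E : Subsets K m,
      ∫⁻ ω in {ω | S n ω = E}, f (S n ω) (V ω, obs (S n ω) (ω.2 n)) ∂P =
      ∫⁻ ω in {ω | S n ω = E}, ∫⁻ z, f (S n ω) (V ω, z) ∂((μ n).map (obs (S n ω))) ∂P := by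
    intro E
    have hEm := measurableSet_sample_eq hS n E
    -- Carrying the indicator of the event that `E` is sampled along with `V` freezes the adaptive
    -- choice, so that independence applies to a fixed `obs E`.
    let X : Rand × Path K 𝒳 → ℝ≥0∞ × A := fun ω => ({ω | S n ω = E}.indicator 1 ω, V ω)
    have hX : Measurable[history S n] X :=
      ((@measurable_const _ _ _ (history S n) 1).indicator (hS n E)).prodMk hV
    have hind : ProbabilityTheory.IndepFun X (fun ω => ω.2 n) P :=
      ProbabilityTheory.indep_of_indep_of_le_left (indep_history hS n) hX.comap_le
    have h := lintegral_indepFun (hX.mono (history_le hS n) le_rfl) hev hind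
      (f := fun q => q.1.1 * f E (q.1.2, obs E q.2))
      ((measurable_fst.comp measurable_fst).mul ((hf E).comp
        ((measurable_snd.comp measurable_fst).prodMk ((measurable_obs E).comp measurable_snd))))
    rw [hmapev] at h
    rw [← lintegral_indicator hEm, ← lintegral_indicator hEm]
    refine Eq.trans (lintegral_congr fun ω => ?_) (h.trans (lintegral_congr fun ω => ?_))
    · by_cases hω : S n ω = E
      · simp [X, hω]
      · simp [X, hω]
    · by_cases hω : S n ω = E
      · have hz : Measurable fun z => f E (V ω, z) := (hf E).comp (measurable_const.prodMk measurable_id)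
        simp only [X, hω, Set.indicator_of_mem (s := {ω | S n ω = E}) hω, Pi.one_apply, one_mul]
        rw [lintegral_map hz (measurable_obs E)]
      · simp [X, hω]
  have hdecomp : ∀ g : Rand × Path K 𝒳 → ℝ≥0∞,
      ∫⁻ ω, g ω ∂P = ∑' E, ∫⁻ ω in {ω | S n ω = E}, g ω ∂P := by
    intro g
    rw [← lintegral_iUnion (measurableSet_sample_eq hS n) ?_]
    · have : (⋃ E, {ω | S n ω = E}) = Set.univ := by ext; simp
      rw [this, setLIntegral_univ]
    · intro E E' hne
      refine Set.disjoint_left.2 fun ω h1 h2 => hne ?_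
      rw [← (show S n ω = E from h1), (show S n ω = E' from h2)]
  rw [hdecomp, hdecomp (fun ω => ∫⁻ z, f (S n ω) (V ω, z) ∂((μ n).map (obs (S n ω))))]
  exact tsum_congr key

end Sampling

/-! ### Change of measure along an adaptive sampling rule -/

/-- Stated for abstract spaces so that the σ-algebra on `A` can be a history instead of the ambient
one. -/
lemma measurable_mul_fst_snd {A B : Type*} [MeasurableSpace A] [MeasurableSpace B]
    {g : A × B → ℝ≥0∞} {d : B → ℝ≥0∞} {D : A → ℝ≥0∞} (hg : Measurable g) (hd : Measurable d)
    (hD : Measurable D) : Measurable fun q : A × B => g q * (d q.2 * D q.1) :=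
  hg.mul ((hd.comp measurable_snd).mul (hD.comp measurable_fst))

section ChangeOfMeasure

variable {K m : ℕ} {𝒳 : Type v} [MeasurableSpace 𝒳] {Rand : Type w} [MeasurableSpace Rand]
  {S : ℕ → Rand × Path K 𝒳 → Subsets K m}

lemma measurable_of_sample (hS : ∀ n E, MeasurableSet[history S n] {ω | S n ω = E}) {n : ℕ}
    {A B : Type*} [MeasurableSpace A] [MeasurableSpace B] {mΩ : MeasurableSpace (Rand × Path K 𝒳)}
    (hle : history S n ≤ mΩ) {V : Rand × Path K 𝒳 → A}
    (hV : Measurable[mΩ] V) {g : Subsets K m → A → B} (hg : ∀ E, Measurable (g E)) :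
    Measurable[mΩ] fun ω => g (S n ω) (V ω) := by
  intro B hB
  have : (fun ω => g (S n ω) (V ω)) ⁻¹' B =
      ⋃ E, {ω | S n ω = E} ∩ (fun ω => g E (V ω)) ⁻¹' B := by
    ext ω
    simp
  rw [this]
  exact .iUnion fun E => (hle _ (hS n E)).inter (((hg E).comp hV) hB)

lemma measurable_sample_obs (hS : ∀ n E, MeasurableSet[history S n] {ω | S n ω = E})
    {g : Subsets K m → (Fin m → 𝒳) → ℝ} (hg : ∀ E, Measurable (g E)) {i n : ℕ} (hi : i < n) :
    Measurable[history S n] fun ω => g (S i ω) (obs (S i ω) (ω.2 i)) := by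
  have h2 : Measurable[history S n] fun ω => obs (S i ω) (ω.2 i) :=
    ((comap_measurable _).mono le_sup_right le_rfl).mono
      (history_mono S (Nat.succ_le_of_lt hi)) le_rfl
  exact measurable_of_sample hS (history_mono S hi.le) h2 hg

variable {ρ : Measure Rand} [IsProbabilityMeasure ρ] {μ μ' : ℕ → Measure (Fin K → 𝒳)}
  [∀ i, IsProbabilityMeasure (μ i)] [∀ i, IsProbabilityMeasure (μ' i)]

/-- Change of measure on the history of an adapted sampling rule. -/
lemma lintegral_history_eq (hS : ∀ n E, MeasurableSet[history S n] {ω | S n ω = E})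
    {ℓ : ℕ → Subsets K m → (Fin m → 𝒳) → ℝ} (hℓ : ∀ i E, Measurable (ℓ i E))
    (hμ : ∀ i E, (μ' i).map (obs E) =
      ((μ i).map (obs E)).withDensity fun z => ENNReal.ofReal (Real.exp (ℓ i E z)))
    (n : ℕ) {V : Rand × Path K 𝒳 → ℝ≥0∞} (hV : Measurable[history S n] V) :
    ∫⁻ ω, V ω ∂(ρ.prod (Measure.infinitePi μ')) =
      ∫⁻ ω, V ω * ENNReal.ofReal
        (Real.exp (∑ i ∈ Finset.range n, ℓ i (S i ω) (obs (S i ω) (ω.2 i))))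
        ∂(ρ.prod (Measure.infinitePi μ)) := by
  induction n generalizing V with
  | zero =>
    obtain ⟨g, hg, rfl⟩ := Measurable.exists_eq_measurable_comp (f := Prod.fst) hV
    have h : ∀ κ : ℕ → Measure (Fin K → 𝒳), [∀ i, IsProbabilityMeasure (κ i)] →
        ∫⁻ ω, (g ∘ Prod.fst) ω ∂(ρ.prod (Measure.infinitePi κ)) = ∫⁻ a, g a ∂ρ := by
      intro κ _
      rw [lintegral_prod _ (hg.comp measurable_fst).aemeasurable]
      simp
    simp only [Finset.range_zero, Finset.sum_empty, Real.exp_zero, ENNReal.ofReal_one, mul_one]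
    rw [h, h]
  | succ n ih =>
    -- The history at `n + 1` is generated by the history at `n` and one new observation. By the
    -- Doob–Dynkin factorisation `V` is then a function `g` of the two, and the new observation can
    -- be integrated out with its own density.
    have hcomap : history S (n + 1) = MeasurableSpace.comap
        (fun ω => (ω, obs (S n ω) (ω.2 n))) ((history S n).prod inferInstance) := by
      rw [MeasurableSpace.prod, MeasurableSpace.comap_sup, MeasurableSpace.comap_comp,
        MeasurableSpace.comap_comp]
      have : (Prod.fst ∘ fun ω : Rand × Path K 𝒳 => (ω, obs (S n ω) (ω.2 n))) = id := rfl
      rw [this, MeasurableSpace.comap_id]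
      rfl
    rw [hcomap] at hV
    obtain ⟨g, hg, rfl⟩ := @Measurable.exists_eq_measurable_comp _ _ _
      ((history S n).prod inferInstance) _ _ _ _ _ hV
    set D : Rand × Path K 𝒳 → ℝ≥0∞ := fun ω => ENNReal.ofReal
        (Real.exp (∑ i ∈ Finset.range n, ℓ i (S i ω) (obs (S i ω) (ω.2 i)))) with hD
    have hDm : Measurable[history S n] D := by
      refine ENNReal.measurable_ofReal.comp (Real.measurable_exp.comp ?_)
      exact Finset.measurable_sum _ fun i hi =>
        measurable_sample_obs hS (hℓ i) (Finset.mem_range.1 hi)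
    have hd : ∀ E, Measurable fun z => ENNReal.ofReal (Real.exp (ℓ n E z)) := fun E =>
      ENNReal.measurable_ofReal.comp (Real.measurable_exp.comp (hℓ n E))
    have h1 := @lintegral_next K m 𝒳 _ Rand _ S ρ μ' _ _ hS n (Rand × Path K 𝒳) (history S n) id
      measurable_id (fun _ => g) (fun _ => hg)
    have h2 := @lintegral_next K m 𝒳 _ Rand _ S ρ μ _ _ hS n (Rand × Path K 𝒳) (history S n) id
      measurable_id (fun E q => g q * (ENNReal.ofReal (Real.exp (ℓ n E q.2)) * D q.1))
      (fun E => @measurable_mul_fst_snd _ _ (history S n) _ _ _ _ hg (hd E) hDm)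
    have hinner : Measurable[history S n] fun ω =>
        ∫⁻ z, g (ω, z) ∂((μ' n).map (obs (S n ω))) := by
      refine @measurable_of_sample K m 𝒳 _ Rand _ S hS n (Rand × Path K 𝒳) ℝ≥0∞ (history S n) _
        (history S n) le_rfl id measurable_id (fun E ω => ∫⁻ z, g (ω, z) ∂((μ' n).map (obs E)))
        fun E => ?_
      have : IsProbabilityMeasure ((μ' n).map (obs E)) :=
        Measure.isProbabilityMeasure_map (measurable_obs E).aemeasurable
      exact @Measurable.lintegral_prod_right' _ _ (history S n) _ _ _ _ hg
    simp only [id] at h1 h2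
    simp only [Function.comp]
    rw [h1, ih hinner]
    refine Eq.trans (lintegral_congr fun ω => ?_) (h2.symm.trans (lintegral_congr fun ω => ?_))
    · have hgz : Measurable fun z => g (ω, z) :=
        hg.comp (@measurable_prodMk_left _ _ (history S n) _ ω)
      rw [hμ, lintegral_withDensity_eq_lintegral_mul _ (hd _) hgz,
        ← lintegral_mul_const _ ((hd _).mul hgz)]
      refine lintegral_congr fun z => ?_
      simp only [Pi.mul_apply, hD]
      ring
    · rw [Finset.sum_range_succ, add_comm, Real.exp_add, ENNReal.ofReal_mul (Real.exp_pos _).le]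

end ChangeOfMeasure

/-! ### The likelihood ratio of a change and its fluctuations -/

section LowerBound

variable {K m : ℕ} {𝒳 : Type v} [MeasurableSpace 𝒳] {F G : ProbabilityMeasure (Fin K → 𝒳)}

instance isProbabilityMeasure_localLaw (E : Subsets K m) : IsProbabilityMeasure (localLaw F E) :=
  Measure.isProbabilityMeasure_map (measurable_obs E).aemeasurable

instance isProbabilityMeasure_ite (ν i : ℕ) : IsProbabilityMeasure
    (if i < ν then (F : Measure (Fin K → 𝒳)) else (G : Measure (Fin K → 𝒳))) := by
  split_ifs <;> infer_instance

instance isProbabilityMeasure_changeLaw (ν : ℕ) : IsProbabilityMeasure (changeLaw F G ν) := by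
  unfold changeLaw; infer_instance

instance isProbabilityMeasure_noChangeLaw : IsProbabilityMeasure (noChangeLaw F) := by
  unfold noChangeLaw; infer_instance

/-- `Q ≪ P` excludes points where dP/dQ vanishes; there the logarithm takes the default value 0, and
its exponential would be 1. -/
lemma withDensity_exp_llr {Z : Type*} [MeasurableSpace Z] {P Q : Measure Z}
    [IsProbabilityMeasure P] [IsProbabilityMeasure Q] (h : P ≪ Q) (h' : Q ≪ P) :
    Q.withDensity (fun z => ENNReal.ofReal (Real.exp (llr P Q z))) = P := by
  rw [← Measure.withDensity_rnDeriv_eq P Q h]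
  have e := exp_llr_of_ac' P Q h'
  rw [Measure.withDensity_rnDeriv_eq P Q h]
  conv_rhs => rw [← Measure.withDensity_rnDeriv_eq P Q h]
  refine withDensity_congr_ae ?_
  filter_upwards [e, Measure.rnDeriv_lt_top P Q] with z hz hlt
  rw [hz, ENNReal.ofReal_toReal hlt.ne]

lemma localLaw_ac (hac : ∀ E ∈ affected m F G,
      localLaw G E ≪ localLaw F E ∧ localLaw F E ≪ localLaw G E) (E : Subsets K m) :
    localLaw G E ≪ localLaw F E ∧ localLaw F E ≪ localLaw G E := by
  by_cases hE : E ∈ affected m F G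
  · exact hac E hE
  · have : localLaw G E = localLaw F E := not_not.1 hE
    rw [this]
    exact ⟨.rfl, .rfl⟩

/-- The likelihood ratio of a change at time `ν`, accumulated over the `n` observations after
time `ν`. -/
noncomputable def logLik (F G : ProbabilityMeasure (Fin K → 𝒳)) {Rand : Type w}
    (S : ℕ → Rand × Path K 𝒳 → Subsets K m) (ν n : ℕ) (ω : Rand × Path K 𝒳) : ℝ :=
  ∑ i ∈ Finset.range n, llr (localLaw G (S (ν + i) ω)) (localLaw F (S (ν + i) ω))
    (obs (S (ν + i) ω) (ω.2 (ν + i)))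

variable {Rand : Type w} [MeasurableSpace Rand] {S : ℕ → Rand × Path K 𝒳 → Subsets K m}
  {ρ : Measure Rand} [IsProbabilityMeasure ρ]

/-- Up to time `ν` both laws give the observations the law `F`, so those factors of the likelihood
ratio are 1. -/
lemma lintegral_changeLaw_eq (hac : ∀ E ∈ affected m F G,
      localLaw G E ≪ localLaw F E ∧ localLaw F E ≪ localLaw G E)
    (hS : ∀ n E, MeasurableSet[history S n] {ω | S n ω = E}) (ν n : ℕ)
    {V : Rand × Path K 𝒳 → ℝ≥0∞} (hV : Measurable[history S (ν + n)] V) :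
    ∫⁻ ω, V ω ∂(ρ.prod (changeLaw F G ν)) =
      ∫⁻ ω, V ω * ENNReal.ofReal (Real.exp (logLik F G S ν n ω)) ∂(ρ.prod (noChangeLaw F)) := by
  have h := lintegral_history_eq (ρ := ρ) (μ := fun _ => (F : Measure (Fin K → 𝒳)))
    (μ' := fun i => if i < ν then (F : Measure (Fin K → 𝒳)) else (G : Measure (Fin K → 𝒳))) hS
    (ℓ := fun i E => if i < ν then 0 else llr (localLaw G E) (localLaw F E))
    (fun i E => by
      split_ifs
      · exact measurable_const
      · exact measurable_llr _ _)
    (fun i E => by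
      split_ifs
      · simp
      · exact (withDensity_exp_llr (localLaw_ac hac E).1 (localLaw_ac hac E).2).symm)
    (ν + n) hV
  refine h.trans (lintegral_congr fun ω => ?_)
  congr 3
  rw [Finset.sum_range_add, logLik, Finset.sum_eq_zero, zero_add]
  · refine Finset.sum_congr rfl fun i _ => ?_
    rw [if_neg (by omega)]
  · intro i hi
    rw [if_pos (Finset.mem_range.1 hi)]
    rfl

lemma changeLaw_apply_eq (hac : ∀ E ∈ affected m F G,
      localLaw G E ≪ localLaw F E ∧ localLaw F E ≪ localLaw G E)
    (hS : ∀ n E, MeasurableSet[history S n] {ω | S n ω = E}) (ν : ℕ)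
    {s : Set (Rand × Path K 𝒳)} (hs : MeasurableSet[history S ν] s) :
    ρ.prod (changeLaw F G ν) s = ρ.prod (noChangeLaw F) s := by
  have hs' := history_le hS ν _ hs
  have h := lintegral_changeLaw_eq (ρ := ρ) hac hS ν 0 (V := s.indicator fun _ => 1)
    ((@measurable_const _ _ _ (history S ν) 1).indicator hs)
  simp only [logLik, Finset.range_zero, Finset.sum_empty, Real.exp_zero, ENNReal.ofReal_one,
    mul_one] at h
  rw [lintegral_indicator hs', lintegral_indicator hs'] at h
  simpa using h

lemma measurable_logLik (hS : ∀ n E, MeasurableSet[history S n] {ω | S n ω = E}) (ν n : ℕ) :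
    Measurable[history S (ν + n)] (logLik F G S ν n) :=
  Finset.measurable_sum _ fun i hi =>
    measurable_sample_obs (g := fun E => llr (localLaw G E) (localLaw F E)) hS
      (fun E => measurable_llr _ _) (by have := Finset.mem_range.1 hi; omega)

/-- Second moment of the centred log-likelihood ratio. -/
lemma lintegral_sq_le (hS : ∀ n E, MeasurableSet[history S n] {ω | S n ω = E})
    {g : Subsets K m → (Fin m → 𝒳) → ℝ} (hg : ∀ E, Measurable (g E))
    (h2 : ∀ E, Integrable (fun z => g E z ^ 2) (localLaw G E))
    (h0 : ∀ E, ∫ z, g E z ∂(localLaw G E) = 0) {σ : ℝ}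
    (hσ : ∀ E, ∫ z, g E z ^ 2 ∂(localLaw G E) ≤ σ) (ν n : ℕ) {s : Set (Rand × Path K 𝒳)}
    (hs : MeasurableSet[history S ν] s) :
    ∫⁻ ω in s, ENNReal.ofReal
        ((∑ i ∈ Finset.range n, g (S (ν + i) ω) (obs (S (ν + i) ω) (ω.2 (ν + i)))) ^ 2)
        ∂(ρ.prod (changeLaw F G ν)) ≤
      n * ENNReal.ofReal σ * ρ.prod (changeLaw F G ν) s := by
  have hs' := history_le hS ν _ hs
  induction n with
  | zero => simp
  | succ n ih =>
    set P := ρ.prod (changeLaw F G ν) with hP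
    set M : Rand × Path K 𝒳 → ℝ := fun ω =>
      ∑ i ∈ Finset.range n, g (S (ν + i) ω) (obs (S (ν + i) ω) (ω.2 (ν + i))) with hM
    have hMm : Measurable[history S (ν + n)] M := Finset.measurable_sum _ fun i hi =>
      measurable_sample_obs hS hg (by have := Finset.mem_range.1 hi; omega)
    have hind : Measurable[history S (ν + n)] (s.indicator fun _ => (1 : ℝ≥0∞)) :=
      (@measurable_const _ _ _ (history S (ν + n)) 1).indicator
        (history_mono S (Nat.le_add_right ν n) _ hs)
    have h := lintegral_next (ρ := ρ)
      (μ := fun i => if i < ν then (F : Measure (Fin K → 𝒳)) else (G : Measure (Fin K → 𝒳))) hS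
      (n := ν + n) (V := fun ω => (s.indicator (fun _ => (1 : ℝ≥0∞)) ω, M ω)) (hind.prodMk hMm)
      (f := fun E q => q.1.1 * ENNReal.ofReal ((q.1.2 + g E q.2) ^ 2)) (fun E =>
        (measurable_fst.comp measurable_fst).mul (ENNReal.measurable_ofReal.comp
          (((measurable_snd.comp measurable_fst).add ((hg E).comp measurable_snd)).pow_const 2)))
    have hG : ∀ E : Subsets K m, (if ν + n < ν then (F : Measure (Fin K → 𝒳)) else
        (G : Measure (Fin K → 𝒳))).map (obs E) = localLaw G E := fun E => by
      rw [if_neg (by omega)]; rfl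
    simp only [hG] at h
    -- The cross term vanishes because `g E` is centred: the increments are orthogonal, whichever
    -- set is sampled.
    have hinner : ∀ (E : Subsets K m) (x : ℝ), ∫⁻ z, ENNReal.ofReal ((x + g E z) ^ 2) ∂(localLaw G E) ≤
        ENNReal.ofReal (x ^ 2) + ENNReal.ofReal σ := by
      intro E x
      have hL2 : MemLp (g E) 2 (localLaw G E) :=
        (memLp_two_iff_integrable_sq (hg E).aestronglyMeasurable).2 (h2 E)
      have hgi : Integrable (g E) (localLaw G E) := hL2.integrable (by norm_num)
      have e : (fun z => (x + g E z) ^ 2) = fun z => x ^ 2 + (2 * x) * g E z + g E z ^ 2 := by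
        ext z; ring
      have hi : Integrable (fun z => (x + g E z) ^ 2) (localLaw G E) := by
        rw [e]
        exact ((integrable_const _).add (hgi.const_mul _)).add (h2 E)
      rw [← ofReal_integral_eq_lintegral_ofReal hi (ae_of_all _ fun z => sq_nonneg _), e,
        integral_add (f := fun z => x ^ 2 + 2 * x * g E z)
          ((integrable_const _).add (hgi.const_mul _)) (h2 E),
        integral_add (integrable_const _) (hgi.const_mul _), integral_const_mul, h0]
      simp only [integral_const, probReal_univ, one_smul, mul_zero, add_zero]
      exact (ENNReal.ofReal_le_ofReal (by gcongr; exact hσ E)).trans ENNReal.ofReal_add_le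
    calc ∫⁻ ω in s, ENNReal.ofReal ((∑ i ∈ Finset.range (n + 1),
            g (S (ν + i) ω) (obs (S (ν + i) ω) (ω.2 (ν + i)))) ^ 2) ∂P
        = ∫⁻ ω, s.indicator (fun _ => (1 : ℝ≥0∞)) ω * ENNReal.ofReal
            ((M ω + g (S (ν + n) ω) (obs (S (ν + n) ω) (ω.2 (ν + n)))) ^ 2) ∂P := by
          rw [← lintegral_indicator hs']
          refine lintegral_congr fun ω => ?_
          by_cases hω : ω ∈ s <;> simp [hω, hM, Finset.sum_range_succ]
      _ = _ := h
      _ ≤ ∫⁻ ω, s.indicator (fun ω => ENNReal.ofReal (M ω ^ 2) + ENNReal.ofReal σ) ω ∂P := by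
          refine lintegral_mono fun ω => ?_
          by_cases hω : ω ∈ s
          · simpa [hω] using hinner (S (ν + n) ω) (M ω)
          · simp [hω]
      _ = ∫⁻ ω in s, ENNReal.ofReal (M ω ^ 2) ∂P + ENNReal.ofReal σ * P s := by
          rw [lintegral_indicator hs', lintegral_add_right _ measurable_const]
          simp
      _ ≤ n * ENNReal.ofReal σ * P s + ENNReal.ofReal σ * P s := by gcongr
      _ = _ := by push_cast; ring

end LowerBound

/-! ### Lower bound on the delay of every policy -/

section DelayBounds

variable {K m : ℕ} {𝒳 : Type v} [MeasurableSpace 𝒳] {F G : ProbabilityMeasure (Fin K → 𝒳)}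

lemma measurableSet_stop_le (π : Policy.{v, w} K m 𝒳) {k n : ℕ} (h : k ≤ n) :
    MeasurableSet[history π.S n] {ω | (k : ℕ∞) < π.T ω} := by
  have : {ω | (k : ℕ∞) < π.T ω} = (⋃ i : Fin (k + 1), {ω | π.T ω = (i : ℕ)})ᶜ := by
    ext ω
    simp only [Set.mem_ofPred_eq, Set.mem_compl_iff, Set.mem_iUnion, not_exists]
    constructor
    · intro hlt i hi
      rw [hi] at hlt
      have h1 : k < (i : ℕ) := by exact_mod_cast hlt
      omega
    · intro hne
      by_contra hle
      rw [not_lt] at hle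
      obtain ⟨t, ht⟩ := ENat.ne_top_iff_exists.1 (ne_top_of_le_ne_top (ENat.natCast_ne_top k) hle)
      rw [← ht] at hle
      have h1 : t ≤ k := by exact_mod_cast hle
      exact hne ⟨t, by omega⟩ ht.symm
  rw [this]
  refine MeasurableSet.compl (.iUnion fun i => ?_)
  exact history_mono π.S (by omega) _ (π.stopping i)

lemma measurableSet_lt_stop (π : Policy.{v, w} K m 𝒳) (n : ℕ) :
    MeasurableSet {ω | (n : ℕ∞) < π.T ω} :=
  history_le π.adapted n _ (measurableSet_stop_le π le_rfl)

/-- The sum is `h` times the number of multiples of `h` below `t`, that is, `t` rounded up to a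
multiple of `h`. -/
lemma toENNReal_le_tsum {h : ℕ} (hh : 1 ≤ h) (t : ℕ∞) :
    (t : ℝ≥0∞) ≤ ∑' j : ℕ, if ((j * h : ℕ) : ℕ∞) < t then (h : ℝ≥0∞) else 0 := by
  have key : ∀ J : ℕ, (∀ j < J, ((j * h : ℕ) : ℕ∞) < t) → ((J * h : ℕ) : ℝ≥0∞) ≤
      ∑' j : ℕ, if ((j * h : ℕ) : ℕ∞) < t then (h : ℝ≥0∞) else 0 := by
    intro J hJ
    refine le_trans (le_of_eq ?_) (ENNReal.sum_le_tsum (Finset.range J))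
    rw [Finset.sum_congr rfl fun j hj => if_pos (hJ j (Finset.mem_range.1 hj))]
    simp
  induction t using ENat.recTopCoe with
  | top =>
    rw [ENat.toENNReal_top, top_le_iff]
    refine ENNReal.eq_top_of_forall_nnreal_le fun r => ?_
    obtain ⟨J, hJ⟩ := exists_nat_ge r
    refine le_trans ?_ (key J fun j _ => ENat.natCast_lt_top _)
    calc (r : ℝ≥0∞) ≤ (J : ℝ≥0∞) := by exact_mod_cast hJ
      _ ≤ ((J * h : ℕ) : ℝ≥0∞) := by exact_mod_cast Nat.le_mul_of_pos_right J hh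
  | coe t =>
    rcases Nat.eq_zero_or_pos t with rfl | ht
    · simp
    · refine le_trans ?_ (key ((t - 1) / h + 1) fun j hj => ?_)
      · rw [ENat.toENNReal_coe]
        have := Nat.lt_mul_div_succ (t - 1) hh
        have h2 : t ≤ ((t - 1) / h + 1) * h := by rw [mul_comm]; omega
        exact_mod_cast h2
      · have h1 : j * h ≤ t - 1 := (Nat.le_div_iff_mul_le hh).1 (by omega)
        have h2 : j * h < t := by omega
        exact_mod_cast h2

/-- If the expected time until a false alarm is large, then there is a window of length `h` in
which a false alarm is conditionally unlikely. -/
lemma exists_window {π : Policy.{v, w} K m 𝒳} {h : ℕ} (hh : 1 ≤ h) {p γ : ℝ} (hp : 0 < p)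
    (hγ : h / p < γ) (hπ : π ∈ Delta m F γ) :
    ∃ ν : ℕ, (π.ρ.prod (noChangeLaw F))
        {ω | (ν : ℕ∞) < π.T ω ∧ π.T ω ≤ (ν + h : ℕ)} <
      ENNReal.ofReal p * (π.ρ.prod (noChangeLaw F)) {ω | (ν : ℕ∞) < π.T ω} := by
  set P := π.ρ.prod (noChangeLaw F) with hP
  -- Otherwise an alarm has conditional probability at least `p` in each of the disjoint windows
  -- starting at multiples of `h`. Summing gives p Σ P(T > jh) ≤ 1, so the mean of T is at most `h /
  -- p < γ`.
  by_contra hcon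
  push Not at hcon
  have hmeas : ∀ n : ℕ, MeasurableSet {ω | (n : ℕ∞) < π.T ω} := measurableSet_lt_stop π
  let B : ℕ → Set (π.Rand × Path K 𝒳) := fun j =>
    {ω | ((j * h : ℕ) : ℕ∞) < π.T ω ∧ π.T ω ≤ (j * h + h : ℕ)}
  have hBm : ∀ j, MeasurableSet (B j) := fun j => by
    have : B j = {ω | ((j * h : ℕ) : ℕ∞) < π.T ω} ∩ {ω | ((j * h + h : ℕ) : ℕ∞) < π.T ω}ᶜ := by
      ext ω; simp [B]
    rw [this]
    exact (hmeas _).inter (hmeas _).compl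
  have hBd : Pairwise (Function.onFun Disjoint B) := by
    have key : ∀ i j, i < j → Disjoint (B i) (B j) := by
      intro i j hij
      refine Set.disjoint_left.2 fun ω h1 h2 => ?_
      have h3 := h2.1.trans_le h1.2
      have h4 : j * h < i * h + h := by exact_mod_cast h3
      have h5 : (i + 1) * h ≤ j * h := Nat.mul_le_mul_right _ hij
      rw [add_mul, one_mul] at h5
      omega
    intro i j hij
    rcases lt_or_gt_of_ne hij with h1 | h1
    · exact key _ _ h1
    · exact (key _ _ h1).symm
  have hsum : ENNReal.ofReal p * ∑' j : ℕ, P {ω | ((j * h : ℕ) : ℕ∞) < π.T ω} ≤ 1 := by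
    calc ENNReal.ofReal p * ∑' j : ℕ, P {ω | ((j * h : ℕ) : ℕ∞) < π.T ω}
        = ∑' j : ℕ, ENNReal.ofReal p * P {ω | ((j * h : ℕ) : ℕ∞) < π.T ω} :=
          ENNReal.tsum_mul_left.symm
      _ ≤ ∑' j, P (B j) := ENNReal.tsum_le_tsum fun j => hcon (j * h)
      _ = P (⋃ j, B j) := (measure_iUnion hBd hBm).symm
      _ ≤ 1 := prob_le_one
  have hET : meanTimeToFalseAlarm F π ≤ h * ∑' j : ℕ, P {ω | ((j * h : ℕ) : ℕ∞) < π.T ω} := by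
    calc meanTimeToFalseAlarm F π
        ≤ ∫⁻ ω, ∑' j : ℕ, {ω | ((j * h : ℕ) : ℕ∞) < π.T ω}.indicator (fun _ => (h : ℝ≥0∞)) ω ∂P := by
          refine lintegral_mono fun ω => (toENNReal_le_tsum hh (π.T ω)).trans (le_of_eq ?_)
          refine tsum_congr fun j => ?_
          simp [Set.indicator]
      _ = ∑' j : ℕ, h * P {ω | ((j * h : ℕ) : ℕ∞) < π.T ω} := by
          rw [lintegral_tsum fun j => (measurable_const.indicator (hmeas _)).aemeasurable]
          refine tsum_congr fun j => ?_
          rw [lintegral_indicator (hmeas _)]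
          simp
      _ = _ := ENNReal.tsum_mul_left
  have hpos : ENNReal.ofReal p ≠ 0 := by simpa using hp
  have h1 : ∑' j : ℕ, P {ω | ((j * h : ℕ) : ℕ∞) < π.T ω} ≤ (ENNReal.ofReal p)⁻¹ := by
    rw [ENNReal.le_inv_iff_mul_le, mul_comm]
    exact hsum
  have h2 : ENNReal.ofReal γ ≤ ENNReal.ofReal (h / p) := by
    calc ENNReal.ofReal γ ≤ meanTimeToFalseAlarm F π := hπ
      _ ≤ h * (ENNReal.ofReal p)⁻¹ := hET.trans (by gcongr)
      _ = ENNReal.ofReal (h / p) := by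
        rw [div_eq_mul_inv, ENNReal.ofReal_mul (by positivity), ENNReal.ofReal_inv_of_pos hp,
          ENNReal.ofReal_natCast]
  have h3 : 0 < (h : ℝ) / p := div_pos (by exact_mod_cast hh) hp
  rw [ENNReal.ofReal_le_ofReal_iff h3.le] at h2
  linarith

lemma measurable_stop (π : Policy.{v, w} K m 𝒳) : Measurable fun ω => (π.T ω : ℝ≥0∞) := by
  have hT : Measurable π.T := by
    refine measurable_to_countable' fun t => ?_
    induction t using ENat.recTopCoe with
    | top =>
      have : π.T ⁻¹' {⊤} = ⋂ n : ℕ, {ω | (n : ℕ∞) < π.T ω} := by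
        ext ω
        simp [ENat.eq_top_iff_forall_gt]
      rw [this]
      exact .iInter fun n => measurableSet_lt_stop π n
    | coe t => exact history_le π.adapted t _ (π.stopping t)
  exact (Measurable.of_discrete (f := fun t : ℕ∞ => (t : ℝ≥0∞))).comp hT

/-- The worst-case delay is at least any conditional mean delay given no false alarm. -/
lemma mul_le_delay (π : Policy.{v, w} K m 𝒳) (ν h : ℕ)
    (h0 : (π.ρ.prod (changeLaw F G ν)) {ω | (ν : ℕ∞) < π.T ω} ≠ 0) :
    h * ((π.ρ.prod (changeLaw F G ν)) {ω | (ν : ℕ∞) < π.T ω})⁻¹ *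
      (π.ρ.prod (changeLaw F G ν)) {ω | ((ν + h : ℕ) : ℕ∞) < π.T ω} ≤ delay F G π := by
  set P := π.ρ.prod (changeLaw F G ν) with hP
  set s := {ω | (ν : ℕ∞) < π.T ω} with hs
  have hprob : IsProbabilityMeasure (ProbabilityTheory.cond P s) :=
    ProbabilityTheory.cond_isProbabilityMeasure h0
  set Q := ProbabilityTheory.cond P s with hQ
  have hm : partialHistory π.S (affected m F G) ν ≤ Prod.instMeasurableSpace :=
    (partialHistory_le π.adapted _ ν).trans (history_le π.adapted ν)
  set X : π.Rand × Path K 𝒳 → ℝ≥0∞ := fun ω => (π.T ω : ℝ≥0∞) - (ν : ℝ≥0∞) with hX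
  have hdelay : essSup (condLExp (partialHistory π.S (affected m F G) ν) Q X) Q ≤ delay F G π :=
    le_iSup (fun ν : ℕ =>
      let μ : Measure (π.Rand × Path K 𝒳) :=
        ProbabilityTheory.cond (π.ρ.prod (changeLaw F G ν)) {ω | (ν : ℕ∞) < π.T ω}
      essSup (condLExp (partialHistory π.S (affected m F G) ν) μ
        (fun ω => (π.T ω : ℝ≥0∞) - (ν : ℝ≥0∞))) μ) ν
  refine le_trans ?_ hdelay
  have hfin : SigmaFinite (Q.trim hm) := by
    have : IsFiniteMeasure (Q.trim hm) := isFiniteMeasure_trim hm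
    infer_instance
  -- The essential supremum of a conditional expectation dominates its mean, which is the
  -- unconditional mean; Markov's inequality then gives the claim.
  have h1 : ∫⁻ ω, X ω ∂Q ≤
      essSup (condLExp (partialHistory π.S (affected m F G) ν) Q X) Q := by
    rw [← lintegral_condLExp hm Q X]
    refine (lintegral_mono_ae (ENNReal.ae_le_essSup _)).trans ?_
    simp
  refine le_trans ?_ h1
  have hmeas : MeasurableSet {ω | ((ν + h : ℕ) : ℕ∞) < π.T ω} := measurableSet_lt_stop π _
  have hsm : MeasurableSet s := measurableSet_lt_stop π ν
  calc h * (P s)⁻¹ * P {ω | ((ν + h : ℕ) : ℕ∞) < π.T ω}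
      = h * Q {ω | ((ν + h : ℕ) : ℕ∞) < π.T ω} := by
        rw [hQ, ProbabilityTheory.cond_apply hsm, mul_assoc]
        congr 3
        ext ω
        simp only [hs, Set.mem_inter_iff, Set.mem_ofPred_eq]
        refine ⟨fun h3 => ⟨lt_of_le_of_lt ?_ h3, h3⟩, fun h3 => h3.2⟩
        exact_mod_cast Nat.le_add_right ν h
    _ = ∫⁻ ω, {ω | ((ν + h : ℕ) : ℕ∞) < π.T ω}.indicator (fun _ => (h : ℝ≥0∞)) ω ∂Q := by
        rw [lintegral_indicator hmeas]; simp
    _ ≤ ∫⁻ ω, X ω ∂Q := by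
        refine lintegral_mono fun ω => ?_
        by_cases hω : ((ν + h : ℕ) : ℕ∞) < π.T ω
        · rw [Set.indicator_of_mem (s := {ω | ((ν + h : ℕ) : ℕ∞) < π.T ω}) hω]
          have h4 : ((ν + h : ℕ) : ℝ≥0∞) ≤ (π.T ω : ℝ≥0∞) := by
            rw [← ENat.toENNReal_coe]
            exact ENat.toENNReal_le.2 hω.le
          rw [hX]
          refine ENNReal.le_sub_of_add_le_left (ENNReal.natCast_ne_top ν) ?_
          exact_mod_cast h4
        · rw [Set.indicator_of_notMem (s := {ω | ((ν + h : ℕ) : ℕ∞) < π.T ω}) hω]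
          exact zero_le

/-- Non-asymptotic lower bound on the worst-case delay. -/
lemma ofReal_le_delay (hac : ∀ E ∈ affected m F G,
      localLaw G E ≪ localLaw F E ∧ localLaw F E ≪ localLaw G E)
    (hSM : SecondMoment F m G) {I σ : ℝ}
    (hI : ∀ E : Subsets K m, ∫ z, llr (localLaw G E) (localLaw F E) z ∂(localLaw G E) ≤ I)
    (hσ : ∀ E : Subsets K m, ∫ z, (llr (localLaw G E) (localLaw F E) z -
      ∫ y, llr (localLaw G E) (localLaw F E) y ∂(localLaw G E)) ^ 2 ∂(localLaw G E) ≤ σ)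
    (hσ0 : 0 ≤ σ)
    {h : ℕ} (hh : 1 ≤ h) {p γ δ : ℝ} (hp : 0 < p) (hδ : 0 < δ) (hγ : h / p < γ)
    {π : Policy.{v, w} K m 𝒳} (hπ : π ∈ Delta m F γ) :
    ENNReal.ofReal (h * (1 - (Real.exp (h * (I + δ)) * p + σ / (h * δ ^ 2)))) ≤
      delay F G π := by
  obtain ⟨ν, hν⟩ := exists_window hh hp hγ hπ
  have hS := π.adapted
  set P := π.ρ.prod (changeLaw F G ν) with hP
  set P₀ := π.ρ.prod (noChangeLaw F) with hP₀
  set s := {ω | (ν : ℕ∞) < π.T ω} with hs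
  have hsν : MeasurableSet[history π.S ν] s := measurableSet_stop_le π le_rfl
  have hsm : MeasurableSet s := measurableSet_lt_stop π ν
  have hPs : P s = P₀ s := changeLaw_apply_eq hac hS ν hsν
  have hs0 : P s ≠ 0 := by
    intro h0
    rw [hPs] at h0
    rw [h0, mul_zero] at hν
    exact absurd hν not_lt_zero
  set B := {ω | (ν : ℕ∞) < π.T ω ∧ π.T ω ≤ (ν + h : ℕ)} with hB
  set R := {ω | ((ν + h : ℕ) : ℕ∞) < π.T ω} with hR
  have hBR : B = s ∩ Rᶜ := by ext ω; simp [hB, hs, hR]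
  have hBh : MeasurableSet[history π.S (ν + h)] B := by
    rw [hBR]
    exact (history_mono π.S (Nat.le_add_right ν h) _ hsν).inter
      (measurableSet_stop_le π le_rfl).compl
  have hBm : MeasurableSet B := history_le hS _ _ hBh
  -- the log-likelihood ratio stays below its typical size
  set Λ := logLik F G π.S ν h with hΛ
  have hΛm : Measurable[history π.S (ν + h)] Λ := measurable_logLik hS ν h
  set C : ℝ := h * (I + δ) with hC
  have hsplit : P B ≤ ENNReal.ofReal (Real.exp C) * P₀ B + P (s ∩ {ω | C < Λ ω}) := by
    have hle : MeasurableSet[history π.S (ν + h)] (B ∩ {ω | Λ ω ≤ C}) :=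
      hBh.inter (hΛm measurableSet_Iic)
    -- On this event the likelihood ratio of the change is at most `exp C`.
    have h1 : P (B ∩ {ω | Λ ω ≤ C}) ≤ ENNReal.ofReal (Real.exp C) * P₀ B := by
      have h2 := lintegral_changeLaw_eq (ρ := π.ρ) hac hS ν h
        (V := (B ∩ {ω | Λ ω ≤ C}).indicator fun _ => 1)
        ((@measurable_const _ _ _ (history π.S (ν + h)) 1).indicator hle)
      rw [lintegral_indicator (history_le hS _ _ hle)] at h2
      simp only [lintegral_const, one_mul, Measure.restrict_apply, MeasurableSet.univ,
        Set.univ_inter] at h2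
      rw [hP, h2]
      calc ∫⁻ ω, (B ∩ {ω | Λ ω ≤ C}).indicator (fun _ => 1) ω *
            ENNReal.ofReal (Real.exp (logLik F G π.S ν h ω)) ∂P₀
          ≤ ∫⁻ ω, B.indicator (fun _ => ENNReal.ofReal (Real.exp C)) ω ∂P₀ := by
            refine lintegral_mono fun ω => ?_
            by_cases hω : ω ∈ B ∩ {ω | Λ ω ≤ C}
            · rw [Set.indicator_of_mem hω, Set.indicator_of_mem hω.1, one_mul]
              exact ENNReal.ofReal_le_ofReal (Real.exp_le_exp.2 hω.2)
            · rw [Set.indicator_of_notMem hω, zero_mul]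
              exact zero_le
        _ = _ := by rw [lintegral_indicator hBm]; simp
    calc P B ≤ P ((B ∩ {ω | Λ ω ≤ C}) ∪ (s ∩ {ω | C < Λ ω})) := by
          refine measure_mono fun ω hω => ?_
          rcases le_or_gt (Λ ω) C with h3 | h3
          · exact Or.inl ⟨hω, h3⟩
          · exact Or.inr ⟨hω.1, h3⟩
      _ ≤ _ := (measure_union_le _ _).trans (by gcongr)
  have hcheb : P (s ∩ {ω | C < Λ ω}) ≤ ENNReal.ofReal (σ / (h * δ ^ 2)) * P s := by
    let mean : Subsets K m → ℝ := fun E =>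
      ∫ y, llr (localLaw G E) (localLaw F E) y ∂(localLaw G E)
    let g : Subsets K m → (Fin m → 𝒳) → ℝ := fun E z =>
      llr (localLaw G E) (localLaw F E) z - mean E
    have hsq : ∀ E : Subsets K m,
        Integrable (fun y => (llr (localLaw G E) (localLaw F E) y) ^ 2) (localLaw G E) := by
      intro E
      by_cases hE : E ∈ affected m F G
      · exact hSM E hE
      · have he : localLaw G E = localLaw F E := not_not.1 hE
        have : (fun y => (llr (localLaw G E) (localLaw F E) y) ^ 2) =ᵐ[localLaw G E] 0 := by
          rw [he]
          filter_upwards [llr_self (localLaw F E)] with y hy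
          simp [hy]
        exact (integrable_zero _ _ _).congr this.symm
    have hL2 : ∀ E : Subsets K m, MemLp (llr (localLaw G E) (localLaw F E)) 2 (localLaw G E) :=
      fun E => (memLp_two_iff_integrable_sq (measurable_llr _ _).aestronglyMeasurable).2 (hsq E)
    have hgL2 : ∀ E : Subsets K m, MemLp (g E) 2 (localLaw G E) := fun E =>
      (hL2 E).sub (memLp_const _)
    have hvar := lintegral_sq_le (ρ := π.ρ) (F := F) (G := G) hS (g := g)
      (fun E => (measurable_llr _ _).sub_const _)
      (fun E => (memLp_two_iff_integrable_sq (hgL2 E).1).1 (hgL2 E))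
      (fun E => by
        have := integral_sub ((hL2 E).integrable (by norm_num)) (integrable_const (mean E))
        simp only [integral_const, probReal_univ, one_smul] at this
        simp only [g]
        rw [this]
        exact sub_self _)
      hσ ν h hsν
    have hd : 0 < ((h : ℝ) * δ) ^ 2 := by
      have : (0 : ℝ) < h := by exact_mod_cast hh
      positivity
    -- Chebyshev: the drifts collected in the window add up to at most `h * I`, so `Λ > C` forces
    -- the centred sum to exceed `h * δ`.
    have hmark : ENNReal.ofReal (((h : ℝ) * δ) ^ 2) * P (s ∩ {ω | C < Λ ω}) ≤
        h * ENNReal.ofReal σ * P s := by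
      refine le_trans ?_ hvar
      have hm2 : MeasurableSet (s ∩ {ω | C < Λ ω}) :=
        hsm.inter (history_le hS _ _ (hΛm measurableSet_Ioi))
      calc ENNReal.ofReal (((h : ℝ) * δ) ^ 2) * P (s ∩ {ω | C < Λ ω})
          = ∫⁻ _ in s ∩ {ω | C < Λ ω}, ENNReal.ofReal (((h : ℝ) * δ) ^ 2) ∂P := by simp
        _ ≤ ∫⁻ ω in s ∩ {ω | C < Λ ω}, ENNReal.ofReal ((∑ i ∈ Finset.range h,
              g (π.S (ν + i) ω) (obs (π.S (ν + i) ω) (ω.2 (ν + i)))) ^ 2) ∂P := by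
            refine setLIntegral_mono' hm2 fun ω hω => ENNReal.ofReal_le_ofReal ?_
            have h5 : C < Λ ω := hω.2
            have h6 : ∑ i ∈ Finset.range h, g (π.S (ν + i) ω)
                (obs (π.S (ν + i) ω) (ω.2 (ν + i))) =
                Λ ω - ∑ i ∈ Finset.range h, mean (π.S (ν + i) ω) := by
              rw [hΛ, logLik, ← Finset.sum_sub_distrib]
            have h7 : ∑ i ∈ Finset.range h, mean (π.S (ν + i) ω) ≤ h * I := by
              refine (Finset.sum_le_sum fun i _ => hI _).trans ?_
              simp
            rw [h6]
            have h8 : (h : ℝ) * δ ≤ Λ ω - ∑ i ∈ Finset.range h, mean (π.S (ν + i) ω) := by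
              rw [hC] at h5
              nlinarith
            gcongr
        _ ≤ _ := lintegral_mono_set Set.inter_subset_left
    have hd' : ENNReal.ofReal (((h : ℝ) * δ) ^ 2) ≠ 0 := (ENNReal.ofReal_pos.2 hd).ne'
    rw [mul_comm, ← ENNReal.le_div_iff_mul_le (Or.inl hd') (Or.inl ENNReal.ofReal_ne_top)] at hmark
    refine hmark.trans (le_of_eq ?_)
    rw [ENNReal.mul_div_right_comm]
    congr 1
    rw [← ENNReal.ofReal_natCast, ← ENNReal.ofReal_mul (by positivity),
      ← ENNReal.ofReal_div_of_pos hd]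
    congr 1
    have : (h : ℝ) ≠ 0 := by
      have : (0 : ℝ) < h := by exact_mod_cast hh
      exact this.ne'
    field_simp
  set η := Real.exp C * p + σ / (h * δ ^ 2) with hη
  have hPB : P B ≤ ENNReal.ofReal η * P s := by
    calc P B ≤ ENNReal.ofReal (Real.exp C) * (ENNReal.ofReal p * P s) +
          ENNReal.ofReal (σ / (h * δ ^ 2)) * P s := by
          refine hsplit.trans (add_le_add ?_ hcheb)
          rw [hPs]
          gcongr
      _ = _ := by
        rw [hη, ENNReal.ofReal_add (by positivity) (by positivity),
          ENNReal.ofReal_mul (by positivity)]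
        ring
  have hPR : P s * ENNReal.ofReal (1 - η) ≤ P R := by
    have h9 : P s ≤ P R + ENNReal.ofReal η * P s := by
      calc P s ≤ P (R ∪ B) := by
            refine measure_mono fun ω hω => ?_
            by_cases h3 : ω ∈ R
            · exact Or.inl h3
            · exact Or.inr (hBR ▸ ⟨hω, h3⟩)
        _ ≤ P R + P B := measure_union_le _ _
        _ ≤ _ := by gcongr
    have hη0 : 0 ≤ η := by positivity
    rw [ENNReal.ofReal_sub _ hη0, ENNReal.ofReal_one, ENNReal.mul_sub (fun _ _ => measure_ne_top _ _),
      mul_one, tsub_le_iff_right, mul_comm (P s)]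
    exact h9
  refine le_trans ?_ (mul_le_delay π ν h hs0)
  calc ENNReal.ofReal (h * (1 - η)) = h * ENNReal.ofReal (1 - η) := by
        rw [ENNReal.ofReal_mul (by positivity), ENNReal.ofReal_natCast]
    _ = h * (P s)⁻¹ * (P s * ENNReal.ofReal (1 - η)) := by
        rw [mul_assoc, ← mul_assoc (P s)⁻¹, ENNReal.inv_mul_cancel hs0 (measure_ne_top _ _), one_mul]
    _ ≤ _ := by gcongr

/-- Asymptotic lower bound on the worst-case delay of all policies with a given expected time
until a false alarm. -/
theorem eventually_le_delay (hac : ∀ E ∈ affected m F G,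
      localLaw G E ≪ localLaw F E ∧ localLaw F E ≪ localLaw G E)
    (hSM : SecondMoment F m G) {I : ℝ} (hI0 : 0 < I)
    (hI : ∀ E : Subsets K m, ∫ z, llr (localLaw G E) (localLaw F E) z ∂(localLaw G E) ≤ I)
    {ε : ℝ} (hε : 0 < ε) (hε1 : ε < 1) :
    ∀ᶠ γ : ℝ in atTop, ∀ π ∈ Delta.{v, w} m F γ,
      ENNReal.ofReal ((1 - ε) * Real.log γ / I) ≤ delay F G π := by
  obtain ⟨σ, hσ0, hσ⟩ : ∃ σ : ℝ, 0 ≤ σ ∧ ∀ E : Subsets K m,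
      ∫ z, (llr (localLaw G E) (localLaw F E) z -
      ∫ y, llr (localLaw G E) (localLaw F E) y ∂(localLaw G E)) ^ 2 ∂(localLaw G E) ≤ σ := by
    refine ⟨∑ E : Subsets K m, ∫ z, (llr (localLaw G E) (localLaw F E) z -
      ∫ y, llr (localLaw G E) (localLaw F E) y ∂(localLaw G E)) ^ 2 ∂(localLaw G E),
      Finset.sum_nonneg fun E _ => integral_nonneg fun z => sq_nonneg _, fun E => ?_⟩
    exact Finset.single_le_sum (f := fun E : Subsets K m =>
      ∫ z, (llr (localLaw G E) (localLaw F E) z -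
      ∫ y, llr (localLaw G E) (localLaw F E) y ∂(localLaw G E)) ^ 2 ∂(localLaw G E))
      (fun E _ => integral_nonneg fun z => sq_nonneg _) (Finset.mem_univ E)
  -- The window has length about `r * log γ`. As (1 - ε/2)(1 + ε/2) < 1, the likelihood ratio is
  -- typically at most γ^(1 - ε²/4), which leaves room for the logarithmic factor in `p`.
  set r := (1 - ε / 2) / I with hr
  have hr0 : 0 < r := div_pos (by linarith) hI0
  set δ := I * ε / 2 with hδdef
  have hδ : 0 < δ := by positivity
  have hrI : r * (I + δ) = 1 - ε ^ 2 / 4 := by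
    rw [hr, hδdef]; field_simp; ring
  -- the error terms vanish
  have hlog : Tendsto Real.log atTop atTop := Real.tendsto_log_atTop
  have hfl : Tendsto (fun a : ℝ => ⌊r * a⌋₊) atTop atTop :=
    tendsto_nat_floor_atTop.comp (tendsto_id.const_mul_atTop hr0)
  have e1 : ∀ᶠ a : ℝ in atTop, 2 * r * (a * Real.exp (-(ε ^ 2 / 4 * a))) < ε / 8 := by
    have h1 : Tendsto (fun a : ℝ => a * Real.exp (-(ε ^ 2 / 4 * a))) atTop (𝓝 0) := by
      have := Real.tendsto_pow_mul_exp_neg_atTop_nhds_zero 1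
      have h2 := this.comp (tendsto_id.const_mul_atTop (show (0 : ℝ) < ε ^ 2 / 4 by positivity))
      have h3 := h2.const_mul (ε ^ 2 / 4)⁻¹
      rw [mul_zero] at h3
      refine h3.congr fun a => ?_
      simp only [Function.comp, id, pow_one]
      field_simp
    have h4 := h1.const_mul (2 * r)
    rw [mul_zero] at h4
    exact h4.eventually_lt_const (by positivity)
  have e2 : ∀ᶠ a : ℝ in atTop, σ / (⌊r * a⌋₊ * δ ^ 2) < ε / 8 := by
    have h1 : Tendsto (fun a : ℝ => (⌊r * a⌋₊ : ℝ) * δ ^ 2) atTop atTop :=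
      (tendsto_natCast_atTop_atTop.comp hfl).atTop_mul_const (by positivity)
    exact (h1.const_div_atTop σ).eventually_lt_const (by positivity)
  have e3 : ∀ᶠ a : ℝ in atTop, 1 ≤ ε / 4 * a / I := by
    filter_upwards [eventually_ge_atTop (4 * I / ε)] with a ha
    rw [le_div_iff₀ hI0, one_mul]
    rw [div_le_iff₀ hε] at ha
    linarith
  filter_upwards [hlog.eventually e1, hlog.eventually e2, hlog.eventually e3,
    hlog.eventually (hfl.eventually_ge_atTop 1), eventually_gt_atTop 0,
    hlog.eventually_gt_atTop 0] with γ h1 h2 h3 h4 hγ hlogpos π hπ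
  set a := Real.log γ with ha
  set h := ⌊r * a⌋₊ with hh
  have hhpos : (0 : ℝ) < h := by exact_mod_cast h4
  have hexpa : Real.exp a = γ := Real.exp_log hγ
  have hfloor : (h : ℝ) ≤ r * a := Nat.floor_le (by positivity)
  have hfloor' : r * a - 1 ≤ h := (Nat.sub_one_lt_floor _).le
  -- With `p = 2 * h / γ` the window condition reads `γ / 2 < γ`.
  refine le_trans (ENNReal.ofReal_le_ofReal ?_) (ofReal_le_delay hac hSM hI hσ hσ0 h4
    (p := 2 * h / γ) (δ := δ) (by positivity) hδ (by field_simp; linarith) hπ)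
  have hη1 : Real.exp (h * (I + δ)) * (2 * h / γ) ≤ ε / 8 := by
    have h5 : (h : ℝ) * (I + δ) ≤ (1 - ε ^ 2 / 4) * a := by
      calc (h : ℝ) * (I + δ) ≤ r * a * (I + δ) := by gcongr
        _ = _ := by rw [← hrI]; ring
    calc Real.exp (h * (I + δ)) * (2 * h / γ)
        ≤ Real.exp ((1 - ε ^ 2 / 4) * a) * (2 * (r * a) / γ) := by gcongr
      _ = 2 * r * (a * Real.exp (-(ε ^ 2 / 4 * a))) := by
          have : Real.exp ((1 - ε ^ 2 / 4) * a) = γ * Real.exp (-(ε ^ 2 / 4 * a)) := by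
            rw [← hexpa, ← Real.exp_add]; congr 1; ring
          rw [this]
          field_simp
      _ ≤ ε / 8 := h1.le
  have hη : Real.exp (h * (I + δ)) * (2 * h / γ) + σ / (h * δ ^ 2) ≤ ε / 4 := by
    linarith
  calc (1 - ε) * a / I ≤ (r * a - 1) * (1 - ε / 4) := by
        have h6 : r * a = (1 - ε / 2) * (a / I) := by rw [hr]; ring
        have h7 : (1 - ε) * a / I = (1 - ε) * (a / I) := by ring
        have h8 : ε / 4 * a / I = ε / 4 * (a / I) := by ring
        rw [h6, h7]
        rw [h8] at h3
        have h9 : 0 < a / I := by positivity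
        nlinarith [mul_pos (mul_pos hε hε) h9]
    _ ≤ h * (1 - ε / 4) := by
        gcongr
        linarith
    _ ≤ _ := by
        gcongr

end DelayBounds

/-! ### Tools for upper bounds on the delay -/

section DelayUpper

variable {K m : ℕ} {𝒳 : Type v} [MeasurableSpace 𝒳] {F G : ProbabilityMeasure (Fin K → 𝒳)}

/-- An upper bound on the worst-case delay, in terms of integrals over the events of the partial
history. -/
lemma delay_le (π : Policy.{v, w} K m 𝒳) {b : ℝ≥0∞}
    (h : ∀ ν : ℕ, ∀ s, MeasurableSet[partialHistory π.S (affected m F G) ν] s →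
      ∫⁻ ω in s ∩ {ω | (ν : ℕ∞) < π.T ω}, ((π.T ω : ℝ≥0∞) - (ν : ℝ≥0∞))
        ∂(π.ρ.prod (changeLaw F G ν)) ≤
      b * (π.ρ.prod (changeLaw F G ν)) (s ∩ {ω | (ν : ℕ∞) < π.T ω})) :
    delay F G π ≤ b := by
  refine iSup_le fun ν => ?_
  simp only
  set P := π.ρ.prod (changeLaw F G ν) with hP
  set A := {ω | (ν : ℕ∞) < π.T ω} with hA
  have hAm : MeasurableSet A := measurableSet_lt_stop π ν
  by_cases h0 : P A = 0
  · rw [ProbabilityTheory.cond_eq_zero_of_meas_eq_zero h0, essSup_measure_zero]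
    exact bot_le
  have hprob : IsProbabilityMeasure (ProbabilityTheory.cond P A) :=
    ProbabilityTheory.cond_isProbabilityMeasure h0
  set Q := ProbabilityTheory.cond P A with hQ
  have hm : partialHistory π.S (affected m F G) ν ≤ Prod.instMeasurableSpace :=
    (partialHistory_le π.adapted _ ν).trans (history_le π.adapted ν)
  have hfin : IsFiniteMeasure (Q.trim hm) := isFiniteMeasure_trim hm
  refine essSup_le_of_ae_le b (ae_le_of_ae_le_trim (hm := hm) ?_)
  refine ae_le_of_forall_setLIntegral_le_of_sigmaFinite (measurable_condLExp _ _ _) fun s hs _ => ?_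
  rw [setLIntegral_condLExp_trim hm _ _ hs, setLIntegral_const, trim_measurableSet_eq hm hs, hQ,
    ProbabilityTheory.cond_apply hAm]
  have hres : (ProbabilityTheory.cond P A).restrict s = (P A)⁻¹ • P.restrict (s ∩ A) := by
    rw [ProbabilityTheory.cond, Measure.restrict_smul, Measure.restrict_restrict (hm _ hs)]
  rw [hres, lintegral_smul_measure, Set.inter_comm A s, mul_left_comm, smul_eq_mul]
  gcongr
  exact h ν s hs

/-- As long as only unaffected sets are sampled, the partial history does not grow. -/
lemma exists_history_trace {Rand : Type w} [MeasurableSpace Rand]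
    {S : ℕ → Rand × Path K 𝒳 → Subsets K m}
    (hS : ∀ n E, MeasurableSet[history S n] {ω | S n ω = E}) {𝒜 : Set (Subsets K m)} {i ν : ℕ}
    {C : Set (Rand × Path K 𝒳)} (hC : ∀ ω ∈ C, ∀ t, i ≤ t → t < ν → S t ω ∉ 𝒜)
    {s : Set (Rand × Path K 𝒳)} (hs : MeasurableSet[partialHistory S 𝒜 ν] s) :
    ∃ s', MeasurableSet[history S i] s' ∧ s ∩ C = s' ∩ C := by
  induction s, hs using MeasurableSpace.generateFrom_induction with
  | hC s hs _ =>
    obtain ⟨t, ht, E, hE, B, hB, rfl⟩ := hs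
    rcases lt_or_ge t i with hti | hti
    · refine ⟨_, ?_, rfl⟩
      exact partialHistory_le hS 𝒜 i _
        (MeasurableSpace.measurableSet_generateFrom ⟨t, hti, E, hE, B, hB, rfl⟩)
    -- A generator at a time in `[i, ν)` requires that a set of `𝒜` be sampled then, which does not
    -- happen on `C`.
    · refine ⟨∅, @MeasurableSet.empty _ (history S i), ?_⟩
      rw [Set.empty_inter, Set.eq_empty_iff_forall_notMem]
      rintro ω ⟨⟨h1, -⟩, h2⟩
      exact hC ω h2 t hti ht (h1 ▸ hE)
  | empty => exact ⟨∅, @MeasurableSet.empty _ (history S i), rfl⟩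
  | compl t _ ih =>
    obtain ⟨s', hs', h⟩ := ih
    refine ⟨s'ᶜ, hs'.compl, ?_⟩
    ext ω
    have := Set.ext_iff.1 h ω
    simp only [Set.mem_inter_iff, Set.mem_compl_iff] at this ⊢
    tauto
  | iUnion f _ ih =>
    choose s' hs' h using ih
    refine ⟨⋃ n, s' n, .iUnion hs', ?_⟩
    rw [Set.iUnion_inter, Set.iUnion_inter]
    exact Set.iUnion_congr h

lemma toENNReal_sub_le_tsum (t : ℕ∞) (ν : ℕ) :
    (t : ℝ≥0∞) - (ν : ℝ≥0∞) ≤ ∑' j : ℕ, if ((ν + j : ℕ) : ℕ∞) < t then (1 : ℝ≥0∞) else 0 := by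
  rw [tsub_le_iff_left]
  have h := toENNReal_le_tsum le_rfl t
  simp only [mul_one, Nat.cast_one] at h
  refine h.trans ?_
  rw [← ENNReal.summable.sum_add_tsum_nat_add' (k := ν)]
  refine add_le_add ?_ (le_of_eq (tsum_congr fun j => by rw [add_comm]))
  calc ∑ i ∈ Finset.range ν, (if (i : ℕ∞) < t then (1 : ℝ≥0∞) else 0)
      ≤ ∑ i ∈ Finset.range ν, 1 := Finset.sum_le_sum fun i _ => by split_ifs <;> simp
    _ = ν := by simp

end DelayUpper

/-! ### The Round Robin CUSUM as a Markov chain, and its false alarms -/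

lemma measurable_xi_obs_pair {K m : ℕ} {𝒳 : Type v} [MeasurableSpace 𝒳]
    {F : ProbabilityMeasure (Fin K → 𝒳)} {𝒢 : Set (ProbabilityMeasure (Fin K → 𝒳))} {N : ℕ} {u : Fin N → Subsets K m} :
    Measurable fun q : (Fin m → 𝒳) × Fin N => xi F 𝒢 (u q.2) q.1 :=
  measurable_from_prod_countable_left fun d => measurable_xi F 𝒢 (u d)

section Chain

variable {K m : ℕ} {𝒳 : Type v} [MeasurableSpace 𝒳] {F : ProbabilityMeasure (Fin K → 𝒳)}
  {𝒢 : Set (ProbabilityMeasure (Fin K → 𝒳))} {N : ℕ} [NeZero N] {u : Fin N → Subsets K m}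

/-- One step of the state of the Round Robin CUSUM, when the increment is `x`. -/
noncomputable def step (q : Fin N × ℝ) (x : ℝ) : Fin N × ℝ :=
  (if max q.2 0 + x ≤ 0 then q.1 + 1 else q.1, max q.2 0 + x)

lemma state_succ (x : Path K 𝒳) (n : ℕ) : state F 𝒢 u x (n + 1) =
    step (state F 𝒢 u x n) (xi F 𝒢 (u (state F 𝒢 u x n).1)
      (obs (u (state F 𝒢 u x n).1) (x n))) := rfl

lemma measurable_step : Measurable fun p : (Fin N × ℝ) × ℝ => step p.1 p.2 := by
  have h : Measurable fun p : (Fin N × ℝ) × ℝ => max p.1.2 0 + p.2 := by fun_prop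
  refine Measurable.prodMk ?_ h
  exact Measurable.ite (measurableSet_le h measurable_const)
    ((Measurable.of_discrete (f := fun d : Fin N => d + 1)).comp
      (measurable_fst.comp measurable_fst)) (measurable_fst.comp measurable_fst)

lemma rrSample_adapted (n : ℕ) (E : Subsets K m) :
    MeasurableSet[history (rrSample.{v, w} F 𝒢 u) n] {ω | rrSample F 𝒢 u n ω = E} :=
  (roundRobin F 𝒢 u 0).adapted n E

/-- One step of the Round Robin CUSUM, in terms of the distributions `κ d` of the increments. -/
lemma lintegral_state_succ {μ : ℕ → Measure (Fin K → 𝒳)} [∀ i, IsProbabilityMeasure (μ i)] {n : ℕ}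
    {κ : Fin N → Measure ℝ} (hκ : ∀ d, ((μ n).map (obs (u d))).map (xi F 𝒢 (u d)) = κ d)
    {B : Type*} [MeasurableSpace B] {V : PUnit.{w + 1} × Path K 𝒳 → B}
    (hV : Measurable[history (rrSample.{v, w} F 𝒢 u) n] V) {f : B × (Fin N × ℝ) → ℝ≥0∞}
    (hf : Measurable f) :
    ∫⁻ ω, f (V ω, state F 𝒢 u ω.2 (n + 1))
        ∂((Measure.dirac PUnit.unit).prod (Measure.infinitePi μ)) =
      ∫⁻ ω, ∫⁻ x, f (V ω, step (state F 𝒢 u ω.2 n) x) ∂κ (state F 𝒢 u ω.2 n).1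
        ∂((Measure.dirac PUnit.unit).prod (Measure.infinitePi μ)) := by
  have hst := measurable_state.{v, w} F 𝒢 u n
  have hπ : Measurable fun p : (B × (Fin N × ℝ)) × (Fin m → 𝒳) => (p.2, p.1.2.1) := by fun_prop
  have hxi := (measurable_xi_obs_pair (F := F) (𝒢 := 𝒢) (u := u)).comp hπ
  simp only [Function.comp_def] at hxi
  have hst' := measurable_step.comp ((measurable_snd.comp measurable_fst).prodMk hxi)
  simp only [Function.comp_def] at hst'
  have hg := hf.comp ((measurable_fst.comp measurable_fst).prodMk hst')
  simp only [Function.comp_def] at hg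
  have hfs : ∀ b q, Measurable fun x => f (b, step q x) := fun b q =>
    hf.comp (measurable_const.prodMk (measurable_step.comp (measurable_const.prodMk measurable_id)))
  generalize hgd : (fun p : (B × (Fin N × ℝ)) × (Fin m → 𝒳) =>
      f (p.1.1, step p.1.2 (xi F 𝒢 (u p.1.2.1) p.2))) = g at hg
  have h := lintegral_next (ρ := Measure.dirac PUnit.unit) (μ := μ)
    (rrSample_adapted.{v, w} (F := F) (𝒢 := 𝒢) (u := u)) (n := n) (hV.prodMk hst)
    (f := fun _ => g) fun _ => hg
  have h1 : ∀ ω : PUnit.{w + 1} × Path K 𝒳, f (V ω, state F 𝒢 u ω.2 (n + 1)) =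
      g ((V ω, state F 𝒢 u ω.2 n), obs (rrSample F 𝒢 u n ω) (ω.2 n)) := fun ω => by
    rw [← hgd, state_succ, rrSample]
  have h2 : ∀ ω : PUnit.{w + 1} × Path K 𝒳,
      ∫⁻ x, f (V ω, step (state F 𝒢 u ω.2 n) x) ∂κ (state F 𝒢 u ω.2 n).1 =
      ∫⁻ z, g ((V ω, state F 𝒢 u ω.2 n), z) ∂(μ n).map (obs (rrSample F 𝒢 u n ω)) := fun ω => by
    rw [← hκ, lintegral_map (hfs _ _) (measurable_xi F 𝒢 _), ← hgd, rrSample]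
  simp only [h1, h2]
  exact h

lemma lt_rrStop_iff {A : ℝ} {n : ℕ} {ω : PUnit.{w + 1} × Path K 𝒳} :
    (n : ℕ∞) < rrStop F 𝒢 u A ω ↔ ∀ k, 1 ≤ k → k ≤ n → (state F 𝒢 u ω.2 k).2 < A := by
  constructor
  · intro h k hk hkn
    by_contra hc
    have h1 : rrStop F 𝒢 u A ω ≤ k := iInf₂_le k ⟨hk, not_lt.1 hc⟩
    have h2 : n < k := by exact_mod_cast h.trans_le h1
    omega
  · intro h
    have h1 : ((n + 1 : ℕ) : ℕ∞) ≤ rrStop F 𝒢 u A ω := by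
      refine le_iInf₂ fun k hk => ?_
      have : n + 1 ≤ k := by
        by_contra hlt
        exact absurd hk.2 (not_le.2 (h k hk.1 (by omega)))
      exact_mod_cast this
    refine lt_of_lt_of_le ?_ h1
    exact_mod_cast Nat.lt_succ_self n

lemma state_lt_of_lt_rrStop {A : ℝ} (hA : 0 < A) {n : ℕ} {ω : PUnit.{w + 1} × Path K 𝒳}
    (h : (n : ℕ∞) < rrStop F 𝒢 u A ω) : (state F 𝒢 u ω.2 n).2 < A := by
  rcases Nat.eq_zero_or_pos n with rfl | hn
  · exact hA
  · exact lt_rrStop_iff.1 h n hn le_rfl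

lemma succ_lt_rrStop_iff {A : ℝ} {n : ℕ} {ω : PUnit.{w + 1} × Path K 𝒳} :
    ((n + 1 : ℕ) : ℕ∞) < rrStop F 𝒢 u A ω ↔
      (n : ℕ∞) < rrStop F 𝒢 u A ω ∧ (state F 𝒢 u ω.2 (n + 1)).2 < A := by
  rw [lt_rrStop_iff, lt_rrStop_iff]
  constructor
  · exact fun h => ⟨fun k hk hkn => h k hk (by omega), h (n + 1) (by omega) le_rfl⟩
  · rintro ⟨h1, h2⟩ k hk hkn
    rcases Nat.lt_or_ge n k with h3 | h3
    · have : k = n + 1 := by omega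
      exact this ▸ h2
    · exact h1 k hk h3

lemma measurableSet_lt_rrStop {A : ℝ} {k n : ℕ} (h : k ≤ n) :
    MeasurableSet[history (rrSample.{v, w} F 𝒢 u) n]
      {ω : PUnit.{w + 1} × Path K 𝒳 | (k : ℕ∞) < rrStop F 𝒢 u A ω} :=
  measurableSet_stop_le (roundRobin F 𝒢 u A) h

/-- The Round Robin CUSUM with threshold `A` has an expected time until a false alarm of at least
`exp A`. -/
theorem exp_le_meanTimeToFalseAlarm {μ₀ : Measure ℝ}
    (hμ₀ : ∀ d, (localLaw F (u d)).map (xi F 𝒢 (u d)) = μ₀)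
    (hexp : ∫⁻ x, ENNReal.ofReal (Real.exp x) ∂μ₀ = 1) (A : ℝ) :
    ENNReal.ofReal (Real.exp A) ≤ meanTimeToFalseAlarm F (roundRobin.{v, w} F 𝒢 u A) := by
  set P : Measure (PUnit.{w + 1} × Path K 𝒳) := (Measure.dirac PUnit.unit).prod (noChangeLaw F)
    with hP
  set Al : ℕ → Set (PUnit.{w + 1} × Path K 𝒳) := fun n => {ω | (n : ℕ∞) < rrStop F 𝒢 u A ω}
    with hAl
  have hAlh : ∀ n, MeasurableSet[history (rrSample.{v, w} F 𝒢 u) n] (Al n) := fun n =>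
    measurableSet_lt_rrStop le_rfl
  have hAlm : ∀ n, MeasurableSet (Al n) := fun n => history_le rrSample_adapted n _ (hAlh n)
  let e : ℝ → ℝ≥0∞ := fun y => ENNReal.ofReal (Real.exp y)
  have he : Measurable e := by fun_prop
  -- The value at `n = 0` is 0 and not exp Y_0 = 1: in the first step exp(max(Y_0, 0)) = 1 is
  -- already accounted for by `P (Al 0) = 1`. This yields `exp A` without loss of a constant.
  let W : ℕ → ℝ≥0∞ := fun n => if n = 0 then 0 else ∫⁻ ω in Al n, e (state F 𝒢 u ω.2 n).2 ∂P
  -- The exponential moment 1 gives exp(max(Y_n, 0)) ≤ exp Y_n + 1 as a bound on the next mean. At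
  -- an alarm at least `e A` is collected.
  have hstep : ∀ n, W (n + 1) + e A * P (Al n \ Al (n + 1)) ≤ W n + P (Al n) := by
    intro n
    have hstm : Measurable fun ω : PUnit.{w + 1} × Path K 𝒳 => state F 𝒢 u ω.2 (n + 1) :=
      (measurable_state F 𝒢 u (n + 1)).mono (history_le rrSample_adapted _) le_rfl
    have h1 := lintegral_state_succ.{v, w} (F := F) (𝒢 := 𝒢) (u := u)
      (μ := fun _ => (F : Measure (Fin K → 𝒳))) (n := n) (κ := fun _ => μ₀) hμ₀
      (V := (Al n).indicator fun _ => (1 : ℝ≥0∞))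
      ((@measurable_const _ _ _ (history (rrSample.{v, w} F 𝒢 u) n) 1).indicator (hAlh n))
      (f := fun q => q.1 * e q.2.2) (by fun_prop)
    have h2 : ∀ ω : PUnit.{w + 1} × Path K 𝒳, ∫⁻ x, (Al n).indicator (fun _ => (1 : ℝ≥0∞)) ω *
        e (step (state F 𝒢 u ω.2 n) x).2 ∂μ₀ =
        (Al n).indicator (fun ω => e (max (state F 𝒢 u ω.2 n).2 0)) ω := by
      intro ω
      have h3 : ∀ x, e (step (state F 𝒢 u ω.2 n) x).2 =
          e (max (state F 𝒢 u ω.2 n).2 0) * ENNReal.ofReal (Real.exp x) := fun x => by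
        simp only [e, step]
        rw [Real.exp_add, ENNReal.ofReal_mul (Real.exp_pos _).le]
      simp only [h3]
      rw [lintegral_const_mul _ (by fun_prop), lintegral_const_mul _ (by fun_prop), hexp, mul_one]
      by_cases hω : ω ∈ Al n <;> simp [hω]
    have h3 : W (n + 1) + e A * P (Al n \ Al (n + 1)) ≤
        ∫⁻ ω, (Al n).indicator (fun _ => (1 : ℝ≥0∞)) ω * e (state F 𝒢 u ω.2 (n + 1)).2 ∂P := by
      simp only [W, Nat.add_eq_zero_iff, one_ne_zero, and_false, if_false]
      have hd : MeasurableSet (Al n \ Al (n + 1)) := (hAlm n).diff (hAlm (n + 1))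
      rw [← lintegral_indicator (hAlm _), ← setLIntegral_const, ← lintegral_indicator hd,
        ← lintegral_add_right _ (measurable_const.indicator hd)]
      refine lintegral_mono fun ω => ?_
      by_cases h4 : ω ∈ Al n
      · by_cases h5 : ω ∈ Al (n + 1)
        · simp [h4, h5]
        · have h6 : A ≤ (state F 𝒢 u ω.2 (n + 1)).2 := by
            by_contra hc
            exact h5 (succ_lt_rrStop_iff.2 ⟨h4, not_le.1 hc⟩)
          simp only [h4, h5, Set.indicator_of_notMem, not_false_eq_true, zero_add,
            Set.indicator_of_mem, one_mul, Set.mem_sdiff, and_self]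
          exact ENNReal.ofReal_le_ofReal (Real.exp_le_exp.2 h6)
      · have h5 : ω ∉ Al (n + 1) := fun h => h4 (succ_lt_rrStop_iff.1 h).1
        simp [h4, h5]
    refine h3.trans ?_
    have h1' : ∫⁻ ω, (Al n).indicator (fun _ => (1 : ℝ≥0∞)) ω * e (state F 𝒢 u ω.2 (n + 1)).2 ∂P =
        ∫⁻ ω in Al n, e (max (state F 𝒢 u ω.2 n).2 0) ∂P := by
      refine Eq.trans h1 ?_
      rw [← lintegral_indicator (hAlm n)]
      exact lintegral_congr h2
    rw [h1']
    rcases Nat.eq_zero_or_pos n with rfl | hn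
    · have h7 : ∀ ω : PUnit.{w + 1} × Path K 𝒳, e (max (state F 𝒢 u ω.2 0).2 0) = 1 := fun ω => by
        simp [e, state]
      simp [h7, W]
    · simp only [W, hn.ne', if_false]
      rw [← setLIntegral_one, ← lintegral_add_right _ measurable_const]
      refine lintegral_mono fun ω => ?_
      rcases le_total (state F 𝒢 u ω.2 n).2 0 with h8 | h8
      · rw [max_eq_right h8]; simp [e]
      · rw [max_eq_left h8]; exact le_self_add
  have hsum : ∀ n, W n + e A * P (Al n)ᶜ ≤ ∑ k ∈ Finset.range n, P (Al k) := by
    intro n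
    induction n with
    | zero =>
      have : Al 0 = Set.univ := by
        ext ω; simp only [hAl, Set.mem_ofPred_eq, Set.mem_univ, iff_true]
        exact lt_rrStop_iff.2 fun k h1 h2 => by omega
      simp [W, this]
    | succ n ih =>
      have h1 : (Al (n + 1))ᶜ = (Al n)ᶜ ∪ (Al n \ Al (n + 1)) := by
        ext ω
        have : ω ∈ Al (n + 1) → ω ∈ Al n := fun h => (succ_lt_rrStop_iff.1 h).1
        simp only [Set.mem_compl_iff, Set.mem_union, Set.mem_sdiff]
        tauto
      rw [Finset.sum_range_succ, h1]
      calc W (n + 1) + e A * P ((Al n)ᶜ ∪ (Al n \ Al (n + 1)))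
          ≤ W (n + 1) + e A * (P (Al n)ᶜ + P (Al n \ Al (n + 1))) := by
            gcongr; exact measure_union_le _ _
        _ = (W (n + 1) + e A * P (Al n \ Al (n + 1))) + e A * P (Al n)ᶜ := by ring
        _ ≤ (W n + P (Al n)) + e A * P (Al n)ᶜ := add_le_add (hstep n) le_rfl
        _ = (W n + e A * P (Al n)ᶜ) + P (Al n) := by ring
        _ ≤ _ := by gcongr
  set T := meanTimeToFalseAlarm F (roundRobin.{v, w} F 𝒢 u A) with hT
  have hTeq : T = ∫⁻ ω, (rrStop F 𝒢 u A ω : ℝ≥0∞) ∂P := rfl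
  have hTn : ∀ n, e A * P (Al n)ᶜ ≤ T := by
    intro n
    refine (le_add_self.trans (hsum n)).trans ?_
    have : ∑ k ∈ Finset.range n, P (Al k) =
        ∫⁻ ω, ∑ k ∈ Finset.range n, (Al k).indicator (fun _ => (1 : ℝ≥0∞)) ω ∂P := by
      rw [lintegral_finsetSum _ fun k _ => measurable_const.indicator (hAlm k)]
      refine Finset.sum_congr rfl fun k _ => ?_
      rw [lintegral_indicator (hAlm k)]; simp
    rw [this, hTeq]
    refine lintegral_mono fun ω => ?_
    clear this
    induction n with
    | zero => simp
    | succ n ih =>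
      rw [Finset.sum_range_succ]
      by_cases h : ω ∈ Al n
      · have h1 : ∑ k ∈ Finset.range n, (Al k).indicator (fun _ => (1 : ℝ≥0∞)) ω ≤ n := by
          refine (Finset.sum_le_sum (g := fun _ => (1 : ℝ≥0∞)) fun k _ => ?_).trans (by simp)
          exact Set.indicator_le_self' (by simp) ω
        have h2 : ((n + 1 : ℕ) : ℝ≥0∞) ≤ (rrStop F 𝒢 u A ω : ℝ≥0∞) := by
          rw [← ENat.toENNReal_coe]
          refine ENat.toENNReal_le.2 ?_
          exact Order.add_one_le_of_lt (show (n : ℕ∞) < rrStop F 𝒢 u A ω from h)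
        refine le_trans ?_ h2
        simp only [h, Set.indicator_of_mem]
        push_cast
        gcongr
      · simpa [h] using ih
  by_cases htop : T = ∞
  · rw [htop]; exact le_top
  -- A finite mean makes the alarm almost surely finite, so P(T ≤ n) tends to 1 in `hTn`.
  have hae : ∀ᵐ ω ∂P, (rrStop F 𝒢 u A ω : ℝ≥0∞) < ∞ :=
    ae_lt_top (measurable_stop (roundRobin.{v, w} F 𝒢 u A)) htop
  have hmono : Monotone fun n => (Al n)ᶜ := by
    refine monotone_nat_of_le_succ fun n => Set.compl_subset_compl.2 fun ω h => ?_
    exact (succ_lt_rrStop_iff.1 h).1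
  have hunion : P (⋃ n, (Al n)ᶜ) = 1 := by
    rw [prob_compl_eq_zero_iff (.iUnion fun n => (hAlm n).compl) |>.symm]
    refine measure_mono_null (fun ω hω => ?_) hae
    simp only [Set.mem_compl_iff, Set.mem_iUnion, not_exists, not_not] at hω
    simp only [Set.mem_compl_iff, Set.mem_ofPred_eq, not_lt, top_le_iff, ENat.toENNReal_eq_top]
    exact ENat.eq_top_iff_forall_gt.2 fun n => hω n
  have hlim := tendsto_measure_iUnion_atTop (μ := P) hmono
  rw [hunion] at hlim
  have h9 := ENNReal.Tendsto.const_mul (a := e A) hlim (Or.inr ENNReal.ofReal_ne_top)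
  rw [mul_one] at h9
  exact le_of_tendsto' h9 hTn

end Chain

/-! ### Time until the alarm, and the walk between resets -/

section Occupation

variable {K m : ℕ} {𝒳 : Type v} [MeasurableSpace 𝒳] {F G : ProbabilityMeasure (Fin K → 𝒳)}
  {𝒢 : Set (ProbabilityMeasure (Fin K → 𝒳))} {N : ℕ} [NeZero N] {u : Fin N → Subsets K m}

/-- An upper bound on the remaining time until the alarm from a Lyapunov function. -/
lemma setLIntegral_rrStop_sub_le {κ : Fin N → Measure ℝ}
    (hκ : ∀ d, (localLaw G (u d)).map (xi F 𝒢 (u d)) = κ d) {A : ℝ} (hA : 0 < A)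
    {Φ : Fin N × ℝ → ℝ≥0∞} (hΦ : Measurable Φ)
    (hdrift : ∀ q : Fin N × ℝ, q.2 < A →
      1 + ∫⁻ x, {q : Fin N × ℝ | q.2 < A}.indicator Φ (step q x) ∂κ q.1 ≤ Φ q)
    {ν : ℕ} {s : Set (PUnit.{w + 1} × Path K 𝒳)}
    (hs : MeasurableSet[history (rrSample.{v, w} F 𝒢 u) ν] s) :
    ∫⁻ ω in s ∩ {ω | (ν : ℕ∞) < rrStop F 𝒢 u A ω}, ((rrStop F 𝒢 u A ω : ℝ≥0∞) - (ν : ℝ≥0∞))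
        ∂((Measure.dirac PUnit.unit).prod (changeLaw F G ν)) ≤
      ∫⁻ ω in s ∩ {ω | (ν : ℕ∞) < rrStop F 𝒢 u A ω}, Φ (state F 𝒢 u ω.2 ν)
        ∂((Measure.dirac PUnit.unit).prod (changeLaw F G ν)) := by
  set P : Measure (PUnit.{w + 1} × Path K 𝒳) :=
    (Measure.dirac PUnit.unit).prod (changeLaw F G ν) with hP
  set Al : ℕ → Set (PUnit.{w + 1} × Path K 𝒳) := fun n => {ω | (n : ℕ∞) < rrStop F 𝒢 u A ω}
    with hAl
  set B : ℕ → Set (PUnit.{w + 1} × Path K 𝒳) := fun j => s ∩ Al (ν + j) with hB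
  have hBh : ∀ j, MeasurableSet[history (rrSample.{v, w} F 𝒢 u) (ν + j)] (B j) := fun j =>
    (history_mono _ (Nat.le_add_right _ _) _ hs).inter (measurableSet_lt_rrStop le_rfl)
  have hBm : ∀ j, MeasurableSet (B j) := fun j => history_le rrSample_adapted _ _ (hBh j)
  -- The drift inequality, integrated over the event of no alarm up to `ν + j`. Telescoping leaves
  -- the sum of the P(T > ν + j), which dominates the mean remaining time.
  have hstep : ∀ j, P (B j) + ∫⁻ ω in B (j + 1), Φ (state F 𝒢 u ω.2 (ν + (j + 1))) ∂P ≤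
      ∫⁻ ω in B j, Φ (state F 𝒢 u ω.2 (ν + j)) ∂P := by
    intro j
    have hG : (if ν + j < ν then (F : Measure (Fin K → 𝒳)) else (G : Measure (Fin K → 𝒳))) = G :=
      if_neg (by omega)
    have h1 := lintegral_state_succ.{v, w} (F := F) (𝒢 := 𝒢) (u := u)
      (μ := fun i => if i < ν then (F : Measure (Fin K → 𝒳)) else (G : Measure (Fin K → 𝒳)))
      (n := ν + j) (κ := κ) (fun d => by simp only [hG]; exact hκ d)
      (V := (B j).indicator fun _ => (1 : ℝ≥0∞))
      ((@measurable_const _ _ _ (history (rrSample.{v, w} F 𝒢 u) (ν + j)) 1).indicator (hBh j))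
      (f := fun q => q.1 * {q : Fin N × ℝ | q.2 < A}.indicator Φ q.2)
      (measurable_fst.mul ((hΦ.indicator
        (measurableSet_lt measurable_snd measurable_const)).comp measurable_snd))
    have h2 : ∫⁻ ω in B (j + 1), Φ (state F 𝒢 u ω.2 (ν + (j + 1))) ∂P ≤
        ∫⁻ ω, (B j).indicator (fun _ => (1 : ℝ≥0∞)) ω *
          {q : Fin N × ℝ | q.2 < A}.indicator Φ (state F 𝒢 u ω.2 (ν + j + 1)) ∂P := by
      rw [← lintegral_indicator (hBm _)]
      refine lintegral_mono fun ω => ?_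
      by_cases hω : ω ∈ B (j + 1)
      swap
      · rw [Set.indicator_of_notMem hω]
        exact zero_le
      rw [Set.indicator_of_mem hω]
      have h3 := succ_lt_rrStop_iff.1 (show ((ν + j + 1 : ℕ) : ℕ∞) < rrStop F 𝒢 u A ω from hω.2)
      rw [Set.indicator_of_mem (show ω ∈ B j from ⟨hω.1, h3.1⟩), one_mul,
        Set.indicator_of_mem (show state F 𝒢 u ω.2 (ν + j + 1) ∈ {q : Fin N × ℝ | q.2 < A} from
          h3.2)]
      exact le_rfl
    have h3 : ∫⁻ ω, (B j).indicator (fun _ => (1 : ℝ≥0∞)) ω *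
          {q : Fin N × ℝ | q.2 < A}.indicator Φ (state F 𝒢 u ω.2 (ν + j + 1)) ∂P =
        ∫⁻ ω in B j, ∫⁻ x, {q : Fin N × ℝ | q.2 < A}.indicator Φ
          (step (state F 𝒢 u ω.2 (ν + j)) x) ∂κ (state F 𝒢 u ω.2 (ν + j)).1 ∂P := by
      refine Eq.trans h1 ?_
      rw [← lintegral_indicator (hBm j)]
      refine lintegral_congr fun ω => ?_
      by_cases hω : ω ∈ B j <;> simp [hω]
    rw [h3] at h2
    refine (add_le_add le_rfl h2).trans ?_
    rw [← setLIntegral_one, ← lintegral_add_left measurable_const]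
    refine setLIntegral_mono' (hBm j) fun ω hω => hdrift _ ?_
    exact state_lt_of_lt_rrStop hA hω.2
  have hsum : ∀ n, ∑ j ∈ Finset.range n, P (B j) + ∫⁻ ω in B n, Φ (state F 𝒢 u ω.2 (ν + n)) ∂P ≤
      ∫⁻ ω in B 0, Φ (state F 𝒢 u ω.2 (ν + 0)) ∂P := by
    intro n
    induction n with
    | zero => simp
    | succ n ih =>
      rw [Finset.sum_range_succ, add_assoc]
      exact (add_le_add le_rfl (hstep n)).trans ih
  calc ∫⁻ ω in s ∩ Al ν, ((rrStop F 𝒢 u A ω : ℝ≥0∞) - (ν : ℝ≥0∞)) ∂P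
      ≤ ∫⁻ ω in s ∩ Al ν, ∑' j : ℕ, (Al (ν + j)).indicator (fun _ => (1 : ℝ≥0∞)) ω ∂P := by
        refine lintegral_mono fun ω => (toENNReal_sub_le_tsum _ ν).trans (le_of_eq ?_)
        exact tsum_congr fun j => by simp [Set.indicator_apply, hAl]
    _ = ∑' j, P (B j) := by
        have hAm : ∀ j, MeasurableSet (Al j) := fun j =>
          history_le rrSample_adapted _ _ (measurableSet_lt_rrStop le_rfl)
        rw [lintegral_tsum fun j => (measurable_const.indicator (hAm _)).aemeasurable]
        refine tsum_congr fun j => ?_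
        rw [lintegral_indicator (hAm _), setLIntegral_const, one_mul,
          Measure.restrict_apply (hAm _)]
        congr 1
        ext ω
        have : ω ∈ Al (ν + j) → ω ∈ Al ν := fun h =>
          lt_of_le_of_lt (show (ν : ℕ∞) ≤ ((ν + j : ℕ) : ℕ∞) by
            exact_mod_cast Nat.le_add_right ν j) h
        simp only [hB, Set.mem_inter_iff]
        tauto
    _ ≤ ∫⁻ ω in s ∩ Al ν, Φ (state F 𝒢 u ω.2 ν) ∂P := by
        refine ENNReal.tsum_le_of_sum_range_le fun n => ?_
        exact le_self_add.trans (hsum n)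

/-- The event that the Round Robin CUSUM statistic stays in the set `I` from time `i + 1` to time
`i + l`. -/
def stay (F : ProbabilityMeasure (Fin K → 𝒳)) (𝒢 : Set (ProbabilityMeasure (Fin K → 𝒳)))
    (u : Fin N → Subsets K m) (I : Set ℝ) (i l : ℕ) : Set (PUnit.{w + 1} × Path K 𝒳) :=
  {ω | ∀ j < l, (state F 𝒢 u ω.2 (i + j + 1)).2 ∈ I}

lemma measurableSet_stay {I : Set ℝ} (hI : MeasurableSet I) (i l : ℕ) :
    MeasurableSet[history (rrSample.{v, w} F 𝒢 u) (i + l)] (stay F 𝒢 u I i l) := by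
  have : stay F 𝒢 u I i l = ⋂ j : Fin l,
      {ω : PUnit.{w + 1} × Path K 𝒳 | (state F 𝒢 u ω.2 (i + j + 1)).2 ∈ I} := by
    ext ω
    simp only [stay, Set.mem_ofPred_eq, Set.mem_iInter]
    exact ⟨fun h j => h j j.2, fun h j hj => h ⟨j, hj⟩⟩
  rw [this]
  refine .iInter fun j => ?_
  exact history_mono _ (by omega) _ ((measurable_snd.comp (measurable_state F 𝒢 u (i + j + 1))) hI)

/-- Between resets and before the change the Round Robin CUSUM is a random walk. -/
lemma setLIntegral_stay_eq {μ : ℕ → Measure (Fin K → 𝒳)} [∀ i, IsProbabilityMeasure (μ i)]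
    {μ₀ : Measure ℝ} [SFinite μ₀] {A : ℝ} {i : ℕ} {R : Set (PUnit.{w + 1} × Path K 𝒳)}
    (hR : MeasurableSet[history (rrSample.{v, w} F 𝒢 u) i] R)
    (hR0 : ∀ ω ∈ R, (state F 𝒢 u ω.2 i).2 ≤ 0) (l : ℕ)
    (hμ : ∀ j < l, ∀ d, ((μ (i + j)).map (obs (u d))).map (xi F 𝒢 (u d)) = μ₀)
    {φ : ℝ → ℝ≥0∞} (hφ : Measurable φ) :
    ∫⁻ ω in R ∩ stay F 𝒢 u (Set.Ioo 0 A) i l, φ (max (state F 𝒢 u ω.2 (i + l)).2 0)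
        ∂((Measure.dirac PUnit.unit).prod (Measure.infinitePi μ)) =
      ((Measure.dirac PUnit.unit).prod (Measure.infinitePi μ)) R *
        strip μ₀ (Set.Ioo 0 A) l φ 0 := by
  have hRm : MeasurableSet R := history_le rrSample_adapted _ _ hR
  induction l generalizing φ with
  | zero =>
    have h0 : stay F 𝒢 u (Set.Ioo 0 A) i 0 = (Set.univ : Set (PUnit.{w + 1} × Path K 𝒳)) := by
      ext; simp [stay]
    rw [h0, Set.inter_univ, mul_comm]
    simp only [strip]
    rw [← setLIntegral_const]
    refine setLIntegral_congr_fun hRm fun ω hω => ?_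
    simp only [add_zero]
    -- Below 0 the next increment is added to 0, so the walk starts at 0 whatever the undershoot at
    -- the reset.
    rw [max_eq_right (hR0 ω hω)]
  | succ l ih =>
    set C := R ∩ stay F 𝒢 u (Set.Ioo 0 A) i l with hC
    have hCh : MeasurableSet[history (rrSample.{v, w} F 𝒢 u) (i + l)] C :=
      (history_mono _ (Nat.le_add_right _ _) _ hR).inter (measurableSet_stay measurableSet_Ioo i l)
    have hCm : MeasurableSet C := history_le rrSample_adapted _ _ hCh
    have hC' : MeasurableSet (R ∩ stay F 𝒢 u (Set.Ioo 0 A) i (l + 1)) :=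
      hRm.inter (history_le rrSample_adapted _ _ (measurableSet_stay measurableSet_Ioo i (l + 1)))
    have h1 := lintegral_state_succ.{v, w} (F := F) (𝒢 := 𝒢) (u := u) (μ := μ)
      (n := i + l) (κ := fun _ => μ₀) (hμ l (Nat.lt_succ_self l))
      (V := C.indicator fun _ => (1 : ℝ≥0∞))
      ((@measurable_const _ _ _ (history (rrSample.{v, w} F 𝒢 u) (i + l)) 1).indicator hCh)
      (f := fun q => q.1 * (Set.Ioo 0 A).indicator φ q.2.2)
      (measurable_fst.mul ((hφ.indicator measurableSet_Ioo).comp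
        (measurable_snd.comp measurable_snd)))
    have h2 := ih (fun j hj => hμ j (by omega)) (measurable_strip (μ := μ₀)
      (measurableSet_Ioo (a := (0 : ℝ)) (b := A)) hφ 1)
    rw [strip_add_steps, ← h2, ← lintegral_indicator hC', ← lintegral_indicator hCm]
    refine Eq.trans (lintegral_congr fun ω => ?_) (h1.trans (lintegral_congr fun ω => ?_))
    · by_cases hω : ω ∈ C
      · by_cases hy : (state F 𝒢 u ω.2 (i + l + 1)).2 ∈ Set.Ioo 0 A
        · have : ω ∈ R ∩ stay F 𝒢 u (Set.Ioo 0 A) i (l + 1) := by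
            refine ⟨hω.1, fun j hj => ?_⟩
            rcases Nat.lt_succ_iff_lt_or_eq.1 hj with h | rfl
            · exact hω.2 j h
            · exact hy
          rw [Set.indicator_of_mem this, Set.indicator_of_mem hω, Set.indicator_of_mem hy,
            one_mul, ← add_assoc, max_eq_left hy.1.le]
        · have : ω ∉ R ∩ stay F 𝒢 u (Set.Ioo 0 A) i (l + 1) := fun h => hy (h.2 l (by omega))
          rw [Set.indicator_of_notMem this, Set.indicator_of_notMem hy, mul_zero]
      · have : ω ∉ R ∩ stay F 𝒢 u (Set.Ioo 0 A) i (l + 1) := fun h =>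
          hω ⟨h.1, fun j hj => h.2 j (by omega)⟩
        rw [Set.indicator_of_notMem this, Set.indicator_of_notMem hω, zero_mul]
    · by_cases hω : ω ∈ C
      · simp only [Set.indicator_of_mem hω, one_mul, strip]
        rfl
      · simp [hω]

end Occupation

/-! ### The statistic of an unaffected unit at the change-point -/

section Height

variable {K m : ℕ} {𝒳 : Type v} [MeasurableSpace 𝒳] {F G : ProbabilityMeasure (Fin K → 𝒳)}
  {𝒢 : Set (ProbabilityMeasure (Fin K → 𝒳))} {N : ℕ} [NeZero N] {u : Fin N → Subsets K m}

/-- A switch to the next unit requires a non-positive statistic. -/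
lemma state_fst_eq_of_mem_stay {A : ℝ} {i l : ℕ} {ω : PUnit.{w + 1} × Path K 𝒳}
    (h : ω ∈ stay F 𝒢 u (Set.Ioo 0 A) i l) {j : ℕ} (hj : j ≤ l) :
    (state F 𝒢 u ω.2 (i + j)).1 = (state F 𝒢 u ω.2 i).1 := by
  induction j with
  | zero => rfl
  | succ j ih =>
    rw [← ih (by omega)]
    have h1 := (h j (by omega)).1
    rw [← add_assoc]
    rw [state_succ] at h1 ⊢
    exact if_neg (not_le.2 h1)

lemma lt_rrStop_of_mem_stay {A : ℝ} {i l : ℕ} {ω : PUnit.{w + 1} × Path K 𝒳}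
    (hi : (i : ℕ∞) < rrStop F 𝒢 u A ω) (h : ω ∈ stay F 𝒢 u (Set.Ioo 0 A) i l) :
    ((i + l : ℕ) : ℕ∞) < rrStop F 𝒢 u A ω := by
  induction l with
  | zero => exact hi
  | succ l ih =>
    exact succ_lt_rrStop_iff.2 ⟨ih fun j hj => h j (by omega), (h l (by omega)).2⟩

/-- The last time up to `ν` at which the statistic of the Round Robin CUSUM was not positive. -/
lemma exists_last_reset {A : ℝ} {ν : ℕ} {ω : PUnit.{w + 1} × Path K 𝒳}
    (hν : (ν : ℕ∞) < rrStop F 𝒢 u A ω) : ∃ i ≤ ν, (i : ℕ∞) < rrStop F 𝒢 u A ω ∧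
      (state F 𝒢 u ω.2 i).2 ≤ 0 ∧ ω ∈ stay F 𝒢 u (Set.Ioo 0 A) i (ν - i) := by
  classical
  set i := Nat.findGreatest (fun i => (state F 𝒢 u ω.2 i).2 ≤ 0) ν with hi
  have hiν : i ≤ ν := Nat.findGreatest_le ν
  refine ⟨i, hiν, lt_of_le_of_lt (by exact_mod_cast hiν) hν, ?_, fun j hj => ⟨?_, ?_⟩⟩
  -- Time 0 qualifies, since Y_0 = 0.
  · exact Nat.findGreatest_spec (P := fun i => (state F 𝒢 u ω.2 i).2 ≤ 0) (Nat.zero_le ν) le_rfl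
  · exact not_le.1 (Nat.findGreatest_is_greatest
      (P := fun i => (state F 𝒢 u ω.2 i).2 ≤ 0) (n := ν) (k := i + j + 1) (by omega) (by omega))
  · exact lt_rrStop_iff.1 hν _ (by omega) (by omega)

/-- The expected height at the change-point of the statistic of the unit sampled then, when this
unit is unaffected. -/
lemma setLIntegral_height_le {μ₀ : Measure ℝ} [SFinite μ₀]
    (hμ₀ : ∀ d, (localLaw F (u d)).map (xi F 𝒢 (u d)) = μ₀) {A : ℝ} {c : ℝ≥0∞}
    (hc : ∀ n, strip μ₀ (Set.Ioo 0 A) n ENNReal.ofReal 0 ≤ c * strip μ₀ (Set.Ioo 0 A) n 1 0)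
    {ν : ℕ} {s : Set (PUnit.{w + 1} × Path K 𝒳)}
    (hs : MeasurableSet[partialHistory (rrSample.{v, w} F 𝒢 u) (affected m F G) ν] s) :
    ∫⁻ ω in s ∩ {ω | (ν : ℕ∞) < rrStop F 𝒢 u A ω}, {q : Fin N × ℝ | u q.1 ∉ affected m F G}.indicator
        (fun q => ENNReal.ofReal (max q.2 0)) (state F 𝒢 u ω.2 ν)
        ∂((Measure.dirac PUnit.unit).prod (changeLaw F G ν)) ≤
      c * ((Measure.dirac PUnit.unit).prod (changeLaw F G ν))
        (s ∩ {ω | (ν : ℕ∞) < rrStop F 𝒢 u A ω}) := by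
  set P : Measure (PUnit.{w + 1} × Path K 𝒳) :=
    (Measure.dirac PUnit.unit).prod (changeLaw F G ν) with hP
  set Al : Set (PUnit.{w + 1} × Path K 𝒳) := {ω | (ν : ℕ∞) < rrStop F 𝒢 u A ω} with hAl
  let R : ℕ → Set (PUnit.{w + 1} × Path K 𝒳) := fun i => {ω | (i : ℕ∞) < rrStop F 𝒢 u A ω ∧
    (state F 𝒢 u ω.2 i).2 ≤ 0 ∧ u (state F 𝒢 u ω.2 i).1 ∉ affected m F G}
  let E : ℕ → Set (PUnit.{w + 1} × Path K 𝒳) := fun i =>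
    R i ∩ stay F 𝒢 u (Set.Ioo 0 A) i (ν - i)
  have hRh : ∀ i, MeasurableSet[history (rrSample.{v, w} F 𝒢 u) i] (R i) := fun i => by
    have h1 := measurable_state.{v, w} F 𝒢 u i
    refine (measurableSet_lt_rrStop le_rfl).inter (MeasurableSet.inter ?_ ?_)
    · exact (measurable_snd.comp h1) measurableSet_Iic
    · exact (measurable_fst.comp h1) (MeasurableSet.of_discrete
        (s := {d : Fin N | u d ∉ affected m F G}))
  have hEm : ∀ i, MeasurableSet (E i) := fun i =>
    (history_le rrSample_adapted _ _ (hRh i)).inter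
      (history_le rrSample_adapted _ _ (measurableSet_stay measurableSet_Ioo i (ν - i)))
  have hsm : MeasurableSet s :=
    history_le rrSample_adapted ν _ (partialHistory_le rrSample_adapted _ ν _ hs)
  have hAm : MeasurableSet Al := history_le rrSample_adapted _ _ (measurableSet_lt_rrStop le_rfl)
  have hfst : ∀ i ≤ ν, ∀ ω ∈ E i, ∀ t, i ≤ t → t ≤ ν →
      (state F 𝒢 u ω.2 t).1 = (state F 𝒢 u ω.2 i).1 := by
    intro i hi ω hω t hit htν
    have := state_fst_eq_of_mem_stay hω.2 (j := t - i) (by omega)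
    rwa [Nat.add_sub_cancel' hit] at this
  have hEA : ∀ i ≤ ν, E i ⊆ Al := by
    intro i hi ω hω
    have := lt_rrStop_of_mem_stay hω.1.1 hω.2
    rwa [Nat.add_sub_cancel' hi] at this
  have hdisj : Pairwise (Function.onFun Disjoint fun i : Fin (ν + 1) => s ∩ E i) := by
    have key : ∀ i j : ℕ, i < j → j ≤ ν → ∀ ω ∈ E i, ω ∉ E j := by
      intro i j hij hj ω h1 h2
      have h3 := (h1.2 (j - i - 1) (by omega)).1
      rw [show i + (j - i - 1) + 1 = j by omega] at h3
      exact absurd h2.1.2.1 (not_le.2 h3)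
    intro i j hij
    refine Set.disjoint_left.2 fun ω h1 h2 => ?_
    rcases lt_or_gt_of_ne hij with h | h
    · exact key i j h (by omega) ω h1.2 h2.2
    · exact key j i h (by omega) ω h2.2 h1.2
  have hsE : ∀ i : Fin (ν + 1), MeasurableSet (s ∩ E i) := fun i => hsm.inter (hEm i)
  have hbound : ∀ i ≤ ν, ∫⁻ ω in s ∩ E i, ENNReal.ofReal (max (state F 𝒢 u ω.2 ν).2 0) ∂P ≤
      c * P (s ∩ E i) := by
    intro i hi
    -- Since the reset at `i` only one unaffected unit has been sampled, so on `E i` the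
    -- conditioning event is already decided at time `i`. Its probability factors out, and what
    -- remains is the walk confined to `(0, A)`.
    obtain ⟨s', hs', he⟩ := exists_history_trace (rrSample_adapted.{v, w} (F := F) (𝒢 := 𝒢) (u := u))
      (i := i) (C := E i) (fun ω hω t hit htν => by
        rw [rrSample, hfst i hi ω hω t hit htν.le]
        exact hω.1.2.2) hs
    have he' : s ∩ E i = (s' ∩ R i) ∩ stay F 𝒢 u (Set.Ioo 0 A) i (ν - i) := by
      rw [he, Set.inter_assoc]
    have hR' := hs'.inter (hRh i)
    have hlaw : ∀ j < ν - i, ∀ d, ((if i + j < ν then (F : Measure (Fin K → 𝒳))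
        else (G : Measure (Fin K → 𝒳))).map (obs (u d))).map (xi F 𝒢 (u d)) = μ₀ := by
      intro j hj d
      rw [if_pos (by omega)]
      exact hμ₀ d
    have h1 := setLIntegral_stay_eq.{v, w}
      (μ := fun i => if i < ν then (F : Measure (Fin K → 𝒳)) else (G : Measure (Fin K → 𝒳)))
      (A := A) hR' (fun ω hω => hω.2.2.1) (ν - i) hlaw ENNReal.measurable_ofReal
    have h2 := setLIntegral_stay_eq.{v, w}
      (μ := fun i => if i < ν then (F : Measure (Fin K → 𝒳)) else (G : Measure (Fin K → 𝒳)))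
      (A := A) hR' (fun ω hω => hω.2.2.1) (ν - i) hlaw (φ := 1) measurable_one
    simp only [Pi.one_apply, setLIntegral_one] at h2
    rw [Nat.add_sub_cancel' hi] at h1
    rw [he']
    refine (le_of_eq h1).trans ?_
    refine le_trans ?_ (le_of_eq (congrArg (c * ·) h2.symm))
    rw [mul_left_comm]
    gcongr
    exact hc _
  calc ∫⁻ ω in s ∩ Al, {q : Fin N × ℝ | u q.1 ∉ affected m F G}.indicator
        (fun q => ENNReal.ofReal (max q.2 0)) (state F 𝒢 u ω.2 ν) ∂P
      ≤ ∫⁻ ω in ⋃ i : Fin (ν + 1), s ∩ E i, ENNReal.ofReal (max (state F 𝒢 u ω.2 ν).2 0) ∂P := by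
        rw [← lintegral_indicator (hsm.inter hAm),
          ← lintegral_indicator (.iUnion hsE)]
        refine lintegral_mono fun ω => ?_
        by_cases hω : ω ∈ s ∩ Al
        · rw [Set.indicator_of_mem hω]
          by_cases hq : u (state F 𝒢 u ω.2 ν).1 ∈ affected m F G
          · rw [Set.indicator_of_notMem (by simpa using hq)]
            exact zero_le
          · obtain ⟨i, hi, h1, h2, h3⟩ := exists_last_reset hω.2
            have h4 := state_fst_eq_of_mem_stay h3 le_rfl
            rw [Nat.add_sub_cancel' hi] at h4
            have h5 : ω ∈ ⋃ i : Fin (ν + 1), s ∩ E i :=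
              Set.mem_iUnion.2 ⟨⟨i, by omega⟩, hω.1, ⟨h1, h2, h4 ▸ hq⟩, h3⟩
            rw [Set.indicator_of_mem h5, Set.indicator_of_mem (by exact hq)]
        · rw [Set.indicator_of_notMem hω]
          exact zero_le
    _ = ∑ i : Fin (ν + 1), ∫⁻ ω in s ∩ E i, ENNReal.ofReal (max (state F 𝒢 u ω.2 ν).2 0) ∂P := by
        rw [lintegral_iUnion hsE hdisj, tsum_fintype]
    _ ≤ ∑ i : Fin (ν + 1), c * P (s ∩ E i) := Finset.sum_le_sum fun i _ => hbound i (by omega)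
    _ = c * P (⋃ i : Fin (ν + 1), s ∩ E i) := by
        rw [← Finset.mul_sum, measure_iUnion hdisj hsE, tsum_fintype]
    _ ≤ c * P (s ∩ Al) := by
        gcongr
        exact Set.iUnion_subset fun i => Set.inter_subset_inter_right s (hEA i (by omega))

end Height

/-! ### A Lyapunov function for the time until the alarm -/

section Lyapunov

/-- A number of steps after which a cyclic enumeration reaches the set `p`. -/
lemma exists_cyclic_distance {N : ℕ} [NeZero N] {p : Fin N → Prop} (h : ∃ d, p d) :
    ∃ k : Fin N → ℕ, ∀ d, ¬ p d → k (d + 1) + 1 ≤ k d := by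
  classical
  obtain ⟨e, he⟩ := h
  have hex : ∀ d : Fin N, ∃ j : ℕ, p (d + Fin.ofNat N j) := fun d =>
    ⟨(e - d).val, by
      have : Fin.ofNat N (e - d).val = e - d := Fin.ofNat_val_eq_self _
      rwa [this, add_sub_cancel]⟩
  -- The least distance is positive where `p` fails, and moving on by one index reduces it.
  refine ⟨fun d => Nat.find (hex d), fun d hd => ?_⟩
  obtain ⟨j, hj⟩ : ∃ j, Nat.find (hex d) = j + 1 := by
    refine Nat.exists_eq_succ_of_ne_zero fun h0 => hd ?_
    have h1 := Nat.find_spec (hex d)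
    rw [h0] at h1
    simpa using h1
  change Nat.find (hex (d + 1)) + 1 ≤ Nat.find (hex d)
  rw [hj]
  refine Nat.succ_le_succ (Nat.find_min' _ ?_)
  have h1 := Nat.find_spec (hex d)
  rw [hj] at h1
  have : Fin.ofNat N (j + 1) = 1 + Fin.ofNat N j := by
    apply Fin.ext
    simp [Fin.val_add, Fin.ofNat, Nat.add_comm]
  rw [this, ← add_assoc] at h1
  exact h1

variable {N : ℕ}

/-- A Lyapunov function for the state of the Round Robin CUSUM after the change. -/
noncomputable def lyapunov (p : Fin N → Prop) [DecidablePred p] (k : Fin N → ℕ)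
    (a c J D g κ : ℝ) (q : Fin N × ℝ) : ℝ :=
  if p q.1 then (if 0 < q.2 then (a - q.2) / J + κ * Real.exp (-q.2) else a / J + κ * g)
  else (k q.1 * c + max q.2 0) / D + (a / J + κ * g)

variable {p : Fin N → Prop} [DecidablePred p] {k : Fin N → ℕ} {A b c J D g κ : ℝ}

lemma measurable_lyapunov : Measurable (lyapunov p k A c J D g κ) := by
  refine measurable_from_prod_countable_right fun d => ?_
  simp only [lyapunov]
  by_cases hd : p d
  · simp only [hd, if_true]
    exact Measurable.ite measurableSet_Ioi (by fun_prop) measurable_const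
  · simp only [hd, if_false]
    fun_prop

lemma lyapunov_nonneg (hc : 0 ≤ c) (hJ : 0 < J) (hD : 0 < D) (hg : 0 ≤ g) (hκ : 0 ≤ κ)
    (hA : 0 < A) {q : Fin N × ℝ} (hq : q.2 ≤ A) : 0 ≤ lyapunov p k A c J D g κ q := by
  have : 0 ≤ A - q.2 := by linarith
  unfold lyapunov
  split_ifs <;> positivity

lemma lyapunov_le_of_nonpos (hc : 0 ≤ c) (hD : 0 < D) {q : Fin N × ℝ} (hq : q.2 ≤ 0) :
    lyapunov p k A c J D g κ q ≤ k q.1 * c / D + (A / J + κ * g) := by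
  unfold lyapunov
  rw [if_neg (not_lt.2 hq), max_eq_right hq, add_zero]
  split_ifs
  · have : 0 ≤ k q.1 * c / D := by positivity
    linarith
  · exact le_rfl

/-- Up to a constant of leading order `A / J`, only the height at an unaffected unit remains; its
mean is controlled by the confined walk. -/
lemma lyapunov_le (hJ : 0 < J) (hg : g ≤ 1) (hκ : 0 ≤ κ)
    {M : ℝ} (hM : ∀ d, k d * c / D ≤ M) (hM0 : 0 ≤ M) (q : Fin N × ℝ) :
    lyapunov p k A c J D g κ q ≤
      (A / J + κ + M) + {q : Fin N × ℝ | ¬ p q.1}.indicator (fun q => max q.2 0) q / D := by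
  have h1 : κ * g ≤ κ := mul_le_of_le_one_right hκ hg
  unfold lyapunov
  by_cases hd : p q.1
  · rw [if_pos hd, Set.indicator_of_notMem (by simpa using hd), zero_div, add_zero]
    split_ifs with hq
    · have h2 : (A - q.2) / J ≤ A / J := by gcongr; linarith
      have h3 : κ * Real.exp (-q.2) ≤ κ :=
        mul_le_of_le_one_right hκ (Real.exp_le_one_iff.2 (by linarith))
      linarith
    · linarith
  · rw [if_neg hd, Set.indicator_of_mem (by exact hd), add_div]
    have := hM q.1
    linarith

variable [NeZero N]

/-- Capping the increment at `b` keeps the bound non-negative when the step overshoots `A`. A fall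
to 0 or below costs at most `κ * (1 - g)` for a round through unaffected units, in addition to the
restart value with `κ * g`; the exponential capped at 1 pays for both. -/
lemma lyapunov_step_le_of_mem (hc : 0 ≤ c) (hJ : 0 < J) (hD : 0 < D) (hκ : 0 ≤ κ)
    (hA : 0 < A) (hM : ∀ d, k d * c / D ≤ κ * (1 - g)) {q : Fin N × ℝ} (hp : p q.1)
    (hq : q.2 < A) (x : ℝ) :
    {q : Fin N × ℝ | q.2 < A}.indicator (lyapunov p k (A + b) c J D g κ) (step q x) ≤
      (A + b - max q.2 0 - min x b) / J + κ * min 1 (Real.exp (-(max q.2 0 + x))) := by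
  have hy : max q.2 0 ≤ A := max_le hq.le hA.le
  have hmx := min_le_left x b
  have hmb := min_le_right x b
  by_cases hz : max q.2 0 + x < A
  · rw [Set.indicator_of_mem (by exact hz)]
    by_cases hz0 : max q.2 0 + x ≤ 0
    · refine (lyapunov_le_of_nonpos hc hD hz0).trans ?_
      rw [min_eq_left (Real.one_le_exp (by linarith))]
      have h1 := hM (step q x).1
      have h2 : (A + b) / J ≤ (A + b - max q.2 0 - min x b) / J := by gcongr; linarith
      linarith
    · have h0 := not_le.1 hz0
      simp only [step, if_neg hz0, lyapunov, if_pos hp, if_pos h0]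
      rw [min_eq_right (Real.exp_le_one_iff.2 (by linarith))]
      have h2 : (A + b - (max q.2 0 + x)) / J ≤ (A + b - max q.2 0 - min x b) / J :=
        div_le_div_of_nonneg_right (by linarith) hJ.le
      linarith
  · rw [Set.indicator_of_notMem (by exact hz)]
    have : 0 ≤ A + b - max q.2 0 - min x b := by linarith
    positivity

/-- A reset removes the height and lowers the cyclic distance by at least one, a credit of `c`.
Hence the decrease is at least `min (-x) c` whether the walk resets or continues. -/
lemma lyapunov_step_le_of_notMem (hk : ∀ d, ¬ p d → k (d + 1) + 1 ≤ k d) (hc : 0 ≤ c) (hJ : 0 < J)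
    (hD : 0 < D) (hg : 0 ≤ g) (hκ : 0 ≤ κ) (hA : 0 < A)
    (hb : 0 ≤ b) {q : Fin N × ℝ} (hp : ¬ p q.1) (x : ℝ) :
    {q : Fin N × ℝ | q.2 < A}.indicator (lyapunov p k (A + b) c J D g κ) (step q x) ≤
      (k q.1 * c + max q.2 0 - min (-x) c) / D + ((A + b) / J + κ * g) := by
  have hy : 0 ≤ max q.2 0 := le_max_right _ _
  have hmx := min_le_left (-x) c
  have hmc := min_le_right (-x) c
  have hk0 : 0 ≤ k q.1 * c := by positivity
  by_cases hz : max q.2 0 + x < A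
  · rw [Set.indicator_of_mem (by exact hz)]
    by_cases hz0 : max q.2 0 + x ≤ 0
    · refine (lyapunov_le_of_nonpos hc hD hz0).trans ?_
      have h1 : ((k (q.1 + 1) : ℝ) + 1) * c ≤ k q.1 * c := by
        gcongr
        exact_mod_cast hk q.1 hp
      have h2 : k (q.1 + 1) * c / D ≤ (k q.1 * c + max q.2 0 - min (-x) c) / D := by
        gcongr
        linarith
      simp only [step, if_pos hz0]
      linarith
    · have h0 := not_le.1 hz0
      simp only [step, if_neg hz0, lyapunov, if_neg hp]
      rw [max_eq_left h0.le]
      have h2 : (k q.1 * c + (max q.2 0 + x)) / D ≤ (k q.1 * c + max q.2 0 - min (-x) c) / D := by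
        gcongr
        linarith
      linarith
  · rw [Set.indicator_of_notMem (by exact hz)]
    have : 0 ≤ k q.1 * c + max q.2 0 - min (-x) c := by linarith
    positivity

lemma one_add_lintegral_le_ofReal {μ : Measure ℝ} {φ : ℝ → ℝ} {ψ : ℝ → ℝ} (hφ : ∀ x, 0 ≤ φ x)
    (h : ∀ x, φ x ≤ ψ x) (hψ : Integrable ψ μ) {z : ℝ} (hz : 1 + ∫ x, ψ x ∂μ ≤ z) :
    1 + ∫⁻ x, ENNReal.ofReal (φ x) ∂μ ≤ ENNReal.ofReal z := by
  have h0 : ∀ x, 0 ≤ ψ x := fun x => (hφ x).trans (h x)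
  calc 1 + ∫⁻ x, ENNReal.ofReal (φ x) ∂μ ≤ ENNReal.ofReal 1 + ∫⁻ x, ENNReal.ofReal (ψ x) ∂μ := by
        rw [ENNReal.ofReal_one]
        gcongr with x
        exact h x
    _ = ENNReal.ofReal (1 + ∫ x, ψ x ∂μ) := by
        rw [← ofReal_integral_eq_lintegral_ofReal hψ (ae_of_all _ h0),
          ENNReal.ofReal_add zero_le_one (integral_nonneg h0)]
    _ ≤ ENNReal.ofReal z := ENNReal.ofReal_le_ofReal hz

/-- `J` and `D` are the means of the capped upward and downward progress, so each step gains one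
unit of time. For a positive affected statistic the exponential term is a supermartingale because
exp(-x) has mean at most 1. When an affected unit restarts, its mean is exactly `g`, the fixed point
built into the definition. -/
lemma lyapunov_drift {μ₀ μ₁ : Measure ℝ} [IsProbabilityMeasure μ₀] [IsProbabilityMeasure μ₁]
    (hk : ∀ d, ¬ p d → k (d + 1) + 1 ≤ k d) (hc : 0 ≤ c) (hb : 0 ≤ b)
    (hi₀ : Integrable (fun x => x) μ₀) (hi₁ : Integrable (fun x => x) μ₁)
    (he : Integrable (fun x => Real.exp (-x)) μ₁) (he1 : ∫ x, Real.exp (-x) ∂μ₁ ≤ 1)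
    (hJ : 0 < J) (hJe : ∫ x, min x b ∂μ₁ = J) (hD : 0 < D) (hDe : ∫ x, min (-x) c ∂μ₀ = D)
    (hge : ∫ x, min 1 (Real.exp (-x)) ∂μ₁ = g) (hκ : 0 ≤ κ)
    (hM : ∀ d, k d * c / D ≤ κ * (1 - g)) (hA : 0 < A) {q : Fin N × ℝ} (hq : q.2 < A) :
    1 + ∫⁻ x, {q : Fin N × ℝ | q.2 < A}.indicator
        (fun q => ENNReal.ofReal (lyapunov p k (A + b) c J D g κ q)) (step q x)
        ∂(if p q.1 then μ₁ else μ₀) ≤ ENNReal.ofReal (lyapunov p k (A + b) c J D g κ q) := by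
  have hg : 0 ≤ g := hge ▸ integral_nonneg fun x => by positivity
  have hind : ∀ x, {q : Fin N × ℝ | q.2 < A}.indicator
        (fun q => ENNReal.ofReal (lyapunov p k (A + b) c J D g κ q)) (step q x) =
      ENNReal.ofReal ({q : Fin N × ℝ | q.2 < A}.indicator
        (lyapunov p k (A + b) c J D g κ) (step q x)) := fun x => by
    by_cases h : step q x ∈ {q : Fin N × ℝ | q.2 < A} <;> simp [Set.indicator, h]
  have hnn : ∀ x, 0 ≤ {q : Fin N × ℝ | q.2 < A}.indicator
        (lyapunov p k (A + b) c J D g κ) (step q x) := fun x =>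
    Set.indicator_nonneg (fun r hr => lyapunov_nonneg hc hJ hD hg hκ (by linarith)
      (by have : r.2 < A := hr; linarith)) _
  simp only [hind]
  have hcap : ∀ t : ℝ, Integrable (fun x => min 1 (Real.exp (-(t + x)))) μ₁ := fun t => by
    refine (integrable_const (1 : ℝ)).mono' (by fun_prop) (ae_of_all _ fun x => ?_)
    rw [Real.norm_of_nonneg (by positivity)]
    exact min_le_left _ _
  by_cases hp : p q.1
  · simp only [if_pos hp]
    have hib : Integrable (fun x => min x b) μ₁ := hi₁.inf (integrable_const b)
    have hψ1 : Integrable (fun x => (A + b - max q.2 0 - min x b) / J) μ₁ :=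
      ((integrable_const _).sub hib).div_const J
    refine one_add_lintegral_le_ofReal hnn
      (lyapunov_step_le_of_mem hc hJ hD hκ hA hM hp hq) (hψ1.add ((hcap _).const_mul κ)) ?_
    have e1 : ∫ x, (A + b - max q.2 0 - min x b) / J ∂μ₁ = (A + b - max q.2 0) / J - 1 := by
      rw [integral_div, integral_sub (integrable_const _) hib, hJe]
      simp only [integral_const, probReal_univ, one_smul]
      field_simp
    rw [integral_add hψ1 ((hcap _).const_mul κ), integral_const_mul, e1]
    simp only [lyapunov, if_pos hp]
    split_ifs with hy
    · rw [max_eq_left hy.le]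
      have h1 : ∫ x, min 1 (Real.exp (-(q.2 + x))) ∂μ₁ ≤ Real.exp (-q.2) := by
        calc ∫ x, min 1 (Real.exp (-(q.2 + x))) ∂μ₁
            ≤ ∫ x, Real.exp (-q.2) * Real.exp (-x) ∂μ₁ := by
              refine integral_mono (hcap _) (he.const_mul _) fun x => (min_le_right _ _).trans ?_
              rw [← Real.exp_add, neg_add]
          _ = Real.exp (-q.2) * ∫ x, Real.exp (-x) ∂μ₁ := integral_const_mul _ _
          _ ≤ Real.exp (-q.2) := mul_le_of_le_one_right (Real.exp_pos _).le he1
      have := mul_le_mul_of_nonneg_left h1 hκ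
      linarith
    · rw [max_eq_right (not_lt.1 hy)]
      simp only [zero_add, hge, sub_zero]
      linarith
  · simp only [if_neg hp]
    have hib : Integrable (fun x => min (-x) c) μ₀ := hi₀.neg.inf (integrable_const c)
    have hψ1 : Integrable (fun x => (k q.1 * c + max q.2 0 - min (-x) c) / D) μ₀ :=
      ((integrable_const _).sub hib).div_const D
    refine one_add_lintegral_le_ofReal hnn
      (lyapunov_step_le_of_notMem hk hc hJ hD hg hκ hA hb hp) (hψ1.add (integrable_const _)) ?_
    have e1 : ∫ x, (k q.1 * c + max q.2 0 - min (-x) c) / D ∂μ₀ =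
        (k q.1 * c + max q.2 0) / D - 1 := by
      rw [integral_div, integral_sub (integrable_const _) hib, hDe]
      simp only [integral_const, probReal_univ, one_smul]
      field_simp
    rw [integral_add hψ1 (integrable_const _), e1]
    simp only [lyapunov, if_neg hp, integral_const, probReal_univ, one_smul]
    linarith

/-- Shows that capping the increments at a high level changes their drift arbitrarily little. -/
lemma tendsto_integral_min {Z : Type*} [MeasurableSpace Z] {μ : Measure Z} [IsFiniteMeasure μ]
    {f : Z → ℝ} (hf : Integrable f μ) :
    Tendsto (fun n : ℕ => ∫ x, min (f x) n ∂μ) atTop (𝓝 (∫ x, f x ∂μ)) := by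
  refine tendsto_integral_of_dominated_convergence (fun x => |f x|)
    (fun n => (hf.inf (integrable_const (n : ℝ))).aestronglyMeasurable) hf.abs
    (fun n => ae_of_all _ fun x => ?_) (ae_of_all _ fun x => ?_)
  · rw [Real.norm_eq_abs, abs_le]
    have h1 : (0 : ℝ) ≤ n := by positivity
    exact ⟨le_min (neg_abs_le _) (by linarith [abs_nonneg (f x)]),
      (min_le_left _ _).trans (le_abs_self _)⟩
  · refine tendsto_const_nhds.congr' ?_
    filter_upwards [eventually_ge_atTop ⌈f x⌉₊] with n hn
    exact (min_eq_left (Nat.ceil_le.1 hn)).symm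

/-- A positive mean forces positive steps with positive probability, and there the integrand is
below 1. Thus `1 - g > 0`, and a finite `κ` can pay for a round through the units. -/
lemma integral_min_one_exp_neg_lt_one {μ : Measure ℝ} [IsProbabilityMeasure μ]
    (h : 0 < ∫ x, x ∂μ) : ∫ x, min 1 (Real.exp (-x)) ∂μ < 1 := by
  have hi : Integrable (fun x : ℝ => min 1 (Real.exp (-x))) μ := by
    refine (integrable_const (1 : ℝ)).mono' (by fun_prop) (ae_of_all _ fun x => ?_)
    rw [Real.norm_of_nonneg (by positivity)]
    exact min_le_left _ _
  have hle : ∫ x, min 1 (Real.exp (-x)) ∂μ ≤ 1 := by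
    calc ∫ x, min 1 (Real.exp (-x)) ∂μ ≤ ∫ _, (1 : ℝ) ∂μ :=
          integral_mono hi (integrable_const _) fun x => min_le_left _ _
      _ = 1 := by simp
  refine lt_of_le_of_ne hle fun he => ?_
  have h0 : ∫ x, (1 - min 1 (Real.exp (-x))) ∂μ = 0 := by
    rw [integral_sub (integrable_const _) hi, he]; simp
  rw [integral_eq_zero_iff_of_nonneg (fun x => sub_nonneg.2 (min_le_left _ _))
    ((integrable_const _).sub hi)] at h0
  refine absurd h (not_lt.2 (integral_nonpos_of_ae ?_))
  filter_upwards [h0] with x hx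
  by_contra hc
  have h1 : Real.exp (-x) < 1 := Real.exp_lt_one_iff.2 (by simpa using hc)
  simp only [Pi.zero_apply, min_eq_right h1.le] at hx
  linarith

end Lyapunov

/-! ### Upper bound on the delay of the Round Robin CUSUM -/

section DelayRoundRobin

variable {K m : ℕ} {𝒳 : Type v} [MeasurableSpace 𝒳] {F G : ProbabilityMeasure (Fin K → 𝒳)}
  {𝒢 : Set (ProbabilityMeasure (Fin K → 𝒳))} {N : ℕ} {u : Fin N → Subsets K m}

lemma localLaw_map_eq_ite [DecidablePred fun d => u d ∈ affected m F G] {μ₀ μ₁ : Measure ℝ}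
    (hμ₀ : ∀ d, (localLaw F (u d)).map (xi F 𝒢 (u d)) = μ₀)
    (hμ₁ : ∀ d, u d ∈ affected m F G → (localLaw G (u d)).map (xi F 𝒢 (u d)) = μ₁) (d : Fin N) :
    (localLaw G (u d)).map (xi F 𝒢 (u d)) = if u d ∈ affected m F G then μ₁ else μ₀ := by
  split_ifs with h
  · exact hμ₁ d h
  · rw [show localLaw G (u d) = localLaw F (u d) from not_not.1 h, hμ₀]

variable [NeZero N]

/-- The worst-case delay of the Round Robin CUSUM is at most of the order of the threshold divided
by the drift after the change. -/
theorem exists_delay_roundRobin_le {μ₀ μ₁ : Measure ℝ} [IsProbabilityMeasure μ₀]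
    [IsProbabilityMeasure μ₁] (hμ₀ : ∀ d, (localLaw F (u d)).map (xi F 𝒢 (u d)) = μ₀)
    (hμ₁ : ∀ d, u d ∈ affected m F G → (localLaw G (u d)).map (xi F 𝒢 (u d)) = μ₁)
    (haff : ∃ d, u d ∈ affected m F G)
    (hi₀ : Integrable (fun x => x) μ₀) (hneg : ∫ x, x ∂μ₀ < 0)
    (he₀ : Integrable Real.exp μ₀) (he₀1 : ∫ x, Real.exp x ∂μ₀ = 1)
    (hi₁ : Integrable (fun x => x) μ₁) {I : ℝ} (hI : ∫ x, x ∂μ₁ = I) (hI0 : 0 < I)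
    (he₁ : Integrable (fun x => Real.exp (-x)) μ₁) (he₁1 : ∫ x, Real.exp (-x) ∂μ₁ ≤ 1)
    {η : ℝ} (hη : 0 < η) : ∃ A₁ : ℝ, ∀ A ≥ A₁,
      delay F G (roundRobin.{v, w} F 𝒢 u A) ≤ ENNReal.ofReal ((1 + η) * A / I) := by
  classical
  -- The cap `b` bounds the overshoot, at the price of a factor at most `1 + η / 3` in the drift.
  -- The excess `η` is spent in thirds: on this loss, on the constants `C`, and on the height of an
  -- unaffected unit.
  obtain ⟨b, hb⟩ : ∃ b : ℕ, I / (1 + η / 3) < ∫ x, min x (b : ℝ) ∂μ₁ := by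
    refine ((tendsto_integral_min hi₁).eventually_const_lt ?_).exists
    rw [hI]
    exact div_lt_self hI0 (by linarith)
  obtain ⟨c, hc⟩ : ∃ c : ℕ, 0 < ∫ x, min (-x) (c : ℝ) ∂μ₀ := by
    refine ((tendsto_integral_min hi₀.neg).eventually_const_lt ?_).exists
    simp only [Pi.neg_apply]
    rw [integral_neg]
    linarith
  have hg := integral_min_one_exp_neg_lt_one (hI ▸ hI0)
  obtain ⟨k, hk⟩ := exists_cyclic_distance haff
  obtain ⟨M, hM⟩ : ∃ M : ℕ, ∀ d, k d ≤ M :=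
    ⟨Finset.univ.sup k, fun d => Finset.le_sup (Finset.mem_univ d)⟩
  generalize hJe : ∫ x, min x (b : ℝ) ∂μ₁ = J at hb
  generalize hDe : ∫ x, min (-x) (c : ℝ) ∂μ₀ = D at hc
  generalize hge : ∫ x, min 1 (Real.exp (-x)) ∂μ₁ = g at hg
  have hJ : 0 < J := lt_trans (by positivity) hb
  have hg1 : 0 < 1 - g := by linarith
  set L : ℝ := M * c / D with hL
  have hL0 : 0 ≤ L := by positivity
  have hkL : ∀ d, k d * (c : ℝ) / D ≤ L := fun d => by
    rw [hL]
    gcongr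
    exact_mod_cast hM d
  -- Chosen so that the gap between `κ` and `κ * g` equals `L`, the largest cost of returning to an
  -- affected unit.
  set κ : ℝ := L / (1 - g) with hκe
  have hκ : 0 ≤ κ := by positivity
  have hκg : κ * (1 - g) = L := div_mul_cancel₀ _ hg1.ne'
  have hε : 0 < η * D / (3 * I) := by positivity
  obtain ⟨A₀, hA₀⟩ := strip_height_le he₀ he₀1 hneg.ne hε
  set C : ℝ := b / J + κ + L with hC
  refine ⟨max (max A₀ 1) (3 * I * C / η), fun A hA => ?_⟩
  have hAA₀ : A₀ ≤ A := (le_max_left _ _).trans ((le_max_left _ _).trans hA)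
  have hA1 : 1 ≤ A := (le_max_right _ _).trans ((le_max_left _ _).trans hA)
  have hAC : 3 * I * C / η ≤ A := (le_max_right _ _).trans hA
  have hA0 : 0 < A := by linarith
  set B : ℝ := (A + b) / J + κ + L with hB
  have hB0 : 0 ≤ B := by positivity
  have hfinal : B + D⁻¹ * (η * D / (3 * I) * A) ≤ (1 + η) * A / I := by
    have h1 : A / J ≤ A * (1 + η / 3) / I := by
      rw [div_le_div_iff₀ hJ hI0, mul_assoc]
      rw [div_lt_iff₀ (by positivity)] at hb
      gcongr
      linarith
    have h2 : C ≤ η * A / (3 * I) := by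
      rw [div_le_iff₀ hη] at hAC
      rw [le_div_iff₀ (by positivity)]
      linarith
    have h3 : B = A / J + C := by rw [hB, hC]; ring
    have h4 : D⁻¹ * (η * D / (3 * I) * A) = η * A / (3 * I) := by field_simp
    have h5 : A * (1 + η / 3) / I + η * A / (3 * I) + η * A / (3 * I) = (1 + η) * A / I := by
      field_simp
      ring
    linarith
  refine le_trans (delay_le _ fun ν s hs => ?_) (ENNReal.ofReal_le_ofReal hfinal)
  set P : Measure (PUnit.{w + 1} × Path K 𝒳) :=
    (Measure.dirac PUnit.unit).prod (changeLaw F G ν) with hP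
  have hsh := partialHistory_le rrSample_adapted _ ν _ hs
  set Φ : Fin N × ℝ → ℝ := lyapunov (fun d => u d ∈ affected m F G) k (A + b) c J D g κ with hΦ
  set h : Fin N × ℝ → ℝ≥0∞ := {q : Fin N × ℝ | u q.1 ∉ affected m F G}.indicator
    (fun q => ENNReal.ofReal (max q.2 0)) with hh
  have hpt : ∀ q, ENNReal.ofReal (Φ q) ≤ ENNReal.ofReal B + ENNReal.ofReal D⁻¹ * h q := by
    intro q
    refine (ENNReal.ofReal_le_ofReal (lyapunov_le hJ hg.le hκ hkL hL0 q)).trans ?_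
    refine ENNReal.ofReal_add_le.trans (add_le_add le_rfl ?_)
    rw [div_eq_inv_mul, ENNReal.ofReal_mul (by positivity)]
    by_cases hq : u q.1 ∈ affected m F G
    · simp [hq]
    · simp [hh, hq]
  calc ∫⁻ ω in s ∩ {ω | (ν : ℕ∞) < rrStop F 𝒢 u A ω}, ((rrStop F 𝒢 u A ω : ℝ≥0∞) - (ν : ℝ≥0∞)) ∂P
      ≤ ∫⁻ ω in s ∩ {ω | (ν : ℕ∞) < rrStop F 𝒢 u A ω}, ENNReal.ofReal (Φ (state F 𝒢 u ω.2 ν)) ∂P :=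
        setLIntegral_rrStop_sub_le (localLaw_map_eq_ite hμ₀ hμ₁) hA0
          measurable_lyapunov.ennreal_ofReal (fun q hq => lyapunov_drift hk (Nat.cast_nonneg c)
            (Nat.cast_nonneg b) hi₀ hi₁ he₁ he₁1 hJ hJe hc hDe hge hκ (fun d => hκg ▸ hkL d)
            hA0 hq) hsh
    _ ≤ ∫⁻ ω in s ∩ {ω | (ν : ℕ∞) < rrStop F 𝒢 u A ω},
          (ENNReal.ofReal B + ENNReal.ofReal D⁻¹ * h (state F 𝒢 u ω.2 ν)) ∂P :=
        lintegral_mono fun ω => hpt _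
    _ = ENNReal.ofReal B * P (s ∩ {ω | (ν : ℕ∞) < rrStop F 𝒢 u A ω}) + ENNReal.ofReal D⁻¹ *
          ∫⁻ ω in s ∩ {ω | (ν : ℕ∞) < rrStop F 𝒢 u A ω}, h (state F 𝒢 u ω.2 ν) ∂P := by
        rw [lintegral_add_left measurable_const, setLIntegral_const,
          lintegral_const_mul' _ _ ENNReal.ofReal_ne_top]
    _ ≤ ENNReal.ofReal B * P (s ∩ {ω | (ν : ℕ∞) < rrStop F 𝒢 u A ω}) + ENNReal.ofReal D⁻¹ *
          (ENNReal.ofReal (η * D / (3 * I) * A) *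
            P (s ∩ {ω | (ν : ℕ∞) < rrStop F 𝒢 u A ω})) := by
        gcongr
        exact setLIntegral_height_le hμ₀ (hA₀ A hAA₀) hs
    _ = ENNReal.ofReal (B + D⁻¹ * (η * D / (3 * I) * A)) *
          P (s ∩ {ω | (ν : ℕ∞) < rrStop F 𝒢 u A ω}) := by
        rw [ENNReal.ofReal_add hB0 (by positivity), ENNReal.ofReal_mul (p := D⁻¹) (by positivity)]
        ring

end DelayRoundRobin

/-! ### Laws of the log-likelihood ratio -/

section Llr

variable {Z : Type*} [MeasurableSpace Z] {P Q : Measure Z} [IsProbabilityMeasure P]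
  [IsProbabilityMeasure Q]

lemma lintegral_exp_llr (h : P ≪ Q) (h' : Q ≪ P) :
    ∫⁻ z, ENNReal.ofReal (Real.exp (llr P Q z)) ∂Q = 1 := by
  have := congrArg (fun μ => μ Set.univ) (withDensity_exp_llr h h')
  simpa [withDensity_apply _ MeasurableSet.univ] using this

/-- The law of the log-likelihood ratio of `P` against `Q` under `Q`, when `P` and `Q` are distinct
and both divergences are finite. -/
lemma map_llr_null (hPQ : InformationTheory.klDiv P Q < ∞) (hQP : InformationTheory.klDiv Q P < ∞)
    (hne : P ≠ Q) :
    Integrable (fun x => x) (Q.map (llr P Q)) ∧ ∫ x, x ∂(Q.map (llr P Q)) < 0 ∧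
      ∫⁻ x, ENNReal.ofReal (Real.exp x) ∂(Q.map (llr P Q)) = 1 := by
  obtain ⟨hac, hi⟩ := InformationTheory.klDiv_ne_top_iff.1 hPQ.ne
  obtain ⟨hac', hi'⟩ := InformationTheory.klDiv_ne_top_iff.1 hQP.ne
  have hm := measurable_llr P Q
  have hneg := neg_llr hac'
  refine ⟨?_, ?_, ?_⟩
  · refine (integrable_map_measure measurable_id.aestronglyMeasurable hm.aemeasurable).2 ?_
    refine hi'.neg.congr ?_
    exact hneg
  · rw [integral_map (f := fun x : ℝ => x) hm.aemeasurable measurable_id'.aestronglyMeasurable]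
    have h1 : ∫ z, llr P Q z ∂Q = - ∫ z, llr Q P z ∂Q := by
      rw [← integral_neg]
      exact integral_congr_ae hneg.symm
    rw [h1, ← InformationTheory.toReal_klDiv_of_measure_eq hac' (by simp), neg_neg_iff_pos]
    refine ENNReal.toReal_pos (fun h0 => hne ?_) hQP.ne
    exact (InformationTheory.klDiv_eq_zero_iff.1 h0).symm
  · rw [lintegral_map (by fun_prop) hm]
    exact lintegral_exp_llr hac hac'

/-- The law of the log-likelihood ratio of `P` against `Q` under `P`, when both divergences are
finite. -/
lemma map_llr_alternative (hPQ : InformationTheory.klDiv P Q < ∞)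
    (hQP : InformationTheory.klDiv Q P < ∞) :
    Integrable (fun x => x) (P.map (llr P Q)) ∧
      ∫ x, x ∂(P.map (llr P Q)) = (InformationTheory.klDiv P Q).toReal ∧
      ∫⁻ x, ENNReal.ofReal (Real.exp (-x)) ∂(P.map (llr P Q)) = 1 := by
  obtain ⟨hac, hi⟩ := InformationTheory.klDiv_ne_top_iff.1 hPQ.ne
  obtain ⟨hac', hi'⟩ := InformationTheory.klDiv_ne_top_iff.1 hQP.ne
  have hm := measurable_llr P Q
  refine ⟨?_, ?_, ?_⟩
  · exact (integrable_map_measure measurable_id.aestronglyMeasurable hm.aemeasurable).2 hi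
  · rw [integral_map (f := fun x : ℝ => x) hm.aemeasurable measurable_id'.aestronglyMeasurable]
    exact (InformationTheory.toReal_klDiv_of_measure_eq hac (by simp)).symm
  · rw [lintegral_map (by fun_prop) hm, ← lintegral_exp_llr hac' hac]
    refine lintegral_congr_ae ?_
    filter_upwards [neg_llr hac] with z hz
    rw [← hz, Pi.neg_apply]

/-- The law of the log-likelihood ratio is invariant under measurable isomorphisms. -/
lemma map_llr_map {Z' : Type*} [MeasurableSpace Z'] (e : Z ≃ᵐ Z') {R : Measure Z} (hR : R ≪ Q) :
    (R.map e).map (llr (P.map e) (Q.map e)) = R.map (llr P Q) := by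
  rw [Measure.map_map (measurable_llr _ _) e.measurable]
  -- The densities before and after the isomorphism agree only `Q`-almost everywhere, hence the need
  -- for `R ≪ Q`.
  refine Measure.map_congr (hR.ae_le ?_)
  filter_upwards [e.measurableEmbedding.rnDeriv_map P Q] with z hz
  simp only [Function.comp, llr, hz]

end Llr

lemma integrable_of_lintegral_ofReal_eq_one {Z : Type*} [MeasurableSpace Z] {μ : Measure Z}
    {f : Z → ℝ} (hf : Measurable f) (h0 : ∀ x, 0 ≤ f x) (h : ∫⁻ x, ENNReal.ofReal (f x) ∂μ = 1) :
    Integrable f μ ∧ ∫ x, f x ∂μ = 1 := by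
  refine ⟨⟨hf.aestronglyMeasurable, ?_⟩, ?_⟩
  · rw [hasFiniteIntegral_iff_ofReal (ae_of_all _ h0), h]
    exact ENNReal.one_lt_top
  · rw [integral_eq_lintegral_of_nonneg_ae (ae_of_all _ h0) hf.aestronglyMeasurable, h]
    rfl

/-! ### Homogeneous units have a single alternative -/

section Homogeneity

variable {K m : ℕ} {𝒳 : Type v} [MeasurableSpace 𝒳] {F G : ProbabilityMeasure (Fin K → 𝒳)}
  {𝒢 : Set (ProbabilityMeasure (Fin K → 𝒳))} {U : Finset (Subsets K m)}
  {Fs Gs : Measure (Fin m → 𝒳)}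

/-- Under homogeneity every unit has a single plausible post-change local distribution. -/
lemma Homogeneous.exists_mixture_eq (hhom : Homogeneous F 𝒢 U Fs Gs) {E : Subsets K m} (hE : E ∈ U)
    (hne : (postFamily F 𝒢 E).Nonempty) :
    ∃ G' ∈ 𝒢, E ∈ affected m F G' ∧ mixture F 𝒢 E = localLaw G' E ∧
      (∀ G ∈ 𝒢, E ∈ affected m F G → localLaw G E = localLaw G' E) ∧
      ∃ e : (Fin m → 𝒳) ≃ᵐ (Fin m → 𝒳),
        (localLaw F E).map e = Fs ∧ (localLaw G' E).map e = Gs := by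
  obtain ⟨σ, hF, hG⟩ := hhom E hE
  obtain ⟨Q, G', hG', hQ, hQF⟩ := hne
  have hG'E : E ∈ affected m F G' := by
    change localLaw G' E ≠ _
    rwa [hQ]
  let e : (Fin m → 𝒳) ≃ᵐ (Fin m → 𝒳) :=
    { toFun := fun y i => y (σ i)
      invFun := fun y i => y (σ.symm i)
      left_inv := fun y => by simp
      right_inv := fun y => by simp
      measurable_toFun := by
        change Measurable fun (y : Fin m → 𝒳) i => y (σ i)
        fun_prop
      measurable_invFun := by
        change Measurable fun (y : Fin m → 𝒳) i => y (σ.symm i)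
        fun_prop }
  -- Relisting the sources is a measurable isomorphism, so equal images force equal laws.
  have huniq : ∀ G ∈ 𝒢, E ∈ affected m F G → localLaw G E = localLaw G' E := by
    intro G hGm hGE
    have h1 : (localLaw G E).map e = (localLaw G' E).map e :=
      (hG G hGm hGE).trans (hG G' hG' hG'E).symm
    exact e.map_measurableEquiv_injective h1
  refine ⟨G', hG', hG'E, ?_, huniq, e, hF, hG G' hG' hG'E⟩
  have hsing : postFamily F 𝒢 E = {localLaw G' E} := by
    refine Set.eq_singleton_iff_unique_mem.2 ⟨⟨G', hG', rfl, hG'E⟩, ?_⟩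
    rintro _ ⟨G, hGm, rfl, hGE⟩
    exact huniq G hGm hGE
  rw [mixture, hsing, Set.ncard_singleton, Nat.cast_one, inv_one, one_smul]
  ext s hs
  rw [Measure.sum_apply _ hs, tsum_fintype]
  simp

end Homogeneity

/-! ### From matching bounds to asymptotic optimality -/

section Optimality

variable {K m : ℕ} {𝒳 : Type v} [MeasurableSpace 𝒳] {F G : ProbabilityMeasure (Fin K → 𝒳)}
  {𝒢 : Set (ProbabilityMeasure (Fin K → 𝒳))} {N : ℕ} [NeZero N] {u : Fin N → Subsets K m}

/-- Matching first-order bounds on the worst-case delay give asymptotic optimality. -/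
lemma asymptoticallyOptimal_of_bounds {I : ℝ} (hI : 0 < I)
    (hmem : ∀ γ : ℝ, 0 < γ → roundRobin.{v, w} F 𝒢 u (Real.log γ) ∈ Delta.{v, w} m F γ)
    (hlow : ∀ ε : ℝ, 0 < ε → ε < 1 → ∀ᶠ γ : ℝ in atTop, ∀ π ∈ Delta.{v, w} m F γ,
      ENNReal.ofReal ((1 - ε) * Real.log γ / I) ≤ delay F G π)
    (hup : ∀ η : ℝ, 0 < η → ∃ A₁ : ℝ, ∀ A ≥ A₁,
      delay F G (roundRobin.{v, w} F 𝒢 u A) ≤ ENNReal.ofReal ((1 + η) * A / I)) :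
    AsymptoticallyOptimal.{v, w} F 𝒢 u G := by
  have hbounds : ∀ ε : ℝ, 0 < ε → ε < 1 → ∀ᶠ γ : ℝ in atTop,
      1 ≤ delay F G (roundRobin.{v, w} F 𝒢 u (Real.log γ)) / ⨅ π ∈ Delta.{v, w} m F γ, delay F G π ∧
      delay F G (roundRobin.{v, w} F 𝒢 u (Real.log γ)) / (⨅ π ∈ Delta.{v, w} m F γ, delay F G π) ≤
        ENNReal.ofReal ((1 + ε) / (1 - ε)) := by
    intro ε hε hε1
    obtain ⟨A₁, hA₁⟩ := hup ε hε
    filter_upwards [hlow ε hε hε1, eventually_gt_atTop 1,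
      Real.tendsto_log_atTop.eventually_ge_atTop A₁] with γ h1 hγ h2
    have hlog : 0 < Real.log γ := Real.log_pos hγ
    have hε' : 0 < 1 - ε := by linarith
    have h3 : (⨅ π ∈ Delta.{v, w} m F γ, delay F G π) ≤
        delay F G (roundRobin.{v, w} F 𝒢 u (Real.log γ)) := iInf₂_le _ (hmem γ (by linarith))
    have h4 : ENNReal.ofReal ((1 - ε) * Real.log γ / I) ≤
        ⨅ π ∈ Delta.{v, w} m F γ, delay F G π := le_iInf₂ h1
    have h5 := hA₁ _ h2
    have h6 : 0 < (1 - ε) * Real.log γ / I := by positivity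
    have h7 : (⨅ π ∈ Delta.{v, w} m F γ, delay F G π) ≠ 0 :=
      ((ENNReal.ofReal_pos.2 h6).trans_le h4).ne'
    have h8 : (⨅ π ∈ Delta.{v, w} m F γ, delay F G π) ≠ ∞ :=
      ((h3.trans h5).trans_lt ENNReal.ofReal_lt_top).ne
    refine ⟨?_, ?_⟩
    · rw [ENNReal.le_div_iff_mul_le (Or.inl h7) (Or.inl h8), one_mul]
      exact h3
    · refine (ENNReal.div_le_div h5 h4).trans (le_of_eq ?_)
      rw [← ENNReal.ofReal_div_of_pos h6]
      congr 1
      field_simp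
  refine tendsto_order.2 ⟨fun a ha => ?_, fun a ha => ?_⟩
  · filter_upwards [hbounds (1 / 2) (by norm_num) (by norm_num)] with γ hγ
    exact ha.trans_le hγ.1
  · obtain ⟨r, hr1, hra⟩ := ENNReal.lt_iff_exists_nnreal_btwn.1 ha
    have hr : (1 : ℝ) < r := by exact_mod_cast hr1
    -- This ε solves (1 + ε) / (1 - ε) = r.
    filter_upwards [hbounds ((r - 1) / (r + 1)) (div_pos (by linarith) (by linarith))
      ((div_lt_one (by linarith)).2 (by linarith))] with γ hγ
    refine hγ.2.trans_lt (lt_of_eq_of_lt ?_ hra)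
    have h1 : (r : ℝ) + 1 ≠ 0 := by positivity
    have : (1 + ((r : ℝ) - 1) / (r + 1)) / (1 - (r - 1) / (r + 1)) = r := by
      have h2 : 1 - ((r : ℝ) - 1) / (r + 1) = 2 / (r + 1) := by field_simp; ring
      rw [h2]
      field_simp
      ring
    rw [this, ENNReal.ofReal_coe_nnreal]

end Optimality

/-! ### Increments and divergences of the units -/

section Units

variable {K m : ℕ} {𝒳 : Type v} [MeasurableSpace 𝒳] {F G : ProbabilityMeasure (Fin K → 𝒳)}
  {𝒢 : Set (ProbabilityMeasure (Fin K → 𝒳))} {U : Finset (Subsets K m)}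
  {Fs Gs : Measure (Fin m → 𝒳)}

/-- An affected unit exhibits `Fs` and `Gs` as images, under one isomorphism, of two distinct local
laws. -/
lemma Homogeneous.isProbabilityMeasure_and_ne (hhom : Homogeneous F 𝒢 U Fs Gs) (hG : G ∈ 𝒢)
    (haff : ∃ E ∈ U, E ∈ affected m F G) :
    IsProbabilityMeasure Fs ∧ IsProbabilityMeasure Gs ∧ Gs ≠ Fs := by
  obtain ⟨E, hE, hEa⟩ := haff
  obtain ⟨G', -, hGa, -, -, e, rfl, rfl⟩ :=
    hhom.exists_mixture_eq hE ⟨localLaw G E, G, hG, rfl, hEa⟩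
  exact ⟨Measure.isProbabilityMeasure_map e.measurable.aemeasurable,
    Measure.isProbabilityMeasure_map e.measurable.aemeasurable,
    fun h => hGa (e.map_measurableEquiv_injective h)⟩

/-- Under homogeneity the increments of the statistic of a unit have the same law for all units
before the change, and for all affected units after it. -/
lemma Homogeneous.map_xi (hhom : Homogeneous F 𝒢 U Fs Gs)
    (hac : ∀ G ∈ 𝒢, ∀ E ∈ affected m F G,
      localLaw G E ≪ localLaw F E ∧ localLaw F E ≪ localLaw G E)
    {E : Subsets K m} (hE : E ∈ U) (hne : (postFamily F 𝒢 E).Nonempty) :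
    (localLaw F E).map (xi F 𝒢 E) = Fs.map (llr Gs Fs) ∧
      (∀ G ∈ 𝒢, E ∈ affected m F G →
        (localLaw G E).map (xi F 𝒢 E) = Gs.map (llr Gs Fs) ∧
        xi F 𝒢 E = llr (localLaw G E) (localLaw F E)) ∧
      -xi F 𝒢 E =ᵐ[localLaw F E] llr (localLaw F E) (mixture F 𝒢 E) := by
  obtain ⟨G', hG', hGa, hmix, huniq, e, rfl, rfl⟩ := hhom.exists_mixture_eq hE hne
  have hxi : xi F 𝒢 E = llr (localLaw G' E) (localLaw F E) := by rw [xi, hmix]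
  refine ⟨?_, fun G hG hE' => ?_, ?_⟩
  · rw [hxi, map_llr_map e .rfl]
  · rw [huniq G hG hE', hxi, map_llr_map e (hac G' hG' E hGa).1]
    exact ⟨rfl, rfl⟩
  · rw [hxi, hmix]
    have h := neg_llr (hac G' hG' E hGa).2
    filter_upwards [h] with z hz
    rw [Pi.neg_apply, ← hz, Pi.neg_apply, neg_neg]

lemma integrable_llr_of_secondMoment (hSM : SecondMoment F m G) {E : Subsets K m}
    (hE : E ∈ affected m F G) :
    Integrable (llr (localLaw G E) (localLaw F E)) (localLaw G E) :=
  ((memLp_two_iff_integrable_sq (stronglyMeasurable_llr _ _).aestronglyMeasurable).2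
    (hSM E hE)).integrable one_le_two

/-- An upper bound on the divergences of the affected sets bounds the drift of all sets. -/
lemma integral_llr_le (hac : ∀ E ∈ affected m F G, localLaw G E ≪ localLaw F E)
    {b : ℝ≥0∞} (hb : b ≠ ∞) (h : ∀ E ∈ affected m F G, info F G E ≤ b) (E : Subsets K m) :
    ∫ z, llr (localLaw G E) (localLaw F E) z ∂(localLaw G E) ≤ b.toReal := by
  by_cases hE : E ∈ affected m F G
  · rw [← InformationTheory.toReal_klDiv_of_measure_eq (hac E hE) (by simp)]
    exact ENNReal.toReal_mono hb (h E hE)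
  · rw [show localLaw G E = localLaw F E from not_not.1 hE, integral_congr_ae (llr_self _)]
    simp

end Units

end RoundRobin

/-! ### The corollary -/

theorem corollary2 {K m : ℕ} {𝒳 : Type v} [MeasurableSpace 𝒳]
    (F : ProbabilityMeasure (Fin K → 𝒳)) (𝒢 : Set (ProbabilityMeasure (Fin K → 𝒳)))
    (hac : ∀ G ∈ 𝒢, ∀ E ∈ RoundRobin.affected m F G,
      RoundRobin.localLaw G E ≪ RoundRobin.localLaw F E ∧
      RoundRobin.localLaw F E ≪ RoundRobin.localLaw G E)
    (U : Finset (RoundRobin.Subsets K m))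
    (hU : ∀ E ∈ U, (RoundRobin.postFamily F 𝒢 E).Nonempty ∧ (RoundRobin.postFamily F 𝒢 E).Finite)
    {N : ℕ} [NeZero N] (u : Fin N ≃ {E // E ∈ U})
    (G : ProbabilityMeasure (Fin K → 𝒳)) (hG : G ∈ 𝒢)
    (haff : ∃ E ∈ U, E ∈ RoundRobin.affected m F G)
    (Fs Gs : Measure (Fin m → 𝒳))
    (hhom : RoundRobin.Homogeneous F 𝒢 U Fs Gs)
    (hGF : InformationTheory.klDiv Gs Fs < ∞)
    (hFG : InformationTheory.klDiv Fs Gs < ∞) :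
    (RoundRobin.PreChangeDrift F 𝒢 U ∧ RoundRobin.PostChangeDrift F 𝒢 U G) ∧
    (RoundRobin.SecondMoment F m G →
      ((∀ E : RoundRobin.Subsets K m, E ∈ U) ∨
        (⨆ E ∈ RoundRobin.affected m F G, RoundRobin.info F G E) =
          InformationTheory.klDiv Gs Fs) →
      RoundRobin.AsymptoticallyOptimal.{v, w} F 𝒢 (fun d => (u d : RoundRobin.Subsets K m)) G) := by
  obtain ⟨hFs, hGs, hne⟩ := hhom.isProbabilityMeasure_and_ne hG haff
  obtain ⟨hi₀, hneg, he₀⟩ := RoundRobin.map_llr_null hGF hFG hne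
  obtain ⟨hi₁, hI, he₁⟩ := RoundRobin.map_llr_alternative hGF hFG
  have hI0 : 0 < (InformationTheory.klDiv Gs Fs).toReal :=
    ENNReal.toReal_pos (fun h => hne (InformationTheory.klDiv_eq_zero_iff.1 h)) hGF.ne
  have hxi := fun E (hE : E ∈ U) => hhom.map_xi hac hE (hU E hE).1
  have hm : ∀ E : RoundRobin.Subsets K m, AEMeasurable (RoundRobin.xi F 𝒢 E) (RoundRobin.localLaw F E) := fun E =>
    (RoundRobin.measurable_xi F 𝒢 E).aemeasurable
  have hm' : ∀ E : RoundRobin.Subsets K m, AEMeasurable (RoundRobin.xi F 𝒢 E) (RoundRobin.localLaw G E) := fun E =>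
    (RoundRobin.measurable_xi F 𝒢 E).aemeasurable
  refine ⟨⟨fun E hE => ?_, fun E hE hEa => ?_⟩, fun hSM hsup => ?_⟩
  · obtain ⟨h0, -, hn⟩ := hxi E hE
    have h1 : Integrable (RoundRobin.xi F 𝒢 E) (RoundRobin.localLaw F E) := by
      rw [← h0] at hi₀
      exact (integrable_map_measure measurable_id'.aestronglyMeasurable (hm E)).1 hi₀
    have h2 : ∫ y, RoundRobin.xi F 𝒢 E y ∂(RoundRobin.localLaw F E) < 0 := by
      rw [← h0, integral_map (f := fun x : ℝ => x) (hm E) measurable_id'.aestronglyMeasurable]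
        at hneg
      exact hneg
    have h3 := integral_congr_ae hn
    simp only [Pi.neg_apply] at h3
    rw [integral_neg] at h3
    exact ⟨h1, h1.neg.congr hn, by linarith, by linarith⟩
  · obtain ⟨h1, -⟩ := (hxi E hE).2.1 G hG hEa
    rw [← h1] at hi₁ hI
    rw [integral_map (f := fun x : ℝ => x) (hm' E) measurable_id'.aestronglyMeasurable] at hI
    exact ⟨(integrable_map_measure measurable_id'.aestronglyMeasurable (hm' E)).1 hi₁,
      hI ▸ hI0⟩
  · have hμ₀ := fun d => (hxi (u d) (u d).2).1
    have hμ₁ := fun d hd => ((hxi (u d) (u d).2).2.1 G hG hd).1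
    have hmeas := measurable_llr Gs Fs
    have hp₀ : IsProbabilityMeasure (Fs.map (llr Gs Fs)) :=
      Measure.isProbabilityMeasure_map hmeas.aemeasurable
    have hp₁ : IsProbabilityMeasure (Gs.map (llr Gs Fs)) :=
      Measure.isProbabilityMeasure_map hmeas.aemeasurable
    obtain ⟨hei₀, hei₀1⟩ := RoundRobin.integrable_of_lintegral_ofReal_eq_one Real.measurable_exp
      (fun x => (Real.exp_pos x).le) he₀
    obtain ⟨hei₁, hei₁1⟩ := RoundRobin.integrable_of_lintegral_ofReal_eq_one
      (Real.measurable_exp.comp measurable_neg) (fun x => (Real.exp_pos (-x)).le) he₁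
    have haff' : ∃ d, (u d : RoundRobin.Subsets K m) ∈ RoundRobin.affected m F G := by
      obtain ⟨E, hE, hEa⟩ := haff
      exact ⟨u.symm ⟨E, hE⟩, by simpa using hEa⟩
    -- The bound that the lower estimate needs: no affected set, unit or not, carries more
    -- information than KL(G*‖F*).
    have hinfo : ∀ E ∈ RoundRobin.affected m F G,
        RoundRobin.info F G E ≤ InformationTheory.klDiv Gs Fs := by
      intro E hEa
      rcases hsup with hall | hsup
      · obtain ⟨h1, h2⟩ := (hxi E (hall E)).2.1 G hG hEa
        -- Equality of the real parts determines the divergences only once both are finite; here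
        -- finiteness comes from the second moment.
        have h3 : RoundRobin.info F G E ≠ ∞ := InformationTheory.klDiv_ne_top (hac G hG E hEa).1
          (RoundRobin.integrable_llr_of_secondMoment hSM hEa)
        refine le_of_eq ((ENNReal.toReal_eq_toReal_iff' h3 hGF.ne).1 ?_)
        rw [← hI, ← h1, RoundRobin.info,
          InformationTheory.toReal_klDiv_of_measure_eq (hac G hG E hEa).1 (by simp),
          integral_map (f := fun x : ℝ => x) (hm' E) measurable_id'.aestronglyMeasurable, h2]
      · rw [← hsup]
        exact le_iSup₂ (f := fun E _ => RoundRobin.info F G E) E hEa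
    refine RoundRobin.asymptoticallyOptimal_of_bounds hI0 (fun γ hγ => ?_) (fun ε hε hε1 => ?_)
      (fun η hη => ?_)
    · have := RoundRobin.exp_le_meanTimeToFalseAlarm.{v, w} hμ₀ he₀ (Real.log γ)
      rwa [Real.exp_log hγ] at this
    · exact RoundRobin.eventually_le_delay (hac G hG) hSM hI0 (RoundRobin.integral_llr_le
        (fun E hE => (hac G hG E hE).1) hGF.ne hinfo) hε hε1
    · exact RoundRobin.exists_delay_roundRobin_le hμ₀ hμ₁ haff' hi₀ hneg hei₀ hei₀1 hi₁ hI hI0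
        hei₁ hei₁1.le hη
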